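/- Let $F$ be a field of characteristic $0$; algebras over $F$ are not assumed associative, commutative or unital. Let $\mathcal V=\mathrm{Alt}^{(2)}$ be the variety of metabelian alternative $F$-algebras, i.e. of the algebras satisfying the identities $(x,x,y)=0$, $(x,y,y)=0$ and $(xy)(zt)=0$, where $(x,y,z)=(xy)z-x(yz)$. A superalgebra is a $\mathbb Z_2$-graded algebra $\mathcal A=\mathcal A_0\oplus\mathcal A_1$, and it is a $\mathcal V$-superalgebra if its Grassmann envelope $\mathrm G_0\otimes\mathcal A_0+\mathrm G_1\otimes\mathcal A_1$ lies in $\mathcal V$, where $\mathrm G=\mathrm G_0\oplus\mathrm G_1$ is the Grassmann algebra on countably many generators. Let $\tilde{\mathcal V}$ be the class of all $\mathcal V$-superalgebras. For a multilinear nonassociative polynomial $f$, a superalgebra satisfies the superidentity $\tilde f=0$ if the polynomial obtained from $f$ by the Koszul sign rule (a factor $-1$ for each pair of odd variables occurring in a monomial in the opposite order) vanishes on all homogeneous elements, for all choices of the parities of the variables. For $r,s\ge 0$ let $\mathcal V_{r,s}$ be the supervariety generated by the free $\mathcal V$-superalgebra on $r$ even and $s$ odd generators, i.e. the class of all superalgebras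 satisfying every superidentity $\tilde f=0$ ($f$ multilinear) of that free superalgebra; in particular $\mathcal V_{0,0}=\{\{0\}\}$. The basic spectrum of $\mathcal V$ is the set of its basic superranks, i.e. of the pairs $(r,s)$ that are minimal, in the componentwise order on pairs of nonnegative integers, among those with $\mathcal V_{r,s}=\tilde{\mathcal V}$. Then the basic spectrum of $\mathrm{Alt}^{(2)}$ is exactly $\{(1,1),(0,3)\}$. Moreover, $\mathrm{Alt}^{(2)}$ has infinite basic rank: for no $r\ge 0$ is it generated, as a variety of algebras, by its free algebra of rank $r$. -/

import Mathlib

open scoped TensorProduct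

noncomputable section

universe u

/-- A (not necessarily unital, associative or commutative) algebra over the field `F`. -/
structure NAAlgebra (F : Type u) [Field F] where
  carrier : Type u
  [ring : NonUnitalNonAssocRing carrier]
  [module : Module F carrier]
  [isScalarTower : IsScalarTower F carrier carrier]
  [smulCommClass : SMulCommClass F carrier carrier]

attribute [instance] NAAlgebra.ring NAAlgebra.module NAAlgebra.isScalarTower
  NAAlgebra.smulCommClass

/-- A superalgebra, i.e. a `ℤ/2`-graded algebra `A = A₀ ⊕ A₁` with `Aᵢ Aⱼ ⊆ Aᵢ₊ⱼ`. -/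
structure Superalgebra (F : Type u) [Field F] extends NAAlgebra F where
  part : ZMod 2 → Submodule F carrier
  isCompl : IsCompl (part 0) (part 1)
  mul_mem : ∀ (i j : ZMod 2) (a b : carrier), a ∈ part i → b ∈ part j → a * b ∈ part (i + j)

/-! ### Ideals and quotients of nonassociative algebras -/

/-- A two-sided ideal of an algebra. -/
structure AlgIdeal {F : Type u} [Field F] (A : NAAlgebra F) extends
    Submodule F A.carrier where
  mul_left_mem : ∀ a x : A.carrier, x ∈ toSubmodule → a * x ∈ toSubmodule
  mul_right_mem : ∀ a x : A.carrier, x ∈ toSubmodule → x * a ∈ toSubmodule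

namespace AlgIdeal

variable {F : Type u} [Field F] {A : NAAlgebra F}

/-- The multiplication of `A ⧸ I` as a bilinear map: `(a + I) (b + I) = a b + I`. -/
def quotMul (I : AlgIdeal A) :
    (A.carrier ⧸ I.toSubmodule) →ₗ[F] (A.carrier ⧸ I.toSubmodule) →ₗ[F]
      (A.carrier ⧸ I.toSubmodule) :=
  I.toSubmodule.liftQ
    (LinearMap.mk₂ F
      (fun (a : A.carrier) (q : A.carrier ⧸ I.toSubmodule) =>
        I.toSubmodule.mapQ I.toSubmodule (LinearMap.mulLeft F a)
          (fun x hx => I.mul_left_mem a x hx) q)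
      (fun a b q => by
        obtain ⟨x, rfl⟩ := I.toSubmodule.mkQ_surjective q
        exact congrArg I.toSubmodule.mkQ (add_mul a b x))
      (fun c a q => by
        obtain ⟨x, rfl⟩ := I.toSubmodule.mkQ_surjective q
        exact congrArg I.toSubmodule.mkQ (smul_mul_assoc c a x))
      (fun a p q => map_add _ p q)
      (fun c a q => map_smul _ c q))
    (fun a ha => by
      rw [LinearMap.mem_ker]
      ext x
      exact (Submodule.Quotient.mk_eq_zero I.toSubmodule).2 (I.mul_right_mem x a ha))

instance (I : AlgIdeal A) : NonUnitalNonAssocRing (A.carrier ⧸ I.toSubmodule) where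
  mul p q := I.quotMul p q
  left_distrib p q r := map_add (I.quotMul p) q r
  right_distrib p q r := LinearMap.map_add₂ I.quotMul p q r
  zero_mul p := LinearMap.map_zero₂ I.quotMul p
  mul_zero p := map_zero (I.quotMul p)

instance (I : AlgIdeal A) :
    IsScalarTower F (A.carrier ⧸ I.toSubmodule) (A.carrier ⧸ I.toSubmodule) where
  smul_assoc c p q := LinearMap.map_smul₂ I.quotMul c p q

instance (I : AlgIdeal A) :
    SMulCommClass F (A.carrier ⧸ I.toSubmodule) (A.carrier ⧸ I.toSubmodule) where
  smul_comm c p q := (map_smul (I.quotMul p) c q).symm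

/-- The quotient algebra `A ⧸ I`. -/
def quot (I : AlgIdeal A) : NAAlgebra F where
  carrier := A.carrier ⧸ I.toSubmodule

/-- The canonical projection `A → A ⧸ I`. -/
def proj (I : AlgIdeal A) : A.carrier →ₗ[F] I.quot.carrier := I.toSubmodule.mkQ

theorem proj_surjective (I : AlgIdeal A) : Function.Surjective I.proj :=
  I.toSubmodule.mkQ_surjective

theorem proj_eq_zero (I : AlgIdeal A) (a : A.carrier) : I.proj a = 0 ↔ a ∈ I.toSubmodule :=
  Submodule.Quotient.mk_eq_zero I.toSubmodule

theorem proj_mul (I : AlgIdeal A) (a b : A.carrier) : I.proj (a * b) = I.proj a * I.proj b := rfl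

/-- The intersection of a set of ideals (the whole algebra if the set is empty). -/
def inter (S : Set (AlgIdeal A)) : AlgIdeal A where
  toSubmodule := ⨅ I ∈ S, I.toSubmodule
  mul_left_mem a x hx := by
    have hx' : x ∈ ⨅ I ∈ S, I.toSubmodule := hx
    change a * x ∈ ⨅ I ∈ S, I.toSubmodule
    simp only [Submodule.mem_iInf] at hx' ⊢
    exact fun I hI => I.mul_left_mem a x (hx' I hI)
  mul_right_mem a x hx := by
    have hx' : x ∈ ⨅ I ∈ S, I.toSubmodule := hx
    change x * a ∈ ⨅ I ∈ S, I.toSubmodule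
    simp only [Submodule.mem_iInf] at hx' ⊢
    exact fun I hI => I.mul_right_mem a x (hx' I hI)

theorem mem_inter (S : Set (AlgIdeal A)) (x : A.carrier) :
    x ∈ (inter S).toSubmodule ↔ ∀ I ∈ S, x ∈ I.toSubmodule := by
  change x ∈ ⨅ I ∈ S, I.toSubmodule ↔ _
  simp only [Submodule.mem_iInf]

end AlgIdeal

namespace Superalgebra

variable {F : Type u} [Field F]

/-- An ideal of a superalgebra is graded if it contains the homogeneous components of each of
its elements. -/
def IsGraded (A : Superalgebra F) (I : AlgIdeal A.toNAAlgebra) : Prop :=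
  ∀ a ∈ A.part 0, ∀ b ∈ A.part 1, a + b ∈ I.toSubmodule →
    a ∈ I.toSubmodule ∧ b ∈ I.toSubmodule

/-- The quotient superalgebra of `A` by a graded ideal `I`, with the parts `(Aᵢ + I) / I`. -/
def quot (A : Superalgebra F) (I : AlgIdeal A.toNAAlgebra) (hI : A.IsGraded I) :
    Superalgebra F where
  toNAAlgebra := I.quot
  part i := (A.part i).map I.proj
  isCompl := by
    constructor
    · rw [Submodule.disjoint_def]
      rintro _ ⟨a, ha, rfl⟩ ⟨b, hb, hab⟩
      rw [AlgIdeal.proj_eq_zero]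
      refine (hI a ha (-b) (Submodule.neg_mem _ hb) ?_).1
      rw [← AlgIdeal.proj_eq_zero, map_add, map_neg, hab, add_neg_cancel]
    · rw [codisjoint_iff, ← Submodule.map_sup, A.isCompl.sup_eq_top, Submodule.map_top,
        LinearMap.range_eq_top]
      exact I.proj_surjective
  mul_mem := by
    rintro i j _ _ ⟨a, ha, rfl⟩ ⟨b, hb, rfl⟩
    exact ⟨a * b, A.mul_mem i j a b ha hb, I.proj_mul a b⟩

theorem isGraded_inter (A : Superalgebra F) (S : Set (AlgIdeal A.toNAAlgebra))
    (hS : ∀ I ∈ S, A.IsGraded I) : A.IsGraded (AlgIdeal.inter S) := by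
  intro a ha b hb hab
  rw [AlgIdeal.mem_inter] at hab
  simp only [AlgIdeal.mem_inter]
  exact ⟨fun I hI => (hS I hI a ha b hb (hab I hI)).1,
    fun I hI => (hS I hI a ha b hb (hab I hI)).2⟩

/-! ### The Grassmann envelope -/

/-- The Grassmann algebra on a countable set of anticommuting generators. -/
abbrev Grassmann (F : Type u) [Field F] : Type u := ExteriorAlgebra F (ℕ →₀ F)

/-- The parts `G₀`, `G₁` of the Grassmann algebra, spanned by the products of an even,
respectively odd, number of vectors of the generating space. -/
abbrev grassmannPart (F : Type u) [Field F] (i : ZMod 2) : Submodule F (Grassmann F) :=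
  CliffordAlgebra.evenOdd (0 : QuadraticForm F (ℕ →₀ F)) i

/-- The subspace `Gᵢ ⊗ Aᵢ` of `G ⊗ A`. -/
def envelopePart (A : Superalgebra F) (i : ZMod 2) :
    Submodule F (Grassmann F ⊗[F] A.carrier) :=
  Submodule.span F {z | ∃ g ∈ grassmannPart F i, ∃ a ∈ A.part i, z = g ⊗ₜ[F] a}

theorem envelopePart_mul (A : Superalgebra F) (i j : ZMod 2)
    {z w : Grassmann F ⊗[F] A.carrier} (hz : z ∈ A.envelopePart i)
    (hw : w ∈ A.envelopePart j) : z * w ∈ A.envelopePart (i + j) := by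
  unfold envelopePart at hz hw
  induction hz, hw using Submodule.span_induction₂ with
  | mem_mem x y hx hy =>
    obtain ⟨g, hg, a, ha, rfl⟩ := hx
    obtain ⟨h, hh, b, hb, rfl⟩ := hy
    rw [Algebra.TensorProduct.tmul_mul_tmul]
    exact Submodule.subset_span ⟨g * h, SetLike.mul_mem_graded hg hh, a * b,
      A.mul_mem i j a b ha hb, rfl⟩
  | zero_left y hy => rw [zero_mul]; exact Submodule.zero_mem _
  | zero_right x hx => rw [mul_zero]; exact Submodule.zero_mem _
  | add_left x y z _ _ _ h₁ h₂ => rw [add_mul]; exact Submodule.add_mem _ h₁ h₂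
  | add_right x y z _ _ _ h₁ h₂ => rw [mul_add]; exact Submodule.add_mem _ h₁ h₂
  | smul_left r x y _ _ h => rw [smul_mul_assoc]; exact Submodule.smul_mem _ r h
  | smul_right r x y _ _ h => rw [mul_smul_comm]; exact Submodule.smul_mem _ r h

/-- The Grassmann envelope `G(A) = G₀ ⊗ A₀ + G₁ ⊗ A₁` as a subalgebra of `G ⊗ A`. -/
def envelopeSubalgebra (A : Superalgebra F) :
    NonUnitalSubalgebra F (Grassmann F ⊗[F] A.carrier) where
  toSubmodule := A.envelopePart 0 ⊔ A.envelopePart 1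
  mul_mem' := by
    intro z w hz hw
    obtain ⟨z₀, hz₀, z₁, hz₁, rfl⟩ := Submodule.mem_sup.1 hz
    obtain ⟨w₀, hw₀, w₁, hw₁, rfl⟩ := Submodule.mem_sup.1 hw
    have h₀₀ := A.envelopePart_mul 0 0 hz₀ hw₀
    have h₀₁ := A.envelopePart_mul 0 1 hz₀ hw₁
    have h₁₀ := A.envelopePart_mul 1 0 hz₁ hw₀
    have h₁₁ := A.envelopePart_mul 1 1 hz₁ hw₁
    rw [show (1 + 1 : ZMod 2) = 0 from rfl] at h₁₁
    rw [add_zero] at h₀₀ h₁₀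
    rw [zero_add] at h₀₁
    have e : (z₀ + z₁) * (w₀ + w₁) = (z₀ * w₀ + z₁ * w₁) + (z₀ * w₁ + z₁ * w₀) := by
      rw [add_mul, mul_add, mul_add]; abel
    rw [e]
    exact Submodule.add_mem_sup (Submodule.add_mem _ h₀₀ h₁₁) (Submodule.add_mem _ h₀₁ h₁₀)

/-- The Grassmann envelope as an algebra. -/
def envelope (A : Superalgebra F) : NAAlgebra F where
  carrier := A.envelopeSubalgebra

end Superalgebra

/-! ### Free nonassociative algebras and superalgebras -/

/-- The free nonassociative algebra on the set `X`. -/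
def freeNA (F : Type u) [Field F] (X : Type) : NAAlgebra F where
  carrier := FreeNonUnitalNonAssocAlgebra F X

/-- The parity of a nonassociative word in even letters `inl i` and odd letters `inr j`:
the number of its odd letters modulo 2. -/
def wordParity {X Y : Type} : FreeMagma (X ⊕ Y) → ZMod 2
  | FreeMagma.of (Sum.inl _) => 0
  | FreeMagma.of (Sum.inr _) => 1
  | FreeMagma.mul v w => wordParity v + wordParity w

/-- The span of the words of parity `i` in the free nonassociative algebra. -/
def wordPart (F : Type u) [Field F] (X Y : Type) (i : ZMod 2) :
    Submodule F (FreeNonUnitalNonAssocAlgebra F (X ⊕ Y)) :=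
  Submodule.span F {z | ∃ w : FreeMagma (X ⊕ Y), wordParity w = i ∧ z = MonoidAlgebra.single w 1}

theorem coeff_eq_zero_of_mem_wordPart {F : Type u} [Field F] {X Y : Type} {i : ZMod 2}
    {z : FreeNonUnitalNonAssocAlgebra F (X ⊕ Y)} (hz : z ∈ wordPart F X Y i)
    (w : FreeMagma (X ⊕ Y)) (hw : wordParity w ≠ i) : z.coeff w = 0 := by
  classical
  unfold wordPart at hz
  induction hz using Submodule.span_induction with
  | mem x hx =>
    obtain ⟨v, hv, rfl⟩ := hx
    rw [MonoidAlgebra.coeff_single, Finsupp.single_apply, if_neg]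
    rintro rfl
    exact hw hv
  | zero => simp
  | add x y _ _ h₁ h₂ => simp [h₁, h₂]
  | smul c x _ h => simp [h]

theorem isCompl_wordPart (F : Type u) [Field F] (X Y : Type) :
    IsCompl (wordPart F X Y 0) (wordPart F X Y 1) := by
  constructor
  · rw [Submodule.disjoint_def]
    intro z h₀ h₁
    rw [← MonoidAlgebra.coeff_eq_zero]
    ext w
    by_cases h : wordParity w = 0
    · exact coeff_eq_zero_of_mem_wordPart h₁ w (by rw [h]; decide)
    · exact coeff_eq_zero_of_mem_wordPart h₀ w h
  · rw [codisjoint_iff, eq_top_iff]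
    intro z _
    induction z using MonoidAlgebra.induction_linear with
    | zero => exact Submodule.zero_mem _
    | add f g hf hg => exact Submodule.add_mem _ (hf trivial) (hg trivial)
    | single w c =>
      have e : (MonoidAlgebra.single w c : MonoidAlgebra F (FreeMagma (X ⊕ Y))) =
          c • MonoidAlgebra.single w 1 := by simp
      rw [e]
      refine Submodule.smul_mem _ c ?_
      have h2 : ∀ i : ZMod 2, i = 0 ∨ i = 1 := by decide
      rcases h2 (wordParity w) with h | h
      · exact Submodule.mem_sup_left (Submodule.subset_span ⟨w, h, rfl⟩)
      · exact Submodule.mem_sup_right (Submodule.subset_span ⟨w, h, rfl⟩)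

theorem mul_mem_wordPart {F : Type u} [Field F] {X Y : Type} {i j : ZMod 2}
    {a b : FreeNonUnitalNonAssocAlgebra F (X ⊕ Y)} (ha : a ∈ wordPart F X Y i)
    (hb : b ∈ wordPart F X Y j) : a * b ∈ wordPart F X Y (i + j) := by
  unfold wordPart at ha hb
  induction ha, hb using Submodule.span_induction₂ with
  | mem_mem x y hx hy =>
    obtain ⟨v, rfl, rfl⟩ := hx
    obtain ⟨w, rfl, rfl⟩ := hy
    rw [MonoidAlgebra.single_mul_single, one_mul]
    exact Submodule.subset_span ⟨v * w, rfl, rfl⟩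
  | zero_left y hy => rw [zero_mul]; exact Submodule.zero_mem _
  | zero_right x hx => rw [mul_zero]; exact Submodule.zero_mem _
  | add_left x y z _ _ _ h₁ h₂ => rw [add_mul]; exact Submodule.add_mem _ h₁ h₂
  | add_right x y z _ _ _ h₁ h₂ => rw [mul_add]; exact Submodule.add_mem _ h₁ h₂
  | smul_left r x y _ _ h => rw [smul_mul_assoc]; exact Submodule.smul_mem _ r h
  | smul_right r x y _ _ h => rw [mul_smul_comm]; exact Submodule.smul_mem _ r h

/-- The free nonassociative superalgebra on a set `X` of even and a set `Y` of odd generators: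
its part of parity `i` consists of the linear combinations of words of parity `i`. -/
def freeNASuper (F : Type u) [Field F] (X Y : Type) : Superalgebra F where
  toNAAlgebra := freeNA F (X ⊕ Y)
  part := wordPart F X Y
  isCompl := isCompl_wordPart F X Y
  mul_mem _ _ _ _ ha hb := mul_mem_wordPart ha hb

/-! ### Varieties, free algebras and basic rank -/

section Varieties

variable {F : Type u} [Field F]

/-- The algebra `A` satisfies the identity `f = 0`. -/
def NAAlgebra.Satisfies (A : NAAlgebra F) (f : FreeNonUnitalNonAssocAlgebra F ℕ) : Prop :=
  ∀ a : ℕ → A.carrier, FreeNonUnitalNonAssocAlgebra.lift F a f = 0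

/-- The variety generated by the algebra `A`. -/
def NAAlgebra.generatedVariety (A : NAAlgebra F) : Set (NAAlgebra F) :=
  {B | ∀ f, A.Satisfies f → B.Satisfies f}

/-- The free algebra of rank `r` of the variety `V`: the quotient of the free nonassociative
algebra on `r` generators by the least ideal such that the quotient lies in `V`. -/
def freeAlg (V : Set (NAAlgebra F)) (r : ℕ) : NAAlgebra F :=
  (AlgIdeal.inter {I : AlgIdeal (freeNA F (Fin r)) | I.quot ∈ V}).quot

/-- The variety `V` has infinite basic rank: none of the subvarieties `V_r` generated by the
free `V`-algebras of finite rank `r` is equal to `V`. -/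
def HasInfiniteBasicRank (V : Set (NAAlgebra F)) : Prop :=
  ∀ r : ℕ, (freeAlg V r).generatedVariety ≠ V

/-- The class of all `V`-superalgebras, i.e. of the superalgebras whose Grassmann envelope lies
in `V`. -/
def superClass (V : Set (NAAlgebra F)) : Set (Superalgebra F) :=
  {A | A.envelope ∈ V}

/-- The graded ideals of the free nonassociative superalgebra on `r` even and `s` odd generators
such that the quotient is a `V`-superalgebra. -/
def superIdeals (V : Set (NAAlgebra F)) (r s : ℕ) :
    Set (AlgIdeal (freeNASuper F (Fin r) (Fin s)).toNAAlgebra) :=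
  {I | ∃ hI : (freeNASuper F (Fin r) (Fin s)).IsGraded I,
    (freeNASuper F (Fin r) (Fin s)).quot I hI ∈ superClass V}

/-- The free `V`-superalgebra on `r` even and `s` odd generators: the quotient of the free
nonassociative superalgebra by the least graded ideal such that the quotient is a
`V`-superalgebra. -/
def freeSuper (V : Set (NAAlgebra F)) (r s : ℕ) : Superalgebra F :=
  (freeNASuper F (Fin r) (Fin s)).quot (AlgIdeal.inter (superIdeals V r s))
    (Superalgebra.isGraded_inter _ _ fun _ h => h.1)

end Varieties

/-! ### Superidentities -/

/-- The letters of a nonassociative word, from left to right. -/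
def wordLetters {X : Type} : FreeMagma X → List X
  | FreeMagma.of x => [x]
  | FreeMagma.mul v w => wordLetters v ++ wordLetters w

/-- The sign of the Koszul rule for a list `l` of variables with parities `p`: one factor `-1`
for each pair of odd variables that stands in `l` in descending order. -/
def koszulSign {n : ℕ} (p : Fin n → ZMod 2) : List (Fin n) → ℤ
  | [] => 1
  | i :: l => (-1) ^ (l.countP fun j => decide (j < i ∧ p i = 1 ∧ p j = 1)) * koszulSign p l

section Super

variable {F : Type u} [Field F]

/-- The nonassociative polynomial `f` is multilinear in the variables `x₀, …, xₙ₋₁`: each of its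
words contains each variable exactly once. -/
def IsMultilinearPoly {n : ℕ} (f : FreeNonUnitalNonAssocAlgebra F (Fin n)) : Prop :=
  ∀ w ∈ f.coeff.support, (wordLetters w).Perm (List.finRange n)

/-- The superpolynomial corresponding to the multilinear polynomial `f`, on variables of
parities `p`: each word is multiplied by its Koszul sign. -/
def superization {n : ℕ} (p : Fin n → ZMod 2) (f : FreeNonUnitalNonAssocAlgebra F (Fin n)) :
    FreeNonUnitalNonAssocAlgebra F (Fin n) :=
  f.coeff.sum fun w c => MonoidAlgebra.single w ((koszulSign p (wordLetters w) : F) * c)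

/-- The superalgebra `A` satisfies the superidentity corresponding to the multilinear identity
`f = 0`: for all parities of the variables, the superpolynomial vanishes on all homogeneous
elements of `A` of these parities. -/
def Superalgebra.SuperSatisfies (A : Superalgebra F) {n : ℕ}
    (f : FreeNonUnitalNonAssocAlgebra F (Fin n)) : Prop :=
  ∀ (p : Fin n → ZMod 2) (a : Fin n → A.carrier), (∀ i, a i ∈ A.part (p i)) →
    FreeNonUnitalNonAssocAlgebra.lift F a (superization p f) = 0

/-- The supervariety generated by the superalgebra `A`: the class of all superalgebras that
satisfy every superidentity of `A`. -/
def Superalgebra.generatedSupervariety (A : Superalgebra F) : Set (Superalgebra F) :=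
  {B | ∀ (n : ℕ) (f : FreeNonUnitalNonAssocAlgebra F (Fin n)), IsMultilinearPoly f →
    A.SuperSatisfies f → B.SuperSatisfies f}

/-- The supervariety `V_{r,s}` generated by the free `V`-superalgebra on `r` even and `s` odd
generators. For `r = s = 0` this superalgebra is zero, and `V_{0,0}` consists of the zero
superalgebras. -/
def supervarietyRS (V : Set (NAAlgebra F)) (r s : ℕ) : Set (Superalgebra F) :=
  (freeSuper V r s).generatedSupervariety

/-- The basic spectrum of `V`: the set of the basic superranks of `V`, i.e. of the pairs `(r, s)`
that are minimal, in the componentwise order, with the property that `V_{r,s}` is the class of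
all `V`-superalgebras. -/
def basicSpectrum (V : Set (NAAlgebra F)) : Set (ℕ × ℕ) :=
  {q | Minimal (fun q : ℕ × ℕ => supervarietyRS V q.1 q.2 = superClass V) q}

end Super

/-- The variety of metabelian alternative algebras over `F`: the identities are
`(x, x, y) = 0`, `(x, y, y) = 0` and `(x y) (z t) = 0`. -/
def altMetabelian (F : Type u) [Field F] : Set (NAAlgebra F) :=
  {A | (∀ x y : A.carrier, associator x x y = 0) ∧
    (∀ x y : A.carrier, associator x y y = 0) ∧
    ∀ x y z t : A.carrier, (x * y) * (z * t) = 0}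

end

noncomputable section

universe u

/-! ### Sign rules and nonvanishing products in the Grassmann algebra. -/

section GrassmannAlgebra

variable {F : Type u} [Field F]

open Superalgebra

/-! A superalgebra satisfies a multilinear superidentity exactly when its Grassmann envelope
satisfies the ordinary identity (`superSatisfies_iff_envelope_sat`). The defining identities of V
are multilinear up to polarization, so V_{r,s} always lies in the class of V-superalgebras. Equality
holds once every multilinear f whose superidentity holds in the free V-superalgebra on r even and s
odd generators is an identity of V (`supervarietyRS_eq`).

Degree n ≥ 4. Compose operators from left to right. On products one has R_xR_y = -R_yR_x, L_xL_y =
R_xR_y and L_xR_y = -R_xL_y - R_xR_y; the last relation uses the middle Moufang identity, which here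
reads x((yz)x) = 0. So once the first two letters of a word are fixed, the other letters act, up to
linear combination, in only two ways: R...R or LR...R, in the natural order. Alternativity reduces
the leading pair to (1,0) or (0,k), which leaves 2n spanning words (`exists_normal_form`). They are
separated by one superalgebra, `dorofeev`: a single odd y acts on a module by two reflections of the
two-dimensional representation of S_3. Putting a module element for one variable and y for the
others gives linear equations in the 2n coefficients with only the zero solution, because 3 ≠ 0
(`sat_of_dorofeev`). The module element may have either parity, so one even and one odd generator
suffice, and so do two odd ones.

Degree n ≤ 3. For A in V the superalgebra G ⊗ A, graded by G, is a V-superalgebra. Three odd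
generators can be sent to independent elements g_i ⊗ a_i, which recovers f. With one even and one
odd generator, the first two variables are taken equal: even values kill the symmetric part of f in
them, odd values the skew part, and 2 ≠ 0.

Negative results. On products right multiplications anticommute, so in an algebra of V with r
generators more than r of them annihilate every product (`rmul_eq_zero_of_card_lt`), whereas long
products survive in the envelope of `dorofeev`. This excludes all pairs (r,0) and proves infinite
basic rank. The symmetrization of (xy)z vanishes in V when an argument is a product; its superform
is skew-symmetric on odd elements, so it vanishes on at most two odd generators. It does not vanish
on x, x², x³ with x⁴ = 0, which excludes (0,s) for s ≤ 2. -/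

theorem Grassmann.ι_mul_eq_involute_mul (v : ℕ →₀ F) (x : Grassmann F) :
    ExteriorAlgebra.ι F v * x = CliffordAlgebra.involute x * ExteriorAlgebra.ι F v := by
  induction x using ExteriorAlgebra.induction with
  | algebraMap r =>
    rw [AlgHom.commutes, Algebra.commutes]
  | ι w =>
    have h : CliffordAlgebra.involute (ExteriorAlgebra.ι F w) = -ExteriorAlgebra.ι F w :=
      CliffordAlgebra.involute_ι w
    rw [h, neg_mul]
    exact eq_neg_of_add_eq_zero_left (ExteriorAlgebra.ι_add_mul_swap v w)
  | mul a b ha hb =>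
    rw [map_mul, ← mul_assoc, ha, mul_assoc, hb, mul_assoc]
  | add a b ha hb => rw [map_add, mul_add, add_mul, ha, hb]

theorem zmod_two_cases (i : ZMod 2) : i = 0 ∨ i = 1 := by
  revert i; decide

/-- The sign `(-1)^{ij}` for parities `i` and `j`. -/
def paritySign (i j : ZMod 2) : ℤ := if i = 1 ∧ j = 1 then -1 else 1

/-- An even g commutes with every vector and an odd g anticommutes with it. Both rules extend
multiplicatively to g x = x g, respectively g x = `involute` x · g, for all x; evaluating at a
homogeneous x gives the sign. -/
theorem Grassmann.graded_comm {i j : ZMod 2} {g h : Grassmann F} (hg : g ∈ grassmannPart F i)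
    (hh : h ∈ grassmannPart F j) : g * h = paritySign i j • (h * g) := by
  rcases zmod_two_cases i with rfl | rfl
  · have key : ∀ x : Grassmann F, g * x = x * g := by
      intro x
      induction x using ExteriorAlgebra.induction with
      | algebraMap r => exact (Algebra.commutes r g).symm
      | ι w => rw [Grassmann.ι_mul_eq_involute_mul, CliffordAlgebra.involute_eq_of_mem_even hg]
      | mul a b ha hb => rw [← mul_assoc, ha, mul_assoc, hb, mul_assoc]
      | add a b ha hb => rw [mul_add, add_mul, ha, hb]
    simp [paritySign, key]
  · have key : ∀ x : Grassmann F, g * x = CliffordAlgebra.involute x * g := by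
      intro x
      induction x using ExteriorAlgebra.induction with
      | algebraMap r => rw [AlgHom.commutes]; exact (Algebra.commutes r g).symm
      | ι w =>
        have h : CliffordAlgebra.involute (ExteriorAlgebra.ι F w) = -ExteriorAlgebra.ι F w :=
          CliffordAlgebra.involute_ι w
        rw [h, neg_mul, Grassmann.ι_mul_eq_involute_mul,
          CliffordAlgebra.involute_eq_of_mem_odd hg, neg_mul, neg_neg]
      | mul a b ha hb => rw [map_mul, ← mul_assoc, ha, mul_assoc, hb, mul_assoc]
      | add a b ha hb => rw [map_add, mul_add, add_mul, ha, hb]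
    rcases zmod_two_cases j with rfl | rfl
    · simp [paritySign, key, CliffordAlgebra.involute_eq_of_mem_even hh]
    · simp [paritySign, key, CliffordAlgebra.involute_eq_of_mem_odd hh]

/-- The generators of the Grassmann algebra. -/
def Grassmann.gen (F : Type u) [Field F] (k : ℕ) : Grassmann F :=
  ExteriorAlgebra.ι F (Finsupp.single k 1)

theorem Grassmann.gen_mem (k : ℕ) : Grassmann.gen F k ∈ grassmannPart F 1 :=
  CliffordAlgebra.ι_mem_evenOdd_one _ _

theorem Grassmann.one_mem : (1 : Grassmann F) ∈ grassmannPart F 0 :=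
  SetLike.GradedOne.one_mem

/-- Contraction with the coordinate functional of the first generator kills the product of the other
generators and strips the first factor, so the vanishing of the product would descend to a shorter
list. -/
theorem Grassmann.prod_gen_ne_zero (l : List ℕ) (hl : l.Nodup) :
    (l.map (Grassmann.gen F)).prod ≠ 0 := by
  induction l with
  | nil => simp
  | cons a l ih =>
    intro h
    refine ih (List.nodup_cons.1 hl).2 ?_
    have ha := (List.nodup_cons.1 hl).1
    let d : Module.Dual F (ℕ →₀ F) := Finsupp.lapply a
    have hd : ∀ l : List ℕ, a ∉ l → CliffordAlgebra.contractLeft (Q := (0 : QuadraticForm F (ℕ →₀ F))) d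
        (l.map (Grassmann.gen F)).prod = 0 := by
      intro l hl
      induction l with
      | nil => simp
      | cons b l ih =>
        rw [List.mem_cons, not_or] at hl
        rw [List.map_cons, List.prod_cons]
        have := CliffordAlgebra.contractLeft_ι_mul (Q := (0 : QuadraticForm F (ℕ →₀ F))) (d := d)
          (Finsupp.single b 1) (l.map (Grassmann.gen F)).prod
        refine this.trans ?_
        rw [ih hl.2, mul_zero, sub_zero]
        have : d (Finsupp.single b 1) = 0 := by simp [d, Ne.symm hl.1]
        rw [this, zero_smul]
    have := CliffordAlgebra.contractLeft_ι_mul (Q := (0 : QuadraticForm F (ℕ →₀ F))) (d := d)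
          (Finsupp.single a 1) (l.map (Grassmann.gen F)).prod
    rw [hd l ha, mul_zero, sub_zero] at this
    have e : d (Finsupp.single a 1) = 1 := by simp [d]
    rw [e, one_smul] at this
    rw [← this]
    rw [List.map_cons, List.prod_cons] at h
    exact (congrArg _ h).trans (map_zero _)

end GrassmannAlgebra

/-! ### The Koszul sign as the sign of sorting Grassmann factors. -/

section KoszulSign

variable {F : Type u} [Field F] {n : ℕ}

open Superalgebra

/-- Inserting `g i` into a sorted product moves it past the smaller letters only, and each exchange
of two odd factors costs -1. This is the recursive step in the definition of `koszulSign`. -/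
theorem Grassmann.mul_prod_orderedInsert (p : Fin n → ZMod 2) (g : Fin n → Grassmann F)
    (hg : ∀ i, g i ∈ grassmannPart F (p i)) (i : Fin n) (l : List (Fin n))
    (hl : l.Pairwise (· ≤ ·)) :
    g i * (l.map g).prod =
      ((-1 : ℤ) ^ (l.countP fun j => decide (j < i ∧ p i = 1 ∧ p j = 1))) •
        ((l.orderedInsert (· ≤ ·) i).map g).prod := by
  induction l with
  | nil => simp
  | cons j l ih =>
    by_cases hij : i ≤ j
    · have h0 : (j :: l).countP (fun j => decide (j < i ∧ p i = 1 ∧ p j = 1)) = 0 := by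
        rw [List.countP_eq_zero]
        intro k hk
        have : j ≤ k := by
          rcases List.mem_cons.1 hk with rfl | hk
          · exact le_rfl
          · exact (List.pairwise_cons.1 hl).1 k hk
        simp [not_lt.2 (hij.trans this)]
      rw [h0, List.orderedInsert_cons, if_pos hij]
      simp
    · have hji : j < i := not_le.1 hij
      rw [List.orderedInsert_cons, if_neg hij, List.map_cons, List.prod_cons, List.map_cons,
        List.prod_cons, ← mul_assoc, Grassmann.graded_comm (hg i) (hg j), smul_mul_assoc,
        mul_assoc, ih (List.pairwise_cons.1 hl).2, mul_smul_comm, smul_smul]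
      congr 1
      rw [List.countP_cons, pow_add, mul_comm]
      congr 1
      by_cases h : p i = 1 ∧ p j = 1 <;> simp [paritySign, h, hji]

theorem Grassmann.prod_eq_koszulSign_smul (p : Fin n → ZMod 2) (g : Fin n → Grassmann F)
    (hg : ∀ i, g i ∈ grassmannPart F (p i)) (l : List (Fin n)) :
    (l.map g).prod = koszulSign p l • ((l.insertionSort (· ≤ ·)).map g).prod := by
  induction l with
  | nil => simp [koszulSign]
  | cons i l ih =>
    rw [List.map_cons, List.prod_cons, ih, mul_smul_comm, List.insertionSort_cons,
      Grassmann.mul_prod_orderedInsert p g hg i _ (List.pairwise_insertionSort _ _), smul_smul,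
      koszulSign, mul_comm]
    congr 3
    exact (List.perm_insertionSort _ l).countP_eq _

/-- Insertion sort turns any arrangement of the variables into the natural order. All words of a
multilinear polynomial therefore share one Grassmann factor, up to their Koszul signs. -/
theorem Grassmann.prod_of_perm (p : Fin n → ZMod 2) (g : Fin n → Grassmann F)
    (hg : ∀ i, g i ∈ grassmannPart F (p i)) (l : List (Fin n)) (hl : l.Perm (List.finRange n)) :
    (l.map g).prod = koszulSign p l • ((List.finRange n).map g).prod := by
  rw [Grassmann.prod_eq_koszulSign_smul p g hg]
  congr 3
  refine List.Perm.eq_of_pairwise' (r := (· ≤ ·)) (List.pairwise_insertionSort _ _) ?_ ?_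
  · exact (List.sortedLT_finRange n).sortedLE.pairwise
  · exact (List.perm_insertionSort _ l).trans hl

theorem koszulSign_mul_self (p : Fin n → ZMod 2) (l : List (Fin n)) :
    koszulSign p l * koszulSign p l = 1 := by
  induction l with
  | nil => simp [koszulSign]
  | cons i l ih =>
    rw [koszulSign, mul_mul_mul_comm, ih, mul_one, ← pow_add, ← two_mul, pow_mul]
    simp

end KoszulSign

/-! ### Evaluation of nonassociative words and linearity in each variable. -/

section Words

/-- The value of a nonassociative word. -/
def evalWord {X M : Type*} [Mul M] (a : X → M) : FreeMagma X → M
  | FreeMagma.of x => a x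
  | FreeMagma.mul v w => evalWord a v * evalWord a w

theorem evalWord_of {X M : Type*} [Mul M] (a : X → M) (x : X) :
    evalWord a (FreeMagma.of x) = a x := rfl

theorem evalWord_comp {X M N : Type*} [Mul M] [Mul N] (φ : M → N)
    (hφ : ∀ x y, φ (x * y) = φ x * φ y) (a : X → M) (w : FreeMagma X) :
    evalWord (fun x => φ (a x)) w = φ (evalWord a w) := by
  induction w using FreeMagma.rec with
  | of x => rfl
  | mul v w hv hw =>
    change evalWord _ v * evalWord _ w = φ (evalWord a v * evalWord a w)
    rw [hv, hw, hφ]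

theorem wordLetters_ne_nil {X : Type} (w : FreeMagma X) : wordLetters w ≠ [] := by
  induction w using FreeMagma.rec with
  | of x => simp [wordLetters]
  | mul v w hv hw => simp [wordLetters, hv]

variable {F : Type u} [Field F]

section

variable {A : Type*} [NonUnitalNonAssocRing A] [Module F A] [IsScalarTower F A A]
  [SMulCommClass F A A]

theorem lift_single {X : Type*} (a : X → A) (w : FreeMagma X) (c : F) :
    FreeNonUnitalNonAssocAlgebra.lift F a (MonoidAlgebra.single w c) = c • evalWord a w := by
  have h : ∀ w : FreeMagma X,
      FreeNonUnitalNonAssocAlgebra.lift F a (MonoidAlgebra.single w 1) = evalWord a w := by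
    intro w
    induction w using FreeMagma.rec with
    | of x => exact FreeNonUnitalNonAssocAlgebra.lift_of_apply F a x
    | mul v w hv hw =>
      have e : (MonoidAlgebra.single (FreeMagma.mul v w) 1 : MonoidAlgebra F (FreeMagma X)) =
          MonoidAlgebra.single v 1 * MonoidAlgebra.single w 1 := by
        rw [MonoidAlgebra.single_mul_single, one_mul]; rfl
      rw [e, map_mul, hv, hw]; rfl
  rw [← h, ← map_smul]
  simp

theorem lift_eq_sum {X : Type*} (a : X → A) (f : FreeNonUnitalNonAssocAlgebra F X) :
    FreeNonUnitalNonAssocAlgebra.lift F a f = f.coeff.sum fun w c => c • evalWord a w := by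
  classical
  induction f using MonoidAlgebra.induction_linear with
  | zero => simp
  | add f g hf hg =>
    rw [map_add, hf, hg, MonoidAlgebra.coeff_add, Finsupp.sum_add_index']
    · simp
    · intros; rw [add_smul]
  | single w c => rw [lift_single, MonoidAlgebra.coeff_single, Finsupp.sum_single_index]; simp

theorem lift_superization {n : ℕ} (p : Fin n → ZMod 2) (a : Fin n → A)
    (f : FreeNonUnitalNonAssocAlgebra F (Fin n)) :
    FreeNonUnitalNonAssocAlgebra.lift F a (superization p f) =
      f.coeff.sum fun w c => ((koszulSign p (wordLetters w) : F) * c) • evalWord a w := by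
  rw [superization, Finsupp.sum, map_sum]
  simp only [lift_single]
  rfl

theorem lift_map {B : Type*} [NonUnitalNonAssocRing B] [Module F B] [IsScalarTower F B B]
    [SMulCommClass F B B] {X : Type*} (φ : A →ₗ[F] B) (hφ : ∀ x y, φ (x * y) = φ x * φ y)
    (a : X → A) (f : FreeNonUnitalNonAssocAlgebra F X) :
    FreeNonUnitalNonAssocAlgebra.lift F (fun x => φ (a x)) f =
      φ (FreeNonUnitalNonAssocAlgebra.lift F a f) := by
  rw [lift_eq_sum, lift_eq_sum, Finsupp.sum, Finsupp.sum, map_sum]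
  simp only [map_smul, evalWord_comp φ hφ]

theorem evalWord_update_of_notMem {X : Type} [DecidableEq X] (a : X → A) (i : X) (u : A)
    (w : FreeMagma X) (h : i ∉ wordLetters w) :
    evalWord (Function.update a i u) w = evalWord a w := by
  induction w using FreeMagma.rec with
  | of x =>
    have : x ≠ i := by rintro rfl; simp [wordLetters] at h
    simp [evalWord, this]
  | mul v w hv hw =>
    simp only [wordLetters, List.mem_append, not_or] at h
    simp only [evalWord, hv h.1, hw h.2]

/-- Linearity of a word in a letter that occurs once. -/
theorem exists_linear_evalWord_update {X : Type} [DecidableEq X] (a : X → A) (i : X)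
    (w : FreeMagma X) (h : (wordLetters w).count i = 1) :
    ∃ T : A →ₗ[F] A, ∀ u, evalWord (Function.update a i u) w = T u := by
  induction w using FreeMagma.rec with
  | of x =>
    have : x = i := by
      by_contra hx
      simp [wordLetters, hx] at h
    subst this
    exact ⟨LinearMap.id, fun u => by simp [evalWord]⟩
  | mul v w hv hw =>
    simp only [wordLetters, List.count_append] at h
    rcases Nat.eq_zero_or_pos ((wordLetters v).count i) with h0 | h0
    · obtain ⟨T, hT⟩ := hw (by omega)
      refine ⟨(LinearMap.mulLeft F (evalWord a v)).comp T, fun u => ?_⟩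
      simp only [evalWord, hT,
        evalWord_update_of_notMem a i u v (List.count_eq_zero.1 h0), LinearMap.comp_apply,
        LinearMap.mulLeft_apply]
    · obtain ⟨T, hT⟩ := hv (by omega)
      refine ⟨(LinearMap.mulRight F (evalWord a w)).comp T, fun u => ?_⟩
      simp only [evalWord, hT,
        evalWord_update_of_notMem a i u w (List.count_eq_zero.1 (by omega)),
        LinearMap.comp_apply, LinearMap.mulRight_apply]

theorem IsMultilinearPoly.exists_linear {n : ℕ} {f : FreeNonUnitalNonAssocAlgebra F (Fin n)}
    (hf : IsMultilinearPoly f) (a : Fin n → A) (i : Fin n) :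
    ∃ T : A →ₗ[F] A, ∀ u,
      FreeNonUnitalNonAssocAlgebra.lift F (Function.update a i u) f = T u := by
  have h : ∀ w : FreeMagma (Fin n), ∃ T : A →ₗ[F] A, w ∈ f.coeff.support →
      ∀ u, evalWord (Function.update a i u) w = T u := by
    intro w
    by_cases hw : w ∈ f.coeff.support
    · obtain ⟨T, hT⟩ := exists_linear_evalWord_update (F := F) a i w
        (by rw [(hf w hw).count_eq]; exact List.count_eq_one_of_mem (List.nodup_finRange n)
              (List.mem_finRange i))
      exact ⟨T, fun _ => hT⟩
    · exact ⟨0, fun h => absurd h hw⟩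
  choose T hT using h
  refine ⟨∑ w ∈ f.coeff.support, f.coeff w • T w, fun u => ?_⟩
  rw [lift_eq_sum, Finsupp.sum, LinearMap.sum_apply]
  exact Finset.sum_congr rfl fun w hw => by rw [hT w hw, LinearMap.smul_apply]

end

end Words

/-! ### Superidentities of a superalgebra versus identities of its Grassmann envelope. -/

section Envelope

variable {F : Type u} [Field F] {n : ℕ}

open Superalgebra

theorem evalWord_tmul {A : Type u} [NonUnitalNonAssocRing A] [Module F A] [IsScalarTower F A A]
    [SMulCommClass F A A] {X : Type} (g : X → Grassmann F) (a : X → A) (w : FreeMagma X) :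
    evalWord (fun i => g i ⊗ₜ[F] a i) w =
      ((wordLetters w).map g).prod ⊗ₜ[F] evalWord a w := by
  induction w using FreeMagma.rec with
  | of x => simp [evalWord, wordLetters]
  | mul v w hv hw =>
    simp only [evalWord, wordLetters, hv, hw, List.map_append, List.prod_append,
      Algebra.TensorProduct.tmul_mul_tmul]

/-- The bridge between identities and superidentities: reordering the Grassmann factors of each word
produces exactly the sign inserted by `superization`, and the common ordered product factors out. -/
theorem lift_tmul {A : Type u} [NonUnitalNonAssocRing A] [Module F A] [IsScalarTower F A A]
    [SMulCommClass F A A] {f : FreeNonUnitalNonAssocAlgebra F (Fin n)}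
    (hf : IsMultilinearPoly f) (p : Fin n → ZMod 2) (g : Fin n → Grassmann F)
    (hg : ∀ i, g i ∈ grassmannPart F (p i)) (a : Fin n → A) :
    FreeNonUnitalNonAssocAlgebra.lift F (fun i => g i ⊗ₜ[F] a i) f =
      ((List.finRange n).map g).prod ⊗ₜ[F]
        FreeNonUnitalNonAssocAlgebra.lift F a (superization p f) := by
  rw [lift_superization, lift_eq_sum, Finsupp.sum, Finsupp.sum, TensorProduct.tmul_sum]
  refine Finset.sum_congr rfl fun w hw => ?_
  rw [evalWord_tmul, Grassmann.prod_of_perm p g hg _ (hf w hw), mul_comm, mul_smul,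
    TensorProduct.tmul_smul, Int.cast_smul_eq_zsmul, TensorProduct.tmul_smul,
    TensorProduct.smul_tmul', TensorProduct.smul_tmul', TensorProduct.smul_tmul']

/-- A Grassmann element of each parity, with nonzero products. -/
def Grassmann.std (F : Type u) [Field F] (p : ZMod 2) (k : ℕ) : Grassmann F :=
  if p = 1 then Grassmann.gen F k else 1

theorem Grassmann.std_mem (p : ZMod 2) (k : ℕ) : Grassmann.std F p k ∈ grassmannPart F p := by
  rcases zmod_two_cases p with rfl | rfl
  · simpa [Grassmann.std] using Grassmann.one_mem
  · simpa [Grassmann.std] using Grassmann.gen_mem k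

/-- Even letters contribute 1, so only a product of distinct generators remains. Hence nothing is
lost when the Grassmann coefficient is cancelled with `tmul_eq_zero_of_ne`. -/
theorem Grassmann.prod_std_ne_zero {X : Type*} (p : X → ZMod 2) (k : X → ℕ)
    (hk : Function.Injective k) (l : List X) (hl : l.Nodup) :
    (l.map fun i => Grassmann.std F (p i) (k i)).prod ≠ 0 := by
  have h : (l.map fun i => Grassmann.std F (p i) (k i)).prod =
      (((l.filter fun i => p i = 1).map k).map (Grassmann.gen F)).prod := by
    clear hl
    induction l with
    | nil => simp
    | cons i l ih =>
      by_cases hi : p i = 1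
      · rw [List.map_cons, List.prod_cons, ih]
        simp [hi, Grassmann.std]
      · rw [List.map_cons, List.prod_cons, ih]
        simp [hi, Grassmann.std]
  rw [h]
  exact Grassmann.prod_gen_ne_zero _ ((hl.filter _).map hk)

theorem tmul_eq_zero_of_ne {A : Type u} [AddCommGroup A] [Module F A] {g : Grassmann F} {a : A}
    (h : g ⊗ₜ[F] a = 0) (hg : g ≠ 0) : a = 0 := by
  obtain ⟨φ, hφ⟩ : ∃ φ : Module.Dual F (Grassmann F), φ g ≠ 0 := by
    by_contra! hφ
    exact hg ((Module.forall_dual_apply_eq_zero_iff F g).1 hφ)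
  have := congrArg (fun z => TensorProduct.lid F A (LinearMap.rTensor A φ z)) h
  simpa [hφ] using this

theorem tmul_mem_envelope (A : Superalgebra F) {p : ZMod 2} {g : Grassmann F} {a : A.carrier}
    (hg : g ∈ grassmannPart F p) (ha : a ∈ A.part p) : g ⊗ₜ[F] a ∈ A.envelopeSubalgebra := by
  change g ⊗ₜ[F] a ∈ A.envelopePart 0 ⊔ A.envelopePart 1
  rcases zmod_two_cases p with rfl | rfl
  · exact Submodule.mem_sup_left (Submodule.subset_span ⟨g, hg, a, ha, rfl⟩)
  · exact Submodule.mem_sup_right (Submodule.subset_span ⟨g, hg, a, ha, rfl⟩)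

/-- The element `g ⊗ a` of the Grassmann envelope. -/
def envTmul (A : Superalgebra F) {p : ZMod 2} {g : Grassmann F} {a : A.carrier}
    (hg : g ∈ grassmannPart F p) (ha : a ∈ A.part p) : A.envelope.carrier :=
  (⟨g ⊗ₜ[F] a, tmul_mem_envelope A hg ha⟩ : A.envelopeSubalgebra)

/-- The inclusion of the Grassmann envelope of `A` into `G ⊗ A`. -/
def envIncl (A : Superalgebra F) : A.envelope.carrier →ₗ[F] Grassmann F ⊗[F] A.carrier :=
  A.envelopeSubalgebra.toSubmodule.subtype

theorem envIncl_mul (A : Superalgebra F) (x y : A.envelope.carrier) :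
    envIncl A (x * y) = envIncl A x * envIncl A y := rfl

theorem envIncl_injective (A : Superalgebra F) : Function.Injective (envIncl A) :=
  Subtype.val_injective

theorem envIncl_envTmul (A : Superalgebra F) {p : ZMod 2} {g : Grassmann F} {a : A.carrier}
    (hg : g ∈ grassmannPart F p) (ha : a ∈ A.part p) :
    envIncl A (envTmul A hg ha) = g ⊗ₜ[F] a := rfl

theorem envIncl_mem (A : Superalgebra F) (x : A.envelope.carrier) :
    envIncl A x ∈ Submodule.span F {z | ∃ p, ∃ g ∈ grassmannPart F p, ∃ a ∈ A.part p,
      z = g ⊗ₜ[F] a} := by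
  have hx : envIncl A x ∈ A.envelopePart 0 ⊔ A.envelopePart 1 := x.2
  refine (sup_le ?_ ?_ : A.envelopePart 0 ⊔ A.envelopePart 1 ≤ _) hx
  · exact Submodule.span_mono fun z hz => ⟨0, hz⟩
  · exact Submodule.span_mono fun z hz => ⟨1, hz⟩

/-- The algebra `A` satisfies the identity `f = 0` in finitely many variables. -/
def NAAlgebra.Sat (A : NAAlgebra F) (f : FreeNonUnitalNonAssocAlgebra F (Fin n)) : Prop :=
  ∀ a : Fin n → A.carrier, FreeNonUnitalNonAssocAlgebra.lift F a f = 0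

/-- The arguments are released from the spanning sets to their spans one at a time, by linearity in
the variable concerned; the induction is on the set of released variables. -/
theorem lift_eq_zero_of_span {A : Type*} [NonUnitalNonAssocRing A] [Module F A]
    [IsScalarTower F A A] [SMulCommClass F A A] {f : FreeNonUnitalNonAssocAlgebra F (Fin n)}
    (hf : IsMultilinearPoly f) (H : Fin n → Set A)
    (h : ∀ z : Fin n → A, (∀ i, z i ∈ H i) → FreeNonUnitalNonAssocAlgebra.lift F z f = 0)
    (z : Fin n → A) (hz : ∀ i, z i ∈ Submodule.span F (H i)) :
    FreeNonUnitalNonAssocAlgebra.lift F z f = 0 := by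
  have key : ∀ s : Finset (Fin n), ∀ z : Fin n → A, (∀ i ∉ s, z i ∈ H i) →
      (∀ i ∈ s, z i ∈ Submodule.span F (H i)) → FreeNonUnitalNonAssocAlgebra.lift F z f = 0 := by
    intro s
    induction s using Finset.induction_on with
    | empty => exact fun z hz _ => h z fun i => hz i (by simp)
    | insert j s hj ih =>
      intro z h₁ h₂
      obtain ⟨T, hT⟩ := hf.exists_linear z j
      have : ∀ u ∈ Submodule.span F (H j), T u = 0 := by
        intro u hu
        refine Submodule.span_induction (p := fun u _ => T u = 0) ?_ ?_ ?_ ?_ hu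
        · intro u hu
          rw [← hT]
          refine ih _ (fun i hi => ?_) (fun i hi => ?_)
          · by_cases hij : i = j
            · subst hij; simpa using hu
            · rw [Function.update_of_ne hij]; exact h₁ i (by simp [hij, hi])
          · have hij : i ≠ j := by rintro rfl; exact hj hi
            rw [Function.update_of_ne hij]; exact h₂ i (by simp [hi])
        · exact map_zero T
        · intro x y _ _ hx hy; rw [map_add, hx, hy, add_zero]
        · intro c x _ hx; rw [map_smul, hx, smul_zero]
      rw [← Function.update_eq_self j z, hT]
      exact this _ (h₂ j (by simp))
  exact key Finset.univ z (fun i hi => absurd (Finset.mem_univ i) hi) fun i _ => hz i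

/-- A superalgebra satisfies a multilinear superidentity if and only if its Grassmann envelope
satisfies the corresponding identity. -/
theorem superSatisfies_iff_envelope_sat (A : Superalgebra F)
    {f : FreeNonUnitalNonAssocAlgebra F (Fin n)} (hf : IsMultilinearPoly f) :
    A.SuperSatisfies f ↔ A.envelope.Sat f := by
  constructor
  · intro h a
    apply envIncl_injective A
    rw [map_zero, ← lift_map (envIncl A) (envIncl_mul A)]
    refine lift_eq_zero_of_span hf (fun _ => _) ?_ _ fun i => envIncl_mem A (a i)
    intro z hz
    choose p g hg b hb e using hz
    rw [show z = fun i => g i ⊗ₜ[F] b i from funext e, lift_tmul hf p g hg, h p b hb,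
      TensorProduct.tmul_zero]
  · intro h p a ha
    have h1 := h fun i => envTmul A (Grassmann.std_mem (p i) (i : ℕ)) (ha i)
    have h2 := congrArg (envIncl A) h1
    rw [map_zero, ← lift_map (envIncl A) (envIncl_mul A)] at h2
    simp only [envIncl_envTmul] at h2
    rw [lift_tmul hf p _ (fun i => Grassmann.std_mem (p i) (i : ℕ))] at h2
    exact tmul_eq_zero_of_ne h2
      (Grassmann.prod_std_ne_zero p _ Fin.val_injective _ (List.nodup_finRange n))

end Envelope

/-! ### Polarized defining identities and their superforms. -/

section Multilinear

variable {F : Type u} [Field F] {n : ℕ}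

theorem superization_add (p : Fin n → ZMod 2) (f g : FreeNonUnitalNonAssocAlgebra F (Fin n)) :
    superization p (f + g) = superization p f + superization p g := by
  classical
  unfold superization
  rw [MonoidAlgebra.coeff_add, Finsupp.sum_add_index']
  · simp
  · intro w b c; rw [mul_add, MonoidAlgebra.single_add]

theorem superization_single (p : Fin n → ZMod 2) (w : FreeMagma (Fin n)) (c : F) :
    superization p (MonoidAlgebra.single w c) =
      MonoidAlgebra.single w ((koszulSign p (wordLetters w) : F) * c) := by
  unfold superization
  rw [MonoidAlgebra.coeff_single, Finsupp.sum_single_index]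
  simp

theorem isMultilinearPoly_single {w : FreeMagma (Fin n)}
    (hw : (wordLetters w).Perm (List.finRange n)) (c : F) :
    IsMultilinearPoly (MonoidAlgebra.single w c : FreeNonUnitalNonAssocAlgebra F (Fin n)) := by
  intro v hv
  rw [MonoidAlgebra.coeff_single] at hv
  rw [Finset.mem_singleton.1 (Finsupp.support_single_subset hv)]
  exact hw

theorem IsMultilinearPoly.add {f g : FreeNonUnitalNonAssocAlgebra F (Fin n)}
    (hf : IsMultilinearPoly f) (hg : IsMultilinearPoly g) : IsMultilinearPoly (f + g) := by
  classical
  intro w hw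
  rcases Finset.mem_union.1 (Finsupp.support_add hw) with h | h
  · exact hf w h
  · exact hg w h

/-- The word `(x y) z`. -/
def wordL {X : Type} (x y z : X) : FreeMagma X :=
  FreeMagma.mul (FreeMagma.mul (FreeMagma.of x) (FreeMagma.of y)) (FreeMagma.of z)

/-- The word `x (y z)`. -/
def wordR {X : Type} (x y z : X) : FreeMagma X :=
  FreeMagma.mul (FreeMagma.of x) (FreeMagma.mul (FreeMagma.of y) (FreeMagma.of z))

/-- The linearization of `(x, x, y)`. -/
def leftAltPoly (F : Type u) [Field F] : FreeNonUnitalNonAssocAlgebra F (Fin 3) :=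
  MonoidAlgebra.single (wordL 0 1 2) 1 + MonoidAlgebra.single (wordR 0 1 2) (-1) +
    MonoidAlgebra.single (wordL 1 0 2) 1 + MonoidAlgebra.single (wordR 1 0 2) (-1)

/-- The linearization of `(x, y, y)`. -/
def rightAltPoly (F : Type u) [Field F] : FreeNonUnitalNonAssocAlgebra F (Fin 3) :=
  MonoidAlgebra.single (wordL 0 1 2) 1 + MonoidAlgebra.single (wordR 0 1 2) (-1) +
    MonoidAlgebra.single (wordL 0 2 1) 1 + MonoidAlgebra.single (wordR 0 2 1) (-1)

/-- The polynomial `(x y) (z t)`. -/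
def metabPoly (F : Type u) [Field F] : FreeNonUnitalNonAssocAlgebra F (Fin 4) :=
  MonoidAlgebra.single (FreeMagma.mul (FreeMagma.mul (FreeMagma.of 0) (FreeMagma.of 1))
    (FreeMagma.mul (FreeMagma.of 2) (FreeMagma.of 3))) 1

theorem isMultilinearPoly_leftAltPoly : IsMultilinearPoly (leftAltPoly F) :=
  (((isMultilinearPoly_single (by decide) _).add (isMultilinearPoly_single (by decide) _)).add
    (isMultilinearPoly_single (by decide) _)).add (isMultilinearPoly_single (by decide) _)

theorem isMultilinearPoly_rightAltPoly : IsMultilinearPoly (rightAltPoly F) :=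
  (((isMultilinearPoly_single (by decide) _).add (isMultilinearPoly_single (by decide) _)).add
    (isMultilinearPoly_single (by decide) _)).add (isMultilinearPoly_single (by decide) _)

theorem isMultilinearPoly_metabPoly : IsMultilinearPoly (metabPoly F) :=
  isMultilinearPoly_single (by decide) _

/-- Polarization: the linearized identity at repeated arguments is twice the original one, and 2 is
invertible. -/
theorem mem_altMetabelian_iff_sat [CharZero F] (A : NAAlgebra F) :
    A ∈ altMetabelian F ↔
      A.Sat (leftAltPoly F) ∧ A.Sat (rightAltPoly F) ∧ A.Sat (metabPoly F) := by
  have two : (2 : F) ≠ 0 := two_ne_zero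
  constructor
  · rintro ⟨h1, h2, h3⟩
    refine ⟨fun a => ?_, fun a => ?_, fun a => ?_⟩
    · have e := h1 (a 0 + a 1) (a 2)
      have e0 := h1 (a 0) (a 2)
      have e1 := h1 (a 1) (a 2)
      simp only [associator, add_mul, mul_add] at e e0 e1
      simp only [leftAltPoly, map_add, lift_single, evalWord, wordL, wordR]
      linear_combination (norm := module) e - e0 - e1
    · have e := h2 (a 0) (a 1 + a 2)
      have e0 := h2 (a 0) (a 1)
      have e1 := h2 (a 0) (a 2)
      simp only [associator, add_mul, mul_add] at e e0 e1
      simp only [rightAltPoly, map_add, lift_single, evalWord, wordL, wordR]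
      linear_combination (norm := module) e - e0 - e1
    · simp only [metabPoly, lift_single, evalWord, one_smul, h3]
  · rintro ⟨h1, h2, h3⟩
    refine ⟨fun x y => ?_, fun x y => ?_, fun x y z t => ?_⟩
    · have e := h1 ![x, x, y]
      simp only [leftAltPoly, map_add, lift_single, evalWord, wordL, wordR] at e
      simp only [Matrix.cons_val] at e
      have : (2 : F) • associator x x y = 0 := by
        simp only [associator]
        linear_combination (norm := module) e
      exact (smul_eq_zero.1 this).resolve_left two
    · have e := h2 ![x, y, y]
      simp only [rightAltPoly, map_add, lift_single, evalWord, wordL, wordR] at e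
      simp only [Matrix.cons_val] at e
      have : (2 : F) • associator x y y = 0 := by
        simp only [associator]
        linear_combination (norm := module) e
      exact (smul_eq_zero.1 this).resolve_left two
    · have e := h3 ![x, y, z, t]
      simpa [metabPoly, lift_single, evalWord] using e

/-- The identities of alternative metabelian superalgebras. -/
structure Superalgebra.IsAltMetabelian (A : Superalgebra F) : Prop where
  left_alt : ∀ (i j k : ZMod 2) (a b c : A.carrier), a ∈ A.part i → b ∈ A.part j → c ∈ A.part k →
    a * b * c - a * (b * c) + paritySign i j • (b * a * c - b * (a * c)) = 0
  right_alt : ∀ (i j k : ZMod 2) (a b c : A.carrier), a ∈ A.part i → b ∈ A.part j → c ∈ A.part k →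
    a * b * c - a * (b * c) + paritySign j k • (a * c * b - a * (c * b)) = 0
  metab : ∀ a b c d : A.carrier, a * b * (c * d) = 0

theorem Superalgebra.exists_add (A : Superalgebra F) (a : A.carrier) :
    ∃ b ∈ A.part 0, ∃ c ∈ A.part 1, a = b + c := by
  have : a ∈ A.part 0 ⊔ A.part 1 := by rw [A.isCompl.sup_eq_top]; trivial
  obtain ⟨b, hb, c, hc, rfl⟩ := Submodule.mem_sup.1 this
  exact ⟨b, hb, c, hc, rfl⟩

theorem superSatisfies_leftAltPoly_iff (A : Superalgebra F) :
    A.SuperSatisfies (leftAltPoly F) ↔ ∀ (i j k : ZMod 2) (a b c : A.carrier),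
      a ∈ A.part i → b ∈ A.part j → c ∈ A.part k →
      a * b * c - a * (b * c) + paritySign i j • (b * a * c - b * (a * c)) = 0 := by
  have key : ∀ (p : Fin 3 → ZMod 2) (a : Fin 3 → A.carrier),
      FreeNonUnitalNonAssocAlgebra.lift F a (superization p (leftAltPoly F)) =
        a 0 * a 1 * a 2 - a 0 * (a 1 * a 2) +
          paritySign (p 0) (p 1) • (a 1 * a 0 * a 2 - a 1 * (a 0 * a 2)) := by
    intro p a
    have h1 : koszulSign p [0, 1, 2] = 1 := by simp [koszulSign]
    have h2 : koszulSign p [1, 0, 2] = paritySign (p 0) (p 1) := by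
      by_cases h : p 0 = 1 ∧ p 1 = 1
      · simp [koszulSign, paritySign, h]
      · simp [koszulSign, paritySign, h, and_comm]
    simp only [leftAltPoly, superization_add, superization_single, map_add, lift_single, evalWord,
      wordL, wordR, wordLetters, List.cons_append, List.nil_append, h1, h2, ← Int.cast_smul_eq_zsmul F]
    push_cast
    module
  constructor
  · intro h i j k a b c ha hb hc
    have := h ![i, j, k] ![a, b, c] (by intro l; fin_cases l <;> simpa)
    rw [key] at this
    exact this
  · intro h p a ha
    rw [key]
    exact h _ _ _ _ _ _ (ha 0) (ha 1) (ha 2)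

theorem superSatisfies_rightAltPoly_iff (A : Superalgebra F) :
    A.SuperSatisfies (rightAltPoly F) ↔ ∀ (i j k : ZMod 2) (a b c : A.carrier),
      a ∈ A.part i → b ∈ A.part j → c ∈ A.part k →
      a * b * c - a * (b * c) + paritySign j k • (a * c * b - a * (c * b)) = 0 := by
  have key : ∀ (p : Fin 3 → ZMod 2) (a : Fin 3 → A.carrier),
      FreeNonUnitalNonAssocAlgebra.lift F a (superization p (rightAltPoly F)) =
        a 0 * a 1 * a 2 - a 0 * (a 1 * a 2) +
          paritySign (p 1) (p 2) • (a 0 * a 2 * a 1 - a 0 * (a 2 * a 1)) := by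
    intro p a
    have h1 : koszulSign p [0, 1, 2] = 1 := by simp [koszulSign]
    have h2 : koszulSign p [0, 2, 1] = paritySign (p 1) (p 2) := by
      by_cases h : p 1 = 1 ∧ p 2 = 1
      · simp [koszulSign, paritySign, h]
      · simp [koszulSign, paritySign, h, and_comm]
    simp only [rightAltPoly, superization_add, superization_single, map_add, lift_single, evalWord,
      wordL, wordR, wordLetters, List.cons_append, List.nil_append, h1, h2, ← Int.cast_smul_eq_zsmul F]
    push_cast
    module
  constructor
  · intro h i j k a b c ha hb hc
    have := h ![i, j, k] ![a, b, c] (by intro l; fin_cases l <;> simpa)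
    rw [key] at this
    exact this
  · intro h p a ha
    rw [key]
    exact h _ _ _ _ _ _ (ha 0) (ha 1) (ha 2)

theorem superSatisfies_metabPoly_iff (A : Superalgebra F) :
    A.SuperSatisfies (metabPoly F) ↔ ∀ a b c d : A.carrier, a * b * (c * d) = 0 := by
  have key : ∀ (p : Fin 4 → ZMod 2) (a : Fin 4 → A.carrier),
      FreeNonUnitalNonAssocAlgebra.lift F a (superization p (metabPoly F)) =
        a 0 * a 1 * (a 2 * a 3) := by
    intro p a
    have h1 : koszulSign p [0, 1, 2, 3] = 1 := by simp [koszulSign]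
    simp [metabPoly, superization_single, lift_single, evalWord, wordLetters, h1]
  constructor
  · intro h
    have hh : ∀ (i j k l : ZMod 2) (a b c d : A.carrier), a ∈ A.part i → b ∈ A.part j →
        c ∈ A.part k → d ∈ A.part l → a * b * (c * d) = 0 := by
      intro i j k l a b c d ha hb hc hd
      have := h ![i, j, k, l] ![a, b, c, d] (by intro l; fin_cases l <;> simpa)
      rw [key] at this
      exact this
    intro a b c d
    obtain ⟨a0, ha0, a1, ha1, rfl⟩ := A.exists_add a
    obtain ⟨b0, hb0, b1, hb1, rfl⟩ := A.exists_add b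
    obtain ⟨c0, hc0, c1, hc1, rfl⟩ := A.exists_add c
    obtain ⟨d0, hd0, d1, hd1, rfl⟩ := A.exists_add d
    simp only [add_mul, mul_add, hh _ _ _ _ _ _ _ _ ha0 hb0 hc0 hd0,
      hh _ _ _ _ _ _ _ _ ha0 hb0 hc0 hd1, hh _ _ _ _ _ _ _ _ ha0 hb0 hc1 hd0,
      hh _ _ _ _ _ _ _ _ ha0 hb0 hc1 hd1, hh _ _ _ _ _ _ _ _ ha0 hb1 hc0 hd0,
      hh _ _ _ _ _ _ _ _ ha0 hb1 hc0 hd1, hh _ _ _ _ _ _ _ _ ha0 hb1 hc1 hd0,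
      hh _ _ _ _ _ _ _ _ ha0 hb1 hc1 hd1, hh _ _ _ _ _ _ _ _ ha1 hb0 hc0 hd0,
      hh _ _ _ _ _ _ _ _ ha1 hb0 hc0 hd1, hh _ _ _ _ _ _ _ _ ha1 hb0 hc1 hd0,
      hh _ _ _ _ _ _ _ _ ha1 hb0 hc1 hd1, hh _ _ _ _ _ _ _ _ ha1 hb1 hc0 hd0,
      hh _ _ _ _ _ _ _ _ ha1 hb1 hc0 hd1, hh _ _ _ _ _ _ _ _ ha1 hb1 hc1 hd0,
      hh _ _ _ _ _ _ _ _ ha1 hb1 hc1 hd1, add_zero]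
  · intro h p a _
    rw [key]
    exact h _ _ _ _

theorem mem_superClass_iff_superSatisfies [CharZero F] (A : Superalgebra F) :
    A ∈ superClass (altMetabelian F) ↔ A.SuperSatisfies (leftAltPoly F) ∧
      A.SuperSatisfies (rightAltPoly F) ∧ A.SuperSatisfies (metabPoly F) := by
  rw [superSatisfies_iff_envelope_sat A isMultilinearPoly_leftAltPoly,
    superSatisfies_iff_envelope_sat A isMultilinearPoly_rightAltPoly,
    superSatisfies_iff_envelope_sat A isMultilinearPoly_metabPoly]
  exact mem_altMetabelian_iff_sat A.envelope

theorem mem_superClass_iff [CharZero F] (A : Superalgebra F) :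
    A ∈ superClass (altMetabelian F) ↔ A.IsAltMetabelian := by
  rw [mem_superClass_iff_superSatisfies, superSatisfies_leftAltPoly_iff,
    superSatisfies_rightAltPoly_iff, superSatisfies_metabPoly_iff]
  exact ⟨fun h => ⟨h.1, h.2.1, h.2.2⟩, fun h => ⟨h.left_alt, h.right_alt, h.metab⟩⟩

end Multilinear

/-! ### Universal properties of the relatively free algebras and superalgebras. -/

section FreeObjects

variable {F : Type u} [Field F] {n : ℕ}

theorem proj_smul {A : NAAlgebra F} (I : AlgIdeal A) (c : ℤ) (a : A.carrier) :
    I.proj (c • a) = c • I.proj a := map_zsmul _ _ _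

/-- The kernel of a multiplicative linear map. -/
def kerIdeal {A : NAAlgebra F} {B : Type*} [NonUnitalNonAssocRing B] [Module F B]
    (φ : A.carrier →ₗ[F] B) (hφ : ∀ x y, φ (x * y) = φ x * φ y) : AlgIdeal A where
  toSubmodule := LinearMap.ker φ
  mul_left_mem a x hx := by
    rw [LinearMap.mem_ker] at hx ⊢
    rw [hφ, hx, mul_zero]
  mul_right_mem a x hx := by
    rw [LinearMap.mem_ker] at hx ⊢
    rw [hφ, hx, zero_mul]

theorem mem_kerIdeal {A : NAAlgebra F} {B : Type*} [NonUnitalNonAssocRing B] [Module F B]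
    (φ : A.carrier →ₗ[F] B) (hφ : ∀ x y, φ (x * y) = φ x * φ y) (x : A.carrier) :
    x ∈ (kerIdeal φ hφ).toSubmodule ↔ φ x = 0 := LinearMap.mem_ker

/-- An identity holds modulo an intersection of ideals as soon as it holds modulo each of them; this
is why the relatively free algebra itself belongs to V. -/
theorem quot_inter_mem_altMetabelian (A : NAAlgebra F) (S : Set (AlgIdeal A))
    (hS : ∀ I ∈ S, I.quot ∈ altMetabelian F) : (AlgIdeal.inter S).quot ∈ altMetabelian F := by
  refine ⟨fun x y => ?_, fun x y => ?_, fun x y z t => ?_⟩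
  · obtain ⟨x, rfl⟩ := AlgIdeal.proj_surjective _ x
    obtain ⟨y, rfl⟩ := AlgIdeal.proj_surjective _ y
    simp only [associator, ← AlgIdeal.proj_mul, ← map_sub]
    rw [AlgIdeal.proj_eq_zero, AlgIdeal.mem_inter]
    intro I hI
    rw [← AlgIdeal.proj_eq_zero, map_sub]
    simp only [AlgIdeal.proj_mul]
    exact (hS I hI).1 _ _
  · obtain ⟨x, rfl⟩ := AlgIdeal.proj_surjective _ x
    obtain ⟨y, rfl⟩ := AlgIdeal.proj_surjective _ y
    simp only [associator, ← AlgIdeal.proj_mul, ← map_sub]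
    rw [AlgIdeal.proj_eq_zero, AlgIdeal.mem_inter]
    intro I hI
    rw [← AlgIdeal.proj_eq_zero, map_sub]
    simp only [AlgIdeal.proj_mul]
    exact (hS I hI).2.1 _ _
  · obtain ⟨x, rfl⟩ := AlgIdeal.proj_surjective _ x
    obtain ⟨y, rfl⟩ := AlgIdeal.proj_surjective _ y
    obtain ⟨z, rfl⟩ := AlgIdeal.proj_surjective _ z
    obtain ⟨t, rfl⟩ := AlgIdeal.proj_surjective _ t
    simp only [← AlgIdeal.proj_mul]
    rw [AlgIdeal.proj_eq_zero, AlgIdeal.mem_inter]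
    intro I hI
    rw [← AlgIdeal.proj_eq_zero]
    simp only [AlgIdeal.proj_mul]
    exact (hS I hI).2.2 _ _ _ _

theorem freeAlg_mem (F : Type u) [Field F] (r : ℕ) :
    freeAlg (altMetabelian F) r ∈ altMetabelian F :=
  quot_inter_mem_altMetabelian _ _ fun _ h => h

/-- The linear map underlying the homomorphism from the free algebra given by `b`. -/
def liftLin {X : Type} {B : NAAlgebra F} (b : X → B.carrier) :
    (freeNA F X).carrier →ₗ[F] B.carrier where
  toFun f := FreeNonUnitalNonAssocAlgebra.lift F b f
  map_add' f g := map_add (FreeNonUnitalNonAssocAlgebra.lift F b) f g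
  map_smul' c f := map_smul (FreeNonUnitalNonAssocAlgebra.lift F b) c f

theorem liftLin_mul {X : Type} {B : NAAlgebra F} (b : X → B.carrier)
    (f g : (freeNA F X).carrier) : liftLin b (f * g) = liftLin b f * liftLin b g :=
  map_mul (FreeNonUnitalNonAssocAlgebra.lift F b) f g

/-- The generators of the free nonassociative algebra. -/
def freeGen (F : Type u) [Field F] {X : Type} (x : X) : (freeNA F X).carrier :=
  FreeNonUnitalNonAssocAlgebra.of F x

theorem liftLin_freeGen {X : Type} {B : NAAlgebra F} (b : X → B.carrier) (x : X) :
    liftLin b (freeGen F x) = b x := FreeNonUnitalNonAssocAlgebra.lift_of_apply F b x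

theorem quot_kerIdeal_mem {A B : NAAlgebra F} (hB : B ∈ altMetabelian F)
    (φ : A.carrier →ₗ[F] B.carrier) (hφ : ∀ x y, φ (x * y) = φ x * φ y) :
    (kerIdeal φ hφ).quot ∈ altMetabelian F := by
  refine ⟨fun x y => ?_, fun x y => ?_, fun x y z t => ?_⟩
  · obtain ⟨x, rfl⟩ := AlgIdeal.proj_surjective _ x
    obtain ⟨y, rfl⟩ := AlgIdeal.proj_surjective _ y
    simp only [associator, ← AlgIdeal.proj_mul, ← map_sub]
    rw [AlgIdeal.proj_eq_zero, mem_kerIdeal]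
    simp only [map_sub, hφ]
    exact hB.1 _ _
  · obtain ⟨x, rfl⟩ := AlgIdeal.proj_surjective _ x
    obtain ⟨y, rfl⟩ := AlgIdeal.proj_surjective _ y
    simp only [associator, ← AlgIdeal.proj_mul, ← map_sub]
    rw [AlgIdeal.proj_eq_zero, mem_kerIdeal]
    simp only [map_sub, hφ]
    exact hB.2.1 _ _
  · obtain ⟨x, rfl⟩ := AlgIdeal.proj_surjective _ x
    obtain ⟨y, rfl⟩ := AlgIdeal.proj_surjective _ y
    obtain ⟨z, rfl⟩ := AlgIdeal.proj_surjective _ z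
    obtain ⟨t, rfl⟩ := AlgIdeal.proj_surjective _ t
    simp only [← AlgIdeal.proj_mul]
    rw [AlgIdeal.proj_eq_zero, mem_kerIdeal]
    simp only [hφ]
    exact hB.2.2 _ _ _ _

/-- The generators of the relatively free algebra. -/
def freeAlgGen (F : Type u) [Field F] {r : ℕ} (i : Fin r) :
    (freeAlg (altMetabelian F) r).carrier :=
  AlgIdeal.proj _ (freeGen F i)

/-- Polynomials that vanish at the generators of the relatively free algebra are identities. -/
theorem lift_eq_zero_of_lift_freeAlgGen {A : NAAlgebra F} (hA : A ∈ altMetabelian F) {r : ℕ}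
    (a : Fin r → A.carrier) {f : FreeNonUnitalNonAssocAlgebra F (Fin r)}
    (hf : FreeNonUnitalNonAssocAlgebra.lift F (freeAlgGen F) f = 0) :
    FreeNonUnitalNonAssocAlgebra.lift F a f = 0 := by
  have h1 := lift_map (AlgIdeal.proj
    (AlgIdeal.inter {I : AlgIdeal (freeNA F (Fin r)) | I.quot ∈ altMetabelian F}))
    (AlgIdeal.proj_mul _) (freeGen F) f
  have h2 : FreeNonUnitalNonAssocAlgebra.lift F (freeGen F (X := Fin r)) f = f := by
    have : FreeNonUnitalNonAssocAlgebra.lift F (FreeNonUnitalNonAssocAlgebra.of F (X := Fin r)) =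
        NonUnitalAlgHom.id F _ :=
      ((FreeNonUnitalNonAssocAlgebra.lift_unique F _ (NonUnitalAlgHom.id F _)).1 rfl).symm
    exact congrArg (fun φ => φ f) this
  rw [h2] at h1
  have h3 := h1.symm.trans hf
  replace h3 := (AlgIdeal.mem_inter _ _).1 ((AlgIdeal.proj_eq_zero _ _).1 h3)
  -- The kernel of the evaluation at `a` is one of the ideals that are intersected in the free
  -- algebra.
  exact h3 (kerIdeal (liftLin a) (liftLin_mul a)) (quot_kerIdeal_mem hA _ _)

theorem quot_isAltMetabelian (A : Superalgebra F) (I : AlgIdeal A.toNAAlgebra)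
    (hI : A.IsGraded I)
    (h1 : ∀ (i j k : ZMod 2) (a b c : A.carrier), a ∈ A.part i → b ∈ A.part j → c ∈ A.part k →
      a * b * c - a * (b * c) + paritySign i j • (b * a * c - b * (a * c)) ∈ I.toSubmodule)
    (h2 : ∀ (i j k : ZMod 2) (a b c : A.carrier), a ∈ A.part i → b ∈ A.part j → c ∈ A.part k →
      a * b * c - a * (b * c) + paritySign j k • (a * c * b - a * (c * b)) ∈ I.toSubmodule)
    (h3 : ∀ a b c d : A.carrier, a * b * (c * d) ∈ I.toSubmodule) :
    (A.quot I hI).IsAltMetabelian := by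
  refine ⟨?_, ?_, ?_⟩
  · rintro i j k _ _ _ ⟨a, ha, rfl⟩ ⟨b, hb, rfl⟩ ⟨c, hc, rfl⟩
    have := (AlgIdeal.proj_eq_zero I _).2 (h1 i j k a b c ha hb hc)
    simp only [map_add, map_sub, proj_smul, AlgIdeal.proj_mul] at this
    exact this
  · rintro i j k _ _ _ ⟨a, ha, rfl⟩ ⟨b, hb, rfl⟩ ⟨c, hc, rfl⟩
    have := (AlgIdeal.proj_eq_zero I _).2 (h2 i j k a b c ha hb hc)
    simp only [map_add, map_sub, proj_smul, AlgIdeal.proj_mul] at this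
    exact this
  · intro a b c d
    obtain ⟨a, rfl⟩ := I.proj_surjective a
    obtain ⟨b, rfl⟩ := I.proj_surjective b
    obtain ⟨c, rfl⟩ := I.proj_surjective c
    obtain ⟨d, rfl⟩ := I.proj_surjective d
    have := (AlgIdeal.proj_eq_zero I _).2 (h3 a b c d)
    simp only [AlgIdeal.proj_mul] at this
    exact this

theorem isAltMetabelian_of_quot (A : Superalgebra F) (I : AlgIdeal A.toNAAlgebra)
    (hI : A.IsGraded I) (h : (A.quot I hI).IsAltMetabelian) :
    (∀ (i j k : ZMod 2) (a b c : A.carrier), a ∈ A.part i → b ∈ A.part j → c ∈ A.part k →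
      a * b * c - a * (b * c) + paritySign i j • (b * a * c - b * (a * c)) ∈ I.toSubmodule) ∧
    (∀ (i j k : ZMod 2) (a b c : A.carrier), a ∈ A.part i → b ∈ A.part j → c ∈ A.part k →
      a * b * c - a * (b * c) + paritySign j k • (a * c * b - a * (c * b)) ∈ I.toSubmodule) ∧
    ∀ a b c d : A.carrier, a * b * (c * d) ∈ I.toSubmodule := by
  refine ⟨fun i j k a b c ha hb hc => ?_, fun i j k a b c ha hb hc => ?_, fun a b c d => ?_⟩
  · rw [← AlgIdeal.proj_eq_zero]
    simp only [map_add, map_sub, proj_smul, AlgIdeal.proj_mul]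
    exact h.left_alt i j k _ _ _ ⟨a, ha, rfl⟩ ⟨b, hb, rfl⟩ ⟨c, hc, rfl⟩
  · rw [← AlgIdeal.proj_eq_zero]
    simp only [map_add, map_sub, proj_smul, AlgIdeal.proj_mul]
    exact h.right_alt i j k _ _ _ ⟨a, ha, rfl⟩ ⟨b, hb, rfl⟩ ⟨c, hc, rfl⟩
  · rw [← AlgIdeal.proj_eq_zero]
    simp only [AlgIdeal.proj_mul]
    exact h.metab (I.proj a) (I.proj b) (I.proj c) (I.proj d)

theorem freeSuper_isAltMetabelian [CharZero F] (r s : ℕ) :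
    (freeSuper (altMetabelian F) r s).IsAltMetabelian := by
  have h : ∀ I ∈ superIdeals (altMetabelian F) r s, _ := fun I hI =>
    isAltMetabelian_of_quot _ I hI.choose ((mem_superClass_iff _).1 hI.choose_spec)
  refine quot_isAltMetabelian _ _ _ ?_ ?_ ?_
  · intro i j k a b c ha hb hc
    rw [AlgIdeal.mem_inter]
    exact fun I hI => (h I hI).1 i j k a b c ha hb hc
  · intro i j k a b c ha hb hc
    rw [AlgIdeal.mem_inter]
    exact fun I hI => (h I hI).2.1 i j k a b c ha hb hc
  · intro a b c d
    rw [AlgIdeal.mem_inter]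
    exact fun I hI => (h I hI).2.2 a b c d

/-- The parity of a generator. -/
def genParity {X Y : Type} : X ⊕ Y → ZMod 2
  | Sum.inl _ => 0
  | Sum.inr _ => 1

theorem freeGen_mem_part (F : Type u) [Field F] {X Y : Type} (q : X ⊕ Y) :
    freeGen F q ∈ (freeNASuper F X Y).part (genParity q) := by
  have h : wordParity (FreeMagma.of q) = genParity q := by cases q <;> rfl
  change FreeNonUnitalNonAssocAlgebra.of F q ∈ wordPart F X Y (genParity q)
  exact Submodule.subset_span ⟨FreeMagma.of q, h, rfl⟩

theorem evalWord_mem_part {X Y : Type} (B : Superalgebra F) (b : X ⊕ Y → B.carrier)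
    (hb : ∀ q, b q ∈ B.part (genParity q)) (w : FreeMagma (X ⊕ Y)) :
    evalWord b w ∈ B.part (wordParity w) := by
  induction w using FreeMagma.rec with
  | of q =>
    cases q with
    | inl x => exact hb (Sum.inl x)
    | inr y => exact hb (Sum.inr y)
  | mul v w hv hw => exact B.mul_mem _ _ _ _ hv hw

theorem liftLin_mem_part {X Y : Type} (B : Superalgebra F) (b : X ⊕ Y → B.carrier)
    (hb : ∀ q, b q ∈ B.part (genParity q)) (i : ZMod 2) (f : (freeNASuper F X Y).carrier)
    (hf : f ∈ (freeNASuper F X Y).part i) :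
    liftLin (B := B.toNAAlgebra) b f ∈ B.part i := by
  have hf' : f ∈ wordPart F X Y i := hf
  unfold wordPart at hf'
  refine Submodule.span_induction (p := fun f _ => liftLin (B := B.toNAAlgebra) b f ∈ B.part i)
    ?_ ?_ ?_ ?_ hf'
  · rintro _ ⟨w, rfl, rfl⟩
    have := lift_single b w (1 : F)
    rw [one_smul] at this
    exact (congrArg (· ∈ B.part (wordParity w)) this).mpr (evalWord_mem_part B b hb w)
  · rw [map_zero]; exact Submodule.zero_mem _
  · intro x y _ _ hx hy; rw [map_add]; exact Submodule.add_mem _ hx hy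
  · intro c x _ hx; rw [map_smul]; exact Submodule.smul_mem _ _ hx

theorem ker_isGraded {A B : Superalgebra F} (φ : A.carrier →ₗ[F] B.carrier)
    (hφ : ∀ x y, φ (x * y) = φ x * φ y) (hp : ∀ i, ∀ x ∈ A.part i, φ x ∈ B.part i) :
    A.IsGraded (kerIdeal φ hφ) := by
  intro x hx y hy hxy
  rw [mem_kerIdeal, map_add] at hxy
  rw [mem_kerIdeal, mem_kerIdeal]
  have h0 : φ x = 0 :=
    (Submodule.disjoint_def.1 B.isCompl.disjoint) _ (hp 0 x hx) (by
      rw [eq_neg_of_add_eq_zero_left hxy]; exact Submodule.neg_mem _ (hp 1 y hy))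
  exact ⟨h0, by rwa [h0, zero_add] at hxy⟩

theorem quot_ker_isAltMetabelian {A B : Superalgebra F} (hB : B.IsAltMetabelian)
    (φ : A.carrier →ₗ[F] B.carrier) (hφ : ∀ x y, φ (x * y) = φ x * φ y)
    (hp : ∀ i, ∀ x ∈ A.part i, φ x ∈ B.part i) :
    (A.quot _ (ker_isGraded φ hφ hp)).IsAltMetabelian := by
  refine quot_isAltMetabelian _ _ _ ?_ ?_ ?_
  · intro i j k x y z hx hy hz
    rw [mem_kerIdeal]
    simp only [map_add, map_sub, map_zsmul, hφ]
    exact hB.left_alt i j k _ _ _ (hp _ _ hx) (hp _ _ hy) (hp _ _ hz)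
  · intro i j k x y z hx hy hz
    rw [mem_kerIdeal]
    simp only [map_add, map_sub, map_zsmul, hφ]
    exact hB.right_alt i j k _ _ _ (hp _ _ hx) (hp _ _ hy) (hp _ _ hz)
  · intro x y z t
    rw [mem_kerIdeal]
    simp only [hφ]
    exact hB.metab _ _ _ _

/-- The generators of the free `V`-superalgebra. -/
def freeSuperGen (F : Type u) [Field F] {r s : ℕ} (q : Fin r ⊕ Fin s) :
    (freeSuper (altMetabelian F) r s).carrier :=
  AlgIdeal.proj (AlgIdeal.inter (superIdeals (altMetabelian F) r s)) (freeGen F q)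

theorem freeSuperGen_mem {r s : ℕ} (q : Fin r ⊕ Fin s) :
    freeSuperGen F q ∈ (freeSuper (altMetabelian F) r s).part (genParity q) :=
  ⟨_, freeGen_mem_part F q, rfl⟩

/-- The kernel of a parity-preserving evaluation in a V-superalgebra is among the graded ideals
defining the free superalgebra. The map `q` may repeat generators, so few generators serve
polynomials in many variables. -/
theorem lift_eq_zero_of_lift_freeSuperGen [CharZero F] {r s : ℕ} (B : Superalgebra F)
    (hB : B.IsAltMetabelian) (b : Fin r ⊕ Fin s → B.carrier)
    (hb : ∀ q, b q ∈ B.part (genParity q)) (q : Fin n → Fin r ⊕ Fin s)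
    (f : FreeNonUnitalNonAssocAlgebra F (Fin n))
    (hf : FreeNonUnitalNonAssocAlgebra.lift F (fun i => freeSuperGen F (q i)) f = 0) :
    FreeNonUnitalNonAssocAlgebra.lift F (fun i => b (q i)) f = 0 := by
  have h2 := lift_map (AlgIdeal.proj (AlgIdeal.inter (superIdeals (altMetabelian F) r s)))
    (AlgIdeal.proj_mul _) (fun i => freeGen F (q i)) f
  have h3 := h2.symm.trans hf
  replace h3 := (AlgIdeal.mem_inter _ _).1 ((AlgIdeal.proj_eq_zero _ _).1 h3)
  let φ : (freeNASuper F (Fin r) (Fin s)).carrier →ₗ[F] B.carrier :=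
    liftLin (B := B.toNAAlgebra) b
  have hφ : ∀ x y, φ (x * y) = φ x * φ y := liftLin_mul b
  have hp := liftLin_mem_part B b hb
  have h4 := h3 (kerIdeal φ hφ) ⟨ker_isGraded φ hφ hp,
    (mem_superClass_iff _).2 (quot_ker_isAltMetabelian hB φ hφ hp)⟩
  have h5 := (mem_kerIdeal φ hφ _).1 h4
  have h6 := lift_map φ hφ (fun i => freeGen F (q i)) f
  have h7 : (fun i => φ (freeGen F (q i))) = fun i => b (q i) :=
    funext fun i => liftLin_freeGen (B := B.toNAAlgebra) b (q i)
  rw [h7] at h6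
  exact h6.trans h5

/-- A superidentity of the free `V`-superalgebra vanishes at all homogeneous elements of the
parities of the generators in all `V`-superalgebras. -/
theorem lift_superization_eq_zero [CharZero F] {r s : ℕ}
    {f : FreeNonUnitalNonAssocAlgebra F (Fin n)}
    (hf : (freeSuper (altMetabelian F) r s).SuperSatisfies f) (B : Superalgebra F)
    (hB : B.IsAltMetabelian) (b : Fin r ⊕ Fin s → B.carrier)
    (hb : ∀ q, b q ∈ B.part (genParity q)) (q : Fin n → Fin r ⊕ Fin s) :
    FreeNonUnitalNonAssocAlgebra.lift F (fun i => b (q i))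
      (superization (fun i => genParity (q i)) f) = 0 :=
  lift_eq_zero_of_lift_freeSuperGen B hB b hb q _
    (hf (fun i => genParity (q i)) _ fun i => freeSuperGen_mem (q i))

/-- If every superidentity of the free `V`-superalgebra on `r` even and `s` odd generators is an
identity of `V`, then this superalgebra generates the supervariety of all `V`-superalgebras. -/
theorem supervarietyRS_eq [CharZero F] {r s : ℕ}
    (h : ∀ (n : ℕ) (f : FreeNonUnitalNonAssocAlgebra F (Fin n)), IsMultilinearPoly f →
      (freeSuper (altMetabelian F) r s).SuperSatisfies f → ∀ A ∈ altMetabelian F, A.Sat f) :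
    supervarietyRS (altMetabelian F) r s = superClass (altMetabelian F) := by
  ext B
  constructor
  · intro hB
    have hC := (mem_superClass_iff_superSatisfies _).1
      ((mem_superClass_iff _).2 (freeSuper_isAltMetabelian (F := F) r s))
    exact (mem_superClass_iff_superSatisfies B).2
      ⟨hB _ _ isMultilinearPoly_leftAltPoly hC.1, hB _ _ isMultilinearPoly_rightAltPoly hC.2.1,
        hB _ _ isMultilinearPoly_metabPoly hC.2.2⟩
  · intro hB n f hf hC
    exact (superSatisfies_iff_envelope_sat B hf).2 (h n f hf hC _ hB)

end FreeObjects

/-! ### Operator relations on products in metabelian alternative algebras. -/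

section Identities

variable {F : Type u} [Field F] {A : NAAlgebra F}

theorem left_alt_lin (hA : A ∈ altMetabelian F) (a b c : A.carrier) :
    a * b * c - a * (b * c) + (b * a * c - b * (a * c)) = 0 := by
  have e := hA.1 (a + b) c
  have e0 := hA.1 a c
  have e1 := hA.1 b c
  simp only [associator, add_mul, mul_add] at e e0 e1
  linear_combination (norm := abel) e - e0 - e1

theorem right_alt_lin (hA : A ∈ altMetabelian F) (a b c : A.carrier) :
    a * b * c - a * (b * c) + (a * c * b - a * (c * b)) = 0 := by
  have e := hA.2.1 a (b + c)
  have e0 := hA.2.1 a b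
  have e1 := hA.2.1 a c
  simp only [associator, add_mul, mul_add] at e e0 e1
  linear_combination (norm := abel) e - e0 - e1

/-- The middle Moufang identity in a metabelian alternative algebra. -/
theorem middle_moufang [CharZero F] (hA : A ∈ altMetabelian F) (x y z : A.carrier) :
    x * (y * z * x) = 0 := by
  have m := hA.2.2
  have l := left_alt_lin hA
  have r := right_alt_lin hA
  have t1 := congrArg (· * y) (r z x x)
  have t2 := congrArg (y * ·) (r z x x)
  have t3 := congrArg (z * ·) (l x x y)
  have t4 := congrArg (· * x) (l x y z)
  have t5 := congrArg (· * x) (r y x z)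
  have s1 := l x x (y * z)
  have s2 := r (y * z) x x
  have s3 := l (x * x) y z
  have s4 := r (x * x) y z
  have s5 := l (x * x) z y
  have s6 := l (x * y) x z
  have s7 := r (x * y) x z
  have s8 := r x (x * y) z
  have s9 := r (z * x) x y
  have s10 := r x x (y * z)
  have s11 := l (z * x) y x
  have s12 := l x z (x * y)
  have s13 := r y (x * x) z
  simp only [mul_add, add_mul, mul_sub, sub_mul, m, mul_zero, zero_mul] at *
  -- An explicit linear dependence among consequences of degree 4: the `t` are linearized
  -- alternative laws multiplied by a letter, the `s` are such laws with a product substituted for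
  -- an argument.
  have : (2 : F) • (x * (y * z * x)) = 0 := by
    linear_combination (norm := module) s1 - s2 + t1 + t2 + t3 + (2 : F) • s3 - (2 : F) • s4 +
      (2 : F) • s5 - (2 : F) • s6 + (2 : F) • s7 + (2 : F) • s8 - (2 : F) • s9 - (2 : F) • s10 +
      (2 : F) • s11 - (2 : F) • s12 - (2 : F) • s13 - (2 : F) • t4 + (2 : F) • t5
  exact (smul_eq_zero.1 this).resolve_left two_ne_zero

/-- `R_x R_y = - R_y R_x` on products. -/
theorem mul_right_right (hA : A ∈ altMetabelian F) (a b x y : A.carrier) :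
    a * b * y * x = -(a * b * x * y) := by
  have h := right_alt_lin hA (a * b) x y
  simp only [hA.2.2, sub_zero] at h
  exact eq_neg_of_add_eq_zero_right h

/-- `L_x L_y = R_x R_y` on products. -/
theorem mul_left_left (hA : A ∈ altMetabelian F) (a b x y : A.carrier) :
    y * (x * (a * b)) = a * b * x * y := by
  have h1 := left_alt_lin hA x (a * b) y
  have h2 := right_alt_lin hA x (a * b) y
  have h3 := left_alt_lin hA x y (a * b)
  simp only [hA.2.2] at h1 h2 h3
  linear_combination (norm := abel) h2 - h1 - h3

/-- Linearization of x(wx) = 0 for a product w = ab: the operators R_yL_x are skew-symmetric in x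
and y. -/
theorem mul_right_left [CharZero F] (hA : A ∈ altMetabelian F) (a b x y : A.carrier) :
    x * (a * b * y) = -(y * (a * b * x)) := by
  have h := middle_moufang hA (x + y) a b
  simp only [mul_add, add_mul, middle_moufang hA, zero_add, add_zero] at h
  exact eq_neg_of_add_eq_zero_left (by rw [add_comm]; exact h)

/-- `L_x R_y = - R_x L_y - R_x R_y` on products. -/
theorem mul_left_right [CharZero F] (hA : A ∈ altMetabelian F) (a b x y : A.carrier) :
    x * (a * b) * y = -(y * (a * b * x)) - a * b * x * y := by
  have h1 := left_alt_lin hA x (a * b) y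
  have h2 := mul_right_left hA a b x y
  simp only [hA.2.2] at h1
  linear_combination (norm := abel) h1 + h2

end Identities

/-! ### Rewriting the operators that follow the leading pair, and then the leading pair. -/

section Tails

variable {F : Type u} [Field F] {A : NAAlgebra F} {X : Type}

/-- The result of applying to `w` the multiplications by `x i` for the entries `(b, i)` of a list:
from the right if `b` is `true`, from the left otherwise. -/
def act (x : X → A.carrier) : A.carrier → List (Bool × X) → A.carrier
  | w, [] => w
  | w, (true, i) :: T => act x (w * x i) T
  | w, (false, i) :: T => act x (x i * w) T

/-- The result of applying to `w` the right multiplications by `x i` for the entries of a list. -/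
def rmul {M : Type*} [Mul M] (x : X → M) : M → List X → M
  | w, [] => w
  | w, i :: l => rmul x (w * x i) l

theorem act_add (x : X → A.carrier) (T : List (Bool × X)) (v w : A.carrier) :
    act x (v + w) T = act x v T + act x w T := by
  induction T generalizing v w with
  | nil => rfl
  | cons t T ih => rcases t with ⟨_ | _, i⟩ <;> simp only [act, add_mul, mul_add, ih]

theorem act_neg (x : X → A.carrier) (T : List (Bool × X)) (w : A.carrier) :
    act x (-w) T = -act x w T := by
  induction T generalizing w with
  | nil => rfl
  | cons t T ih => rcases t with ⟨_ | _, i⟩ <;> simp only [act, neg_mul, mul_neg, ih]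

theorem act_sub (x : X → A.carrier) (T : List (Bool × X)) (v w : A.carrier) :
    act x (v - w) T = act x v T - act x w T := by
  rw [sub_eq_add_neg, act_add, act_neg, sub_eq_add_neg]

theorem act_append (x : X → A.carrier) (T : List (Bool × X)) (b : Bool) (i : X)
    (w : A.carrier) :
    act x w (T ++ [(b, i)]) = if b then act x w T * x i else x i * act x w T := by
  induction T generalizing w with
  | nil => cases b <;> rfl
  | cons t T ih => rcases t with ⟨_ | _, j⟩ <;> simp only [List.cons_append, act, ih]

theorem rmul_eq_act (x : X → A.carrier) (l : List X) (w : A.carrier) :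
    rmul x w l = act x w (l.map fun i => (true, i)) := by
  induction l generalizing w with
  | nil => rfl
  | cons i l ih => simp only [rmul, List.map_cons, act, ih]

theorem rmul_add (x : X → A.carrier) (l : List X) (v w : A.carrier) :
    rmul x (v + w) l = rmul x v l + rmul x w l := by
  simp only [rmul_eq_act, act_add]

theorem rmul_neg (x : X → A.carrier) (l : List X) (w : A.carrier) :
    rmul x (-w) l = -rmul x w l := by
  simp only [rmul_eq_act, act_neg]

theorem rmul_sub (x : X → A.carrier) (l : List X) (v w : A.carrier) :
    rmul x (v - w) l = rmul x v l - rmul x w l := by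
  simp only [rmul_eq_act, act_sub]

/-- Right multiplications anticommute on products, and the value stays a product after each of them,
so any permutation only costs a sign. -/
theorem rmul_perm (hA : A ∈ altMetabelian F) (x : X → A.carrier) {l l' : List X}
    (h : l.Perm l') (a b : A.carrier) :
    rmul x (a * b) l = rmul x (a * b) l' ∨ rmul x (a * b) l = -rmul x (a * b) l' := by
  induction h generalizing a b with
  | nil => exact Or.inl rfl
  | cons i _ ih => exact ih (a * b) (x i)
  | swap i j l =>
    right
    simp only [rmul]
    rw [mul_right_right hA a b (x i) (x j), rmul_neg]
  | trans _ _ ih₁ ih₂ =>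
    rcases ih₁ a b with h₁ | h₁ <;> rcases ih₂ a b with h₂ | h₂ <;> simp [h₁, h₂]

/-- The span of the values of the skew-symmetric operators of a given list of variables. -/
def skewSpan (x : X → A.carrier) (w : A.carrier) : List X → Submodule F A.carrier
  | [] => Submodule.span F {w}
  | i :: l => Submodule.span F {rmul x (w * x i) l, rmul x (x i * w) l}

/-- Both operators R_iR_j... and L_iR_j... are skew-symmetric in all letters. Permutations of the
later letters are covered by `rmul_perm`; only the exchange of the first two is new. -/
theorem skewSpan_perm [CharZero F] (hA : A ∈ altMetabelian F) (x : X → A.carrier)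
    {l l' : List X} (h : l.Perm l') (a b : A.carrier) :
    skewSpan x (a * b) l ≤ skewSpan x (a * b) l' := by
  induction h with
  | nil => exact le_rfl
  | @cons i l l' h _ =>
    refine Submodule.span_le.2 ?_
    rintro _ (rfl | rfl)
    · rcases rmul_perm hA x h (a * b) (x i) with h | h
      · rw [h]; exact Submodule.subset_span (Or.inl rfl)
      · rw [h]; exact Submodule.neg_mem _ (Submodule.subset_span (Or.inl rfl))
    · rcases rmul_perm hA x h (x i) (a * b) with h | h
      · rw [h]; exact Submodule.subset_span (Or.inr rfl)
      · rw [h]; exact Submodule.neg_mem _ (Submodule.subset_span (Or.inr rfl))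
  | swap i j l =>
    refine Submodule.span_le.2 ?_
    rintro _ (rfl | rfl)
    · simp only [rmul]
      rw [mul_right_right hA a b (x i) (x j), rmul_neg]
      exact Submodule.neg_mem _ (Submodule.subset_span (Or.inl rfl))
    -- L_jR_i = -L_iR_j: after expanding by L_xR_y = -R_xL_y - R_xR_y, both summands are skew.
    · have : x j * (a * b) * x i = -(x i * (a * b) * x j) := by
        rw [mul_left_right hA, mul_left_right hA, mul_right_left hA a b (x i) (x j),
          mul_right_right hA a b (x i) (x j)]
        abel
      simp only [rmul, this, rmul_neg]
      exact Submodule.neg_mem _ (Submodule.subset_span (Or.inr rfl))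
  | trans _ _ ih₁ ih₂ => exact ih₁.trans ih₂

/-- By induction the tail beyond its first letter may be taken as R...R or LR...R. Then L_iL_j =
R_iR_j and R_iL_j = -L_iR_j - R_iR_j remove the left multiplication from the second place. -/
theorem act_mem_skewSpan [CharZero F] (hA : A ∈ altMetabelian F) (x : X → A.carrier)
    (T : List (Bool × X)) (a b : A.carrier) :
    act x (a * b) T ∈ skewSpan x (a * b) (T.map Prod.snd) := by
  induction T generalizing a b with
  | nil => exact Submodule.subset_span rfl
  | cons t T ih =>
    rcases T with _ | ⟨s, T⟩
    · rcases t with ⟨_ | _, i⟩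
      · exact Submodule.subset_span (Or.inr rfl)
      · exact Submodule.subset_span (Or.inl rfl)
    · rcases t with ⟨_ | _, i⟩
      · refine (Submodule.span_le.2 ?_ : skewSpan x (x i * (a * b)) (s.2 :: T.map Prod.snd) ≤ _)
          (ih (x i) (a * b))
        rintro _ (rfl | rfl)
        · exact Submodule.subset_span (Or.inr rfl)
        · rw [mul_left_left hA]; exact Submodule.subset_span (Or.inl rfl)
      · refine (Submodule.span_le.2 ?_ : skewSpan x (a * b * x i) (s.2 :: T.map Prod.snd) ≤ _)
          (ih (a * b) (x i))
        rintro _ (rfl | rfl)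
        · exact Submodule.subset_span (Or.inl rfl)
        · have : x s.2 * (a * b * x i) = -(x i * (a * b) * x s.2) - a * b * x i * x s.2 := by
            rw [mul_left_right hA]; abel
          rw [this, rmul_sub, rmul_neg]
          exact Submodule.sub_mem _ (Submodule.neg_mem _ (Submodule.subset_span (Or.inr rfl)))
            (Submodule.subset_span (Or.inl rfl))

/-- A letter of the tail may be assumed to act first, and from the left: the operator R_iR_j... that
starts differently equals L_iL_j.... A second letter j is needed for this, hence `l ≠ []`. -/
theorem act_mem_of_left [CharZero F] (hA : A ∈ altMetabelian F) (x : X → A.carrier)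
    (S : Submodule F A.carrier) (a b : A.carrier) (i : X) (l : List X) (hl : l ≠ [])
    (h : ∀ T : List (Bool × X), (T.map Prod.snd).Perm l → act x (x i * (a * b)) T ∈ S)
    (T : List (Bool × X)) (hT : (T.map Prod.snd).Perm (i :: l)) : act x (a * b) T ∈ S := by
  refine (Submodule.span_le.2 ?_ : skewSpan x (a * b) (i :: l) ≤ S)
    (skewSpan_perm hA x hT a b (act_mem_skewSpan hA x T a b))
  rintro _ (rfl | rfl)
  · obtain ⟨j, l, rfl⟩ := List.exists_cons_of_ne_nil hl
    have := h ((false, j) :: l.map fun i => (true, i)) (by simp)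
    rw [rmul, ← mul_left_left hA, rmul_eq_act]
    exact this
  · rw [rmul_eq_act]
    exact h _ (by simp)

/-- The counterpart for right multiplication: L_iR_j = -R_iL_j - R_iR_j lets `i` act first from the
right, again using a second letter. -/
theorem act_mem_of_right [CharZero F] (hA : A ∈ altMetabelian F) (x : X → A.carrier)
    (S : Submodule F A.carrier) (a b : A.carrier) (i : X) (l : List X) (hl : l ≠ [])
    (h : ∀ T : List (Bool × X), (T.map Prod.snd).Perm l → act x (a * b * x i) T ∈ S)
    (T : List (Bool × X)) (hT : (T.map Prod.snd).Perm (i :: l)) : act x (a * b) T ∈ S := by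
  refine (Submodule.span_le.2 ?_ : skewSpan x (a * b) (i :: l) ≤ S)
    (skewSpan_perm hA x hT a b (act_mem_skewSpan hA x T a b))
  rintro _ (rfl | rfl)
  · rw [rmul_eq_act]
    exact h _ (by simp)
  · obtain ⟨j, l, rfl⟩ := List.exists_cons_of_ne_nil hl
    have h1 := h ((false, j) :: l.map fun i => (true, i)) (by simp)
    have h2 := h ((true, j) :: l.map fun i => (true, i)) (by simp)
    rw [rmul, mul_left_right hA, rmul_sub, rmul_neg, rmul_eq_act, rmul_eq_act]
    exact Submodule.sub_mem _ (Submodule.neg_mem _ h1) h2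

/-- All words on the letters of `L` that start with `x i * x j` have values in `S`. -/
def StartsIn (x : X → A.carrier) (S : Submodule F A.carrier) (L : List X) (i j : X) : Prop :=
  ∀ T : List (Bool × X), (i :: j :: T.map Prod.snd).Perm L → act x (x i * x j) T ∈ S

theorem List.perm_rotate_three (i j k : X) (l : List X) : (i :: j :: k :: l).Perm (j :: k :: i :: l) :=
  (List.Perm.swap j i _).trans ((List.Perm.swap k i _).cons j)

section

variable [DecidableEq X] {x : X → A.carrier} {S : Submodule F A.carrier} {L : List X}

/-- Total length at least 4 ensures that a letter besides `k` remains in the tail, as required by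
`act_mem_of_left` and `act_mem_of_right`. -/
theorem exists_perm_cons (hL : 4 ≤ L.length) {i j k : X} (hk : k ∈ L) (hi : k ≠ i)
    (hj : k ≠ j) {T : List (Bool × X)} (hT : (i :: j :: T.map Prod.snd).Perm L) :
    ∃ l, l ≠ [] ∧ (T.map Prod.snd).Perm (k :: l) ∧ (i :: j :: k :: l).Perm L := by
  have hkT : k ∈ T.map Prod.snd := by
    have := hT.mem_iff.2 hk
    simpa [hi, hj] using this
  have hp := List.perm_cons_erase hkT
  refine ⟨_, ?_, hp, (hp.symm.cons _).cons _ |>.trans hT⟩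
  intro h
  have h1 := hT.length_eq
  have h2 := hp.length_eq
  rw [h] at h2
  simp only [List.length_cons, List.length_nil] at h1 h2
  omega

/-- Let x_k act first from the left; linearized left alternativity rewrites x_k(x_ix_j) by words
with leading pairs (i,k), (k,i) and (k,j). -/
theorem StartsIn.rule_left [CharZero F] (hA : A ∈ altMetabelian F) (hL : 4 ≤ L.length)
    {i j k : X} (hk : k ∈ L) (hki : k ≠ i) (hkj : k ≠ j) (h1 : StartsIn x S L i k)
    (h2 : StartsIn x S L k i) (h3 : StartsIn x S L k j) : StartsIn x S L i j := by
  intro T hT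
  obtain ⟨l, hl, hTl, hp⟩ := exists_perm_cons hL hk hki hkj hT
  refine act_mem_of_left hA x S _ _ k l hl (fun T' hT' => ?_) T hTl
  have e : x k * (x i * x j) = x i * x k * x j + x k * x i * x j - x i * (x k * x j) := by
    have := left_alt_lin hA (x i) (x k) (x j)
    linear_combination (norm := abel) -this
  rw [e, act_sub, act_add]
  refine S.sub_mem (S.add_mem (h1 ((true, j) :: T') ?_) (h2 ((true, j) :: T') ?_))
    (h3 ((false, i) :: T') ?_)
  · exact ((((hT'.cons j).cons k).cons i).trans ((List.Perm.swap j k l).cons i)).trans hp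
  · exact (((hT'.cons j).cons i).cons k).trans (((List.perm_rotate_three k i j l)).trans hp)
  · exact (((hT'.cons i).cons j).cons k).trans ((List.perm_rotate_three k j i l).trans
      ((List.Perm.swap i j _).trans hp))

/-- Let x_k act first from the right; linearized right alternativity rewrites (x_jx_i)x_k by words
with leading pairs (i,k), (k,i) and (j,k). -/
theorem StartsIn.rule_right [CharZero F] (hA : A ∈ altMetabelian F) (hL : 4 ≤ L.length)
    {i j k : X} (hk : k ∈ L) (hki : k ≠ i) (hkj : k ≠ j) (h1 : StartsIn x S L i k)
    (h2 : StartsIn x S L k i) (h3 : StartsIn x S L j k) : StartsIn x S L j i := by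
  intro T hT
  obtain ⟨l, hl, hTl, hp⟩ := exists_perm_cons hL hk hkj hki hT
  refine act_mem_of_right hA x S _ _ k l hl (fun T' hT' => ?_) T hTl
  have e : x j * x i * x k = x j * (x i * x k) + x j * (x k * x i) - x j * x k * x i := by
    have := right_alt_lin hA (x j) (x i) (x k)
    linear_combination (norm := abel) this
  rw [e, act_sub, act_add]
  refine S.sub_mem (S.add_mem (h1 ((false, j) :: T') ?_) (h2 ((false, j) :: T') ?_))
    (h3 ((true, i) :: T') ?_)
  · exact (((hT'.cons j).cons k).cons i).trans
      (((List.Perm.swap j k l).cons i).trans ((List.Perm.swap j i _).trans hp))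
  · exact (((hT'.cons j).cons i).cons k).trans ((List.perm_rotate_three k i j l).trans
      ((List.Perm.swap j i _).trans hp))
  · exact (((hT'.cons i).cons k).cons j).trans (((List.Perm.swap i k l).cons j).trans hp)

/-- Linearized right alternativity applied to x_k(x_jx_i) trades the pair (j,i) for (i,j), at the
cost of pairs beginning with k. -/
theorem StartsIn.rule_swap [CharZero F] (hA : A ∈ altMetabelian F) (hL : 4 ≤ L.length)
    {i j k : X} (hk : k ∈ L) (hki : k ≠ i) (hkj : k ≠ j) (h1 : StartsIn x S L i j)
    (h2 : StartsIn x S L k i) (h3 : StartsIn x S L k j) : StartsIn x S L j i := by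
  intro T hT
  obtain ⟨l, hl, hTl, hp⟩ := exists_perm_cons hL hk hkj hki hT
  refine act_mem_of_left hA x S _ _ k l hl (fun T' hT' => ?_) T hTl
  have e : x k * (x j * x i) = x k * x i * x j + x k * x j * x i - x k * (x i * x j) := by
    have := right_alt_lin hA (x k) (x i) (x j)
    linear_combination (norm := abel) -this
  rw [e, act_sub, act_add]
  refine S.sub_mem (S.add_mem (h2 ((true, j) :: T') ?_) (h3 ((true, i) :: T') ?_))
    (h1 ((false, k) :: T') ?_)
  · exact (((hT'.cons j).cons i).cons k).trans ((List.perm_rotate_three k i j l).trans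
      ((List.Perm.swap j i _).trans hp))
  · exact (((hT'.cons i).cons j).cons k).trans ((List.perm_rotate_three k j i l).trans hp)
  · exact (((hT'.cons k).cons j).cons i).trans ((List.Perm.swap j i _).trans hp)

/-- The three rules generate all ordered pairs from (e,o) and the pairs (o,j): first (e,j), then
(j,e), then (j,o), and finally arbitrary pairs with `o` as the auxiliary letter. -/
theorem startsIn_all [CharZero F] (hA : A ∈ altMetabelian F) (hL : 4 ≤ L.length) {o e : X}
    (ho : o ∈ L) (he : e ∈ L) (hoe : o ≠ e) (h1 : StartsIn x S L e o)
    (h2 : ∀ j, j ≠ o → StartsIn x S L o j) (i j : X) (hij : i ≠ j) : StartsIn x S L i j := by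
  have h3 : ∀ j, j ≠ o → j ≠ e → StartsIn x S L e j := fun j hjo hje =>
    StartsIn.rule_left hA hL ho hoe hjo.symm h1 (h2 e hoe.symm) (h2 j hjo)
  have h4 : ∀ j, j ≠ o → j ≠ e → StartsIn x S L j e := fun j hjo hje =>
    StartsIn.rule_swap hA hL ho hoe hjo.symm (h3 j hjo hje) (h2 e hoe.symm) (h2 j hjo)
  have h5 : ∀ j, j ≠ o → StartsIn x S L j o := by
    intro j hjo
    by_cases hje : j = e
    · subst hje; exact h1
    · exact StartsIn.rule_right hA hL he hoe.symm (Ne.symm hje) (h2 e hoe.symm) h1 (h4 j hjo hje)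
  by_cases hi : i = o
  · subst hi; exact h2 j hij.symm
  · by_cases hj : j = o
    · subst hj; exact h5 i hi
    · exact StartsIn.rule_left hA hL ho (Ne.symm hi) (Ne.symm hj) (h5 i hi) (h2 i hi) (h2 j hj)

end

/-- A factorization into two products has value zero, so in a nonzero word every multiplication
beyond the innermost pair has a single letter on one side. -/
theorem evalWord_eq_act (hA : A ∈ altMetabelian F) (x : X → A.carrier) (w : FreeMagma X)
    (hw : (wordLetters w).length ≠ 1) :
    evalWord x w = 0 ∨ ∃ i j T, (wordLetters w).Perm (i :: j :: T.map Prod.snd) ∧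
      evalWord x w = act x (x i * x j) T := by
  induction w using FreeMagma.rec with
  | of i => simp [wordLetters] at hw
  | mul v w hv hw' =>
    cases v with
    | of i =>
      cases w with
      | of j => exact Or.inr ⟨i, j, [], List.Perm.refl _, rfl⟩
      | mul w₁ w₂ =>
        rcases hw' (by
          have h1 := List.length_pos_of_ne_nil (wordLetters_ne_nil w₁)
          have h2 := List.length_pos_of_ne_nil (wordLetters_ne_nil w₂)
          simp only [wordLetters, List.length_append]; omega) with h | ⟨a, b, T, h1, h2⟩
        · left
          change x i * evalWord x (FreeMagma.mul w₁ w₂) = 0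
          rw [h, mul_zero]
        · right
          refine ⟨a, b, T ++ [(false, i)], ?_, ?_⟩
          · rw [List.map_append]
            exact (h1.cons i).trans (List.perm_append_singleton i _).symm
          · rw [act_append, ← h2]; rfl
    | mul v₁ v₂ =>
      cases w with
      | of i =>
        rcases hv (by
          have h1 := List.length_pos_of_ne_nil (wordLetters_ne_nil v₁)
          have h2 := List.length_pos_of_ne_nil (wordLetters_ne_nil v₂)
          simp only [wordLetters, List.length_append]; omega) with h | ⟨a, b, T, h1, h2⟩
        · left
          change evalWord x (FreeMagma.mul v₁ v₂) * x i = 0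
          rw [h, zero_mul]
        · right
          refine ⟨a, b, T ++ [(true, i)], ?_, ?_⟩
          · rw [List.map_append]
            exact h1.append_right [i]
          · rw [act_append, ← h2]; rfl
      | mul w₁ w₂ =>
        left
        exact hA.2.2 _ _ _ _

end Tails

/-! ### Normal form with 2n spanning words in degree n ≥ 4. -/

section NormalForm

variable {F : Type u} [Field F] {m : ℕ}

/-- The letters different from `i` and `j`. -/
def restList (m : ℕ) (i j : Fin (m + 4)) : List (Fin (m + 4)) :=
  ((List.finRange (m + 4)).erase i).erase j

theorem perm_restList {i j : Fin (m + 4)} (hij : i ≠ j) :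
    (i :: j :: restList m i j).Perm (List.finRange (m + 4)) := by
  have h1 : j ∈ (List.finRange (m + 4)).erase i :=
    (List.mem_erase_of_ne hij.symm).2 (List.mem_finRange j)
  exact ((List.perm_cons_erase h1).symm.cons i).trans
    (List.perm_cons_erase (List.mem_finRange i)).symm

/-- The first pair of letters of a basic word. -/
def basicPair (k : Fin (m + 4)) : Fin (m + 4) × Fin (m + 4) :=
  if k = 0 then (1, 0) else (0, k)

theorem basicPair_ne (k : Fin (m + 4)) : (basicPair k).1 ≠ (basicPair k).2 := by
  unfold basicPair
  split_ifs with h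
  · exact Fin.ne_of_val_ne (by simp)
  · exact Ne.symm h

/-- The word with the given first two letters in which the other letters are multiplied in their
natural order, the first of them from the right if `c` is `true` and from the left otherwise, the
others from the right. -/
def basicWord (k : Fin (m + 4)) (c : Bool) : FreeMagma (Fin (m + 4)) :=
  let u := FreeMagma.of (basicPair k).1 * FreeMagma.of (basicPair k).2
  match restList m (basicPair k).1 (basicPair k).2 with
  | [] => u
  | z :: l => rmul FreeMagma.of (if c then u * FreeMagma.of z else FreeMagma.of z * u) l

theorem evalWord_rmul {X : Type} {M : Type*} [Mul M] (x : X → M) (l : List X)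
    (w : FreeMagma X) : evalWord x (rmul FreeMagma.of w l) = rmul x (evalWord x w) l := by
  induction l generalizing w with
  | nil => rfl
  | cons i l ih => rw [rmul, rmul, ih]; rfl

theorem evalWord_basicWord {M : Type*} [Mul M] (x : Fin (m + 4) → M) (k z : Fin (m + 4))
    (l : List (Fin (m + 4)))
    (h : restList m (basicPair k).1 (basicPair k).2 = z :: l) (c : Bool) :
    evalWord x (basicWord k c) = rmul x
      (if c then x (basicPair k).1 * x (basicPair k).2 * x z
        else x z * (x (basicPair k).1 * x (basicPair k).2)) l := by
  unfold basicWord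
  simp only [h]
  rw [evalWord_rmul]
  cases c <;> rfl

/-- For a basic leading pair, `skewSpan_perm` sorts the tail. The basic pairs are (1,0) and all
(0,k), exactly the input of `startsIn_all` with o = 0 and e = 1. -/
theorem evalWord_mem_span_basicWord [CharZero F] {A : NAAlgebra F} (hA : A ∈ altMetabelian F)
    (x : Fin (m + 4) → A.carrier) (w : FreeMagma (Fin (m + 4)))
    (hw : (wordLetters w).Perm (List.finRange (m + 4))) :
    evalWord x w ∈ Submodule.span F
      (Set.range fun k : Fin (m + 4) × Bool => evalWord x (basicWord k.1 k.2)) := by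
  set S := Submodule.span F
      (Set.range fun k : Fin (m + 4) × Bool => evalWord x (basicWord k.1 k.2)) with hS
  have hb : ∀ k : Fin (m + 4),
      StartsIn x S (List.finRange (m + 4)) (basicPair k).1 (basicPair k).2 := by
    intro k T hT
    have hp := perm_restList (basicPair_ne k)
    have hT' : (T.map Prod.snd).Perm (restList m (basicPair k).1 (basicPair k).2) :=
      ((hT.trans hp.symm).cons_inv).cons_inv
    have h1 := skewSpan_perm hA x hT' (x (basicPair k).1) (x (basicPair k).2)
      (act_mem_skewSpan hA x T _ _)
    obtain ⟨z, l, hzl⟩ : ∃ z l, restList m (basicPair k).1 (basicPair k).2 = z :: l := by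
      refine List.exists_cons_of_ne_nil fun h => ?_
      have := hp.length_eq
      rw [h] at this
      simp at this
    rw [hzl] at h1
    refine Submodule.span_le.2 ?_ h1
    rintro _ (rfl | rfl)
    · exact Submodule.subset_span ⟨(k, true), evalWord_basicWord x k z l hzl true⟩
    · exact Submodule.subset_span ⟨(k, false), evalWord_basicWord x k z l hzl false⟩
  have hlen : 4 ≤ (List.finRange (m + 4)).length := by simp
  have h10 : (1 : Fin (m + 4)) ≠ 0 := Fin.ne_of_val_ne (by simp)
  have hall := startsIn_all (x := x) (S := S) hA hlen (List.mem_finRange 0) (List.mem_finRange 1)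
    h10.symm (hb 0) (fun j hj => by have := hb j; simpa only [basicPair, if_neg hj] using this)
  rcases evalWord_eq_act hA x w (by rw [hw.length_eq]; simp) with h | ⟨i, j, T, h1, h2⟩
  · rw [h]; exact S.zero_mem
  · rw [h2]
    refine hall i j ?_ T (h1.symm.trans hw)
    rintro rfl
    have := (h1.symm.trans hw).nodup_iff.2 (List.nodup_finRange _)
    simp at this

theorem exists_normal_form [CharZero F] {f : FreeNonUnitalNonAssocAlgebra F (Fin (m + 4))}
    (hf : IsMultilinearPoly f) :
    ∃ c : Fin (m + 4) × Bool → F, ∀ A ∈ altMetabelian F, ∀ x : Fin (m + 4) → A.carrier,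
      FreeNonUnitalNonAssocAlgebra.lift F x f =
        ∑ k, c k • evalWord x (basicWord k.1 k.2) := by
  -- The coefficients are chosen once, at the generators of the free algebra of V, so that they are
  -- valid in every algebra of V.
  have h1 : FreeNonUnitalNonAssocAlgebra.lift F (freeAlgGen F) f ∈ Submodule.span F
      (Set.range fun k : Fin (m + 4) × Bool =>
        evalWord (freeAlgGen F (r := m + 4)) (basicWord k.1 k.2)) := by
    rw [lift_eq_sum, Finsupp.sum]
    exact Submodule.sum_mem _ fun w hw => Submodule.smul_mem _ _
      (evalWord_mem_span_basicWord (freeAlg_mem F _) _ w (hf w hw))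
  obtain ⟨c, hc⟩ := (Submodule.mem_span_range_iff_exists_fun F).1 h1
  refine ⟨c, fun A hA x => ?_⟩
  have h2 := lift_eq_zero_of_lift_freeAlgGen hA x
    (f := f - ∑ k, c k • MonoidAlgebra.single (basicWord k.1 k.2) 1) (by
      rw [map_sub, map_sum, ← hc]
      simp only [map_smul, lift_single, one_smul, sub_self])
  rw [map_sub, map_sum] at h2
  simp only [map_smul, lift_single, one_smul] at h2
  exact sub_eq_zero.1 h2

end NormalForm

/-! ### A superalgebra with one odd operator variable, built from the reflections of S_3. -/

section Dorofeev

/-- The underlying space `F y ⊕ F² ⊕ F²` of a superalgebra of Dorofeev type. -/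
@[ext]
structure DorofeevSpace (F : Type u) where
  y : F
  e₁ : F
  e₂ : F
  o₁ : F
  o₂ : F

namespace DorofeevSpace

variable {F : Type u}

/-- The coordinates of an element. -/
def coords : DorofeevSpace F ≃ F × F × F × F × F where
  toFun a := (a.y, a.e₁, a.e₂, a.o₁, a.o₂)
  invFun v := ⟨v.1, v.2.1, v.2.2.1, v.2.2.2.1, v.2.2.2.2⟩
  left_inv _ := rfl
  right_inv _ := rfl

variable [Field F]

instance : AddCommGroup (DorofeevSpace F) := coords.addCommGroup

instance : Module F (DorofeevSpace F) := coords.module F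

/-- The multiplication: `y` acts on `F² ⊕ F²` by two reflections of the two-dimensional
representation of the symmetric group of degree 3. -/
instance : Mul (DorofeevSpace F) where
  mul a b := ⟨0, b.y * a.o₂ - a.y * b.o₁, b.y * a.o₁ + a.y * (b.o₁ + b.o₂),
    b.y * a.e₂ + a.y * b.e₁, b.y * a.e₁ - a.y * (b.e₁ + b.e₂)⟩

theorem add_def (a b : DorofeevSpace F) :
    a + b = ⟨a.y + b.y, a.e₁ + b.e₁, a.e₂ + b.e₂, a.o₁ + b.o₁, a.o₂ + b.o₂⟩ := rfl

theorem neg_def (a : DorofeevSpace F) : -a = ⟨-a.y, -a.e₁, -a.e₂, -a.o₁, -a.o₂⟩ := rfl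

theorem sub_def (a b : DorofeevSpace F) :
    a - b = ⟨a.y - b.y, a.e₁ - b.e₁, a.e₂ - b.e₂, a.o₁ - b.o₁, a.o₂ - b.o₂⟩ := rfl

theorem smul_def (c : F) (a : DorofeevSpace F) :
    c • a = ⟨c * a.y, c * a.e₁, c * a.e₂, c * a.o₁, c * a.o₂⟩ := rfl

theorem zero_def : (0 : DorofeevSpace F) = ⟨0, 0, 0, 0, 0⟩ := rfl

theorem mul_def (a b : DorofeevSpace F) :
    a * b = ⟨0, b.y * a.o₂ - a.y * b.o₁, b.y * a.o₁ + a.y * (b.o₁ + b.o₂),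
      b.y * a.e₂ + a.y * b.e₁, b.y * a.e₁ - a.y * (b.e₁ + b.e₂)⟩ := rfl

instance : NonUnitalNonAssocRing (DorofeevSpace F) where
  left_distrib a b c := by
    simp only [mul_def, add_def]
    ext <;> ring
  right_distrib a b c := by
    simp only [mul_def, add_def]
    ext <;> ring
  zero_mul a := by
    simp only [mul_def, zero_def]
    ext <;> ring
  mul_zero a := by
    simp only [mul_def, zero_def]
    ext <;> ring

instance : IsScalarTower F (DorofeevSpace F) (DorofeevSpace F) where
  smul_assoc c a b := by
    simp only [smul_eq_mul, mul_def, smul_def]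
    ext <;> ring

instance : SMulCommClass F (DorofeevSpace F) (DorofeevSpace F) where
  smul_comm c a b := by
    simp only [smul_eq_mul, mul_def, smul_def]
    ext <;> ring

end DorofeevSpace

variable {F : Type u} [Field F]

open DorofeevSpace

/-- The even part. -/
def dorofeevEven (F : Type u) [Field F] : Submodule F (DorofeevSpace F) where
  carrier := {a | a.y = 0 ∧ a.o₁ = 0 ∧ a.o₂ = 0}
  add_mem' := by
    rintro a b ⟨h1, h2, h3⟩ ⟨k1, k2, k3⟩
    simp [DorofeevSpace.add_def, h1, h2, h3, k1, k2, k3]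
  zero_mem' := ⟨rfl, rfl, rfl⟩
  smul_mem' := by
    rintro c a ⟨h1, h2, h3⟩
    simp [DorofeevSpace.smul_def, h1, h2, h3]

/-- The odd part. -/
def dorofeevOdd (F : Type u) [Field F] : Submodule F (DorofeevSpace F) where
  carrier := {a | a.e₁ = 0 ∧ a.e₂ = 0}
  add_mem' := by
    rintro a b ⟨h1, h2⟩ ⟨k1, k2⟩
    simp [DorofeevSpace.add_def, h1, h2, k1, k2]
  zero_mem' := ⟨rfl, rfl⟩
  smul_mem' := by
    rintro c a ⟨h1, h2⟩
    simp [DorofeevSpace.smul_def, h1, h2]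

theorem mem_dorofeevEven {a : DorofeevSpace F} :
    a ∈ dorofeevEven F ↔ a.y = 0 ∧ a.o₁ = 0 ∧ a.o₂ = 0 := Iff.rfl

theorem mem_dorofeevOdd {a : DorofeevSpace F} :
    a ∈ dorofeevOdd F ↔ a.e₁ = 0 ∧ a.e₂ = 0 := Iff.rfl

/-- A superalgebra with one odd generator acting on a module of dimension 4. -/
def dorofeev (F : Type u) [Field F] : Superalgebra F where
  carrier := DorofeevSpace F
  part i := if i = 0 then dorofeevEven F else dorofeevOdd F
  isCompl := by
    rw [if_pos rfl, if_neg one_ne_zero]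
    constructor
    · rw [Submodule.disjoint_def]
      rintro a ⟨h1, h2, h3⟩ ⟨k1, k2⟩
      exact DorofeevSpace.ext h1 k1 k2 h2 h3
    · rw [codisjoint_iff, eq_top_iff]
      rintro a -
      refine Submodule.mem_sup.2 ⟨⟨0, a.e₁, a.e₂, 0, 0⟩, ⟨rfl, rfl, rfl⟩,
        ⟨a.y, 0, 0, a.o₁, a.o₂⟩, ⟨rfl, rfl⟩, ?_⟩
      rw [DorofeevSpace.add_def]
      ext <;> simp
  mul_mem := by
    intro i j a b ha hb
    rcases zmod_two_cases i with rfl | rfl <;> rcases zmod_two_cases j with rfl | rfl <;>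
      simp only [one_ne_zero, if_true, if_false, add_zero, zero_add,
        show (1 + 1 : ZMod 2) = 0 from rfl, mem_dorofeevEven, mem_dorofeevOdd] at ha hb ⊢ <;>
      simp [DorofeevSpace.mul_def, ha, hb]

theorem mem_dorofeev_part_zero {a : (dorofeev F).carrier} (ha : a ∈ (dorofeev F).part 0) :
    ∃ s t : F, a = (⟨0, s, t, 0, 0⟩ : DorofeevSpace F) := by
  have h : a ∈ dorofeevEven F := ha
  obtain ⟨h1, h2, h3⟩ := h
  exact ⟨_, _, DorofeevSpace.ext h1 rfl rfl h2 h3⟩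

theorem mem_dorofeev_part_one {a : (dorofeev F).carrier} (ha : a ∈ (dorofeev F).part 1) :
    ∃ r s t : F, a = (⟨r, 0, 0, s, t⟩ : DorofeevSpace F) := by
  have h : a ∈ dorofeevOdd F := ha
  obtain ⟨h1, h2⟩ := h
  exact ⟨_, _, _, DorofeevSpace.ext rfl h1 h2 rfl rfl⟩

/-- The reflections R, L satisfy R² = L² = 1 and RL + LR = -1, which for an odd variable are the
tail relations L_xL_y = R_xR_y and L_xR_y = -R_xL_y - R_xR_y; skew-symmetry imposes nothing on
repeated odd letters. The laws are checked in coordinates for all parities. -/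
theorem dorofeev_isAltMetabelian : (dorofeev F).IsAltMetabelian := by
  constructor
  · intro i j k a b c ha hb hc
    change DorofeevSpace F at a b c
    change a * b * c - a * (b * c) + paritySign i j • (b * a * c - b * (a * c)) = 0
    rcases zmod_two_cases i with rfl | rfl <;> rcases zmod_two_cases j with rfl | rfl <;>
      rcases zmod_two_cases k with rfl | rfl <;>
      first
        | obtain ⟨a1, a2, rfl⟩ := mem_dorofeev_part_zero ha
        | obtain ⟨a1, a2, a3, rfl⟩ := mem_dorofeev_part_one ha
    all_goals
      first
        | obtain ⟨b1, b2, rfl⟩ := mem_dorofeev_part_zero hb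
        | obtain ⟨b1, b2, b3, rfl⟩ := mem_dorofeev_part_one hb
    all_goals
      first
        | obtain ⟨c1, c2, rfl⟩ := mem_dorofeev_part_zero hc
        | obtain ⟨c1, c2, c3, rfl⟩ := mem_dorofeev_part_one hc
    all_goals
      simp only [paritySign, zero_ne_one, and_self, and_false, false_and, if_true,
        if_false, one_smul, neg_smul, DorofeevSpace.mul_def, DorofeevSpace.sub_def,
        DorofeevSpace.add_def, DorofeevSpace.neg_def, DorofeevSpace.zero_def]
      ext <;> ring
  · intro i j k a b c ha hb hc
    change DorofeevSpace F at a b c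
    change a * b * c - a * (b * c) + paritySign j k • (a * c * b - a * (c * b)) = 0
    rcases zmod_two_cases i with rfl | rfl <;> rcases zmod_two_cases j with rfl | rfl <;>
      rcases zmod_two_cases k with rfl | rfl <;>
      first
        | obtain ⟨a1, a2, rfl⟩ := mem_dorofeev_part_zero ha
        | obtain ⟨a1, a2, a3, rfl⟩ := mem_dorofeev_part_one ha
    all_goals
      first
        | obtain ⟨b1, b2, rfl⟩ := mem_dorofeev_part_zero hb
        | obtain ⟨b1, b2, b3, rfl⟩ := mem_dorofeev_part_one hb
    all_goals
      first
        | obtain ⟨c1, c2, rfl⟩ := mem_dorofeev_part_zero hc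
        | obtain ⟨c1, c2, c3, rfl⟩ := mem_dorofeev_part_one hc
    all_goals
      simp only [paritySign, zero_ne_one, and_self, and_false, false_and, if_true,
        if_false, one_smul, neg_smul, DorofeevSpace.mul_def, DorofeevSpace.sub_def,
        DorofeevSpace.add_def, DorofeevSpace.neg_def, DorofeevSpace.zero_def]
      ext <;> ring
  · intro a b c d
    change DorofeevSpace F at a b c d
    change a * b * (c * d) = 0
    simp only [DorofeevSpace.mul_def, DorofeevSpace.zero_def]
    ext <;> ring

/-- The odd generator. -/
def dorofeevY (F : Type u) [Field F] : (dorofeev F).carrier :=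
  (⟨1, 0, 0, 0, 0⟩ : DorofeevSpace F)

/-- The elements of the module of parity `q`. -/
def dorofeevM (q : ZMod 2) (v : F × F) : (dorofeev F).carrier :=
  if q = 0 then (⟨0, v.1, v.2, 0, 0⟩ : DorofeevSpace F) else (⟨0, 0, 0, v.1, v.2⟩ : DorofeevSpace F)

/-- The action of the right multiplication by the odd generator. -/
def reflR (v : F × F) : F × F := (v.2, v.1)

/-- The action of the left multiplication by the odd generator, up to sign. -/
def reflL (v : F × F) : F × F := (v.1, -(v.1 + v.2))

theorem dorofeevY_mem : dorofeevY F ∈ (dorofeev F).part 1 := by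
  change dorofeevY F ∈ dorofeevOdd F
  exact ⟨rfl, rfl⟩

theorem dorofeevM_mem (q : ZMod 2) (v : F × F) : dorofeevM q v ∈ (dorofeev F).part q := by
  rcases zmod_two_cases q with rfl | rfl
  · change dorofeevM 0 v ∈ dorofeevEven F
    exact ⟨rfl, rfl, rfl⟩
  · change dorofeevM 1 v ∈ dorofeevOdd F
    exact ⟨rfl, rfl⟩

theorem dorofeevM_zero_apply (v : F × F) :
    dorofeevM 0 v = (⟨0, v.1, v.2, 0, 0⟩ : DorofeevSpace F) := rfl

theorem dorofeevM_one_apply (v : F × F) :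
    dorofeevM 1 v = (⟨0, 0, 0, v.1, v.2⟩ : DorofeevSpace F) := rfl

theorem dorofeevY_mul_self : dorofeevY F * dorofeevY F = 0 := by
  change (⟨1, 0, 0, 0, 0⟩ * ⟨1, 0, 0, 0, 0⟩ : DorofeevSpace F) = 0
  simp [mul_def, zero_def]

theorem dorofeevM_mul_dorofeevY (q : ZMod 2) (v : F × F) :
    dorofeevM q v * dorofeevY F = dorofeevM (q + 1) (reflR v) := by
  rcases zmod_two_cases q with rfl | rfl
  · rw [zero_add, dorofeevM_one_apply]
    change (⟨0, v.1, v.2, 0, 0⟩ * ⟨1, 0, 0, 0, 0⟩ : DorofeevSpace F) = _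
    simp [mul_def, reflR]
  · rw [show (1 + 1 : ZMod 2) = 0 from rfl, dorofeevM_zero_apply]
    change (⟨0, 0, 0, v.1, v.2⟩ * ⟨1, 0, 0, 0, 0⟩ : DorofeevSpace F) = _
    simp [mul_def, reflR]

theorem dorofeevY_mul_dorofeevM (q : ZMod 2) (v : F × F) :
    dorofeevY F * dorofeevM q v = paritySign q 1 • dorofeevM (q + 1) (reflL v) := by
  rcases zmod_two_cases q with rfl | rfl
  · rw [zero_add, dorofeevM_one_apply]
    change (⟨1, 0, 0, 0, 0⟩ * ⟨0, v.1, v.2, 0, 0⟩ : DorofeevSpace F) =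
      (1 : ℤ) • (⟨0, 0, 0, v.1, -(v.1 + v.2)⟩ : DorofeevSpace F)
    simp only [mul_def, one_smul]
    ext <;> ring
  · rw [show (1 + 1 : ZMod 2) = 0 from rfl, dorofeevM_zero_apply]
    change (⟨1, 0, 0, 0, 0⟩ * ⟨0, 0, 0, v.1, v.2⟩ : DorofeevSpace F) =
      (-1 : ℤ) • (⟨0, v.1, -(v.1 + v.2), 0, 0⟩ : DorofeevSpace F)
    simp only [mul_def, neg_smul, one_smul, neg_def]
    ext <;> ring

theorem dorofeevM_eq_zero {q : ZMod 2} {v : F × F} (h : dorofeevM q v = 0) : v = 0 := by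
  rcases zmod_two_cases q with rfl | rfl
  · exact Prod.ext (congrArg DorofeevSpace.e₁ h) (congrArg DorofeevSpace.e₂ h)
  · exact Prod.ext (congrArg DorofeevSpace.o₁ h) (congrArg DorofeevSpace.o₂ h)

theorem dorofeevM_add (q : ZMod 2) (v w : F × F) :
    dorofeevM q (v + w) = dorofeevM q v + dorofeevM q w := by
  rcases zmod_two_cases q with rfl | rfl
  · change (⟨0, v.1 + w.1, v.2 + w.2, 0, 0⟩ : DorofeevSpace F) =
      ⟨0, v.1, v.2, 0, 0⟩ + ⟨0, w.1, w.2, 0, 0⟩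
    simp [add_def]
  · change (⟨0, 0, 0, v.1 + w.1, v.2 + w.2⟩ : DorofeevSpace F) =
      ⟨0, 0, 0, v.1, v.2⟩ + ⟨0, 0, 0, w.1, w.2⟩
    simp [add_def]

theorem dorofeevM_smul (q : ZMod 2) (c : F) (v : F × F) :
    dorofeevM q (c • v) = c • dorofeevM q v := by
  rcases zmod_two_cases q with rfl | rfl
  · change (⟨0, c * v.1, c * v.2, 0, 0⟩ : DorofeevSpace F) = c • ⟨0, v.1, v.2, 0, 0⟩
    simp [smul_def]
  · change (⟨0, 0, 0, c * v.1, c * v.2⟩ : DorofeevSpace F) = c • ⟨0, 0, 0, v.1, v.2⟩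
    simp [smul_def]

open Superalgebra

theorem tmul_dorofeevM_mul {q : ZMod 2} (h : Grassmann F) (v : F × F) (k : ℕ) :
    (h ⊗ₜ[F] dorofeevM q v) * (Grassmann.gen F k ⊗ₜ[F] dorofeevY F) =
      (h * Grassmann.gen F k) ⊗ₜ[F] dorofeevM (q + 1) (reflR v) := by
  rw [Algebra.TensorProduct.tmul_mul_tmul, dorofeevM_mul_dorofeevY]

/-- The sign in the left action of y cancels the sign from moving the Grassmann generator to the
right. In the envelope left and right multiplication thus change the Grassmann factor alike and
differ only in the reflection. -/
theorem mul_tmul_dorofeevM {q : ZMod 2} {h : Grassmann F} (hh : h ∈ grassmannPart F q)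
    (v : F × F) (k : ℕ) :
    (Grassmann.gen F k ⊗ₜ[F] dorofeevY F) * (h ⊗ₜ[F] dorofeevM q v) =
      (h * Grassmann.gen F k) ⊗ₜ[F] dorofeevM (q + 1) (reflL v) := by
  rw [Algebra.TensorProduct.tmul_mul_tmul, dorofeevY_mul_dorofeevM,
    Grassmann.graded_comm hh (Grassmann.gen_mem k)]
  rw [TensorProduct.tmul_smul, TensorProduct.smul_tmul']

theorem tmul_dorofeevY_mul (k l : ℕ) :
    (Grassmann.gen F k ⊗ₜ[F] dorofeevY F) * (Grassmann.gen F l ⊗ₜ[F] dorofeevY F) = 0 := by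
  rw [Algebra.TensorProduct.tmul_mul_tmul, dorofeevY_mul_self, TensorProduct.tmul_zero]

theorem rmul_tmul_dorofeevM {X : Type} (x : X → Grassmann F ⊗[F] (dorofeev F).carrier)
    (k : X → ℕ) (l : List X) (hx : ∀ i ∈ l, x i = Grassmann.gen F (k i) ⊗ₜ[F] dorofeevY F)
    (q : ZMod 2) (h : Grassmann F) (v : F × F) :
    rmul x (h ⊗ₜ[F] dorofeevM q v) l =
      (h * ((l.map k).map (Grassmann.gen F)).prod) ⊗ₜ[F]
        dorofeevM (q + l.length) (reflR^[l.length] v) := by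
  induction l generalizing q h v with
  | nil => simp [rmul]
  | cons i l ih =>
    rw [rmul, hx i (by simp), tmul_dorofeevM_mul, ih fun j hj => hx j (by simp [hj])]
    simp only [List.map_cons, List.prod_cons, List.length_cons, Function.iterate_succ,
      Function.comp_apply, mul_assoc, Nat.cast_add, Nat.cast_one]
    rw [show q + 1 + (l.length : ZMod 2) = q + (l.length + 1) by ring]

theorem reflR_iterate_eq_zero {n : ℕ} {v : F × F} (h : reflR^[n] v = 0) : v = 0 := by
  induction n generalizing v with
  | zero => exact h
  | succ n ih =>
    have h1 := ih (by rwa [Function.iterate_succ, Function.comp_apply] at h)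
    rw [reflR, Prod.mk_eq_zero] at h1
    exact Prod.ext h1.2 h1.1

end Dorofeev

/-! ### Separation of the basic words in degree at least 4. -/

section LargeDegree

variable {F : Type u} [Field F] {m : ℕ}

open Superalgebra

/-- The values of the variables: an element of the module for the `i`-th variable, the odd
generator for the others. -/
def dorofeevPoint (i : Fin (m + 4)) (q : ZMod 2) (v : F × F) (k : Fin (m + 4)) :
    (dorofeev F).carrier :=
  if k = i then dorofeevM q v else dorofeevY F

/-- The parities of the values `dorofeevPoint`. -/
def dorofeevParity (i : Fin (m + 4)) (q : ZMod 2) (k : Fin (m + 4)) : ZMod 2 :=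
  if k = i then q else 1

theorem dorofeevPoint_mem (i : Fin (m + 4)) (q : ZMod 2) (v : F × F) (k : Fin (m + 4)) :
    dorofeevPoint i q v k ∈ (dorofeev F).part (dorofeevParity i q k) := by
  unfold dorofeevPoint dorofeevParity
  split_ifs
  · exact dorofeevM_mem q v
  · exact dorofeevY_mem

/-- The points of the Grassmann envelope over `dorofeevPoint`. -/
def dorofeevTensor (i : Fin (m + 4)) (q : ZMod 2) (v : F × F) (k : Fin (m + 4)) :
    Grassmann F ⊗[F] (dorofeev F).carrier :=
  Grassmann.std F (dorofeevParity i q k) (k : ℕ) ⊗ₜ[F] dorofeevPoint i q v k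

theorem dorofeevTensor_self (i : Fin (m + 4)) (q : ZMod 2) (v : F × F) :
    dorofeevTensor i q v i = Grassmann.std F q (i : ℕ) ⊗ₜ[F] dorofeevM q v := by
  simp [dorofeevTensor, dorofeevParity, dorofeevPoint]

theorem dorofeevTensor_of_ne {i k : Fin (m + 4)} (h : k ≠ i) (q : ZMod 2) (v : F × F) :
    dorofeevTensor i q v k = Grassmann.gen F (k : ℕ) ⊗ₜ[F] dorofeevY F := by
  simp [dorofeevTensor, dorofeevParity, dorofeevPoint, h, Grassmann.std]

/-- The product of the Grassmann generators of all letters, with the `i`-th letter first. -/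
def leadProd (F : Type u) [Field F] (i j : Fin (m + 4)) (q : ZMod 2) : Grassmann F :=
  ((i :: j :: restList m i j).map fun k =>
    Grassmann.std F (dorofeevParity i q k) (k : ℕ)).prod

theorem leadProd_ne_zero {i j : Fin (m + 4)} (hij : i ≠ j) (q : ZMod 2) :
    leadProd F i j q ≠ 0 :=
  Grassmann.prod_std_ne_zero _ _ Fin.val_injective _
    ((perm_restList hij).nodup_iff.2 (List.nodup_finRange _))

/-- The operator by which a basic word acts, if the module element is its first letter
(`b = true`) or its second letter (`b = false`). -/
def leadOp (b c : Bool) (v : F × F) : F × F :=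
  if c then reflR (if b then reflR v else reflL v) else reflL (if b then reflR v else reflL v)

theorem rmul_zero_left {X : Type} {M : Type*} [NonUnitalNonAssocRing M] (x : X → M) (l : List X) :
    rmul x 0 l = 0 := by
  induction l with
  | nil => rfl
  | cons i l ih => rw [rmul, zero_mul, ih]

theorem restList_comm (i j : Fin (m + 4)) : restList m i j = restList m j i :=
  List.erase_comm ..

theorem length_restList {i j : Fin (m + 4)} (hij : i ≠ j) : (restList m i j).length = m + 2 := by
  have := (perm_restList hij).length_eq
  simp only [List.length_cons, List.length_finRange] at this
  omega

theorem ne_of_mem_restList {i j k : Fin (m + 4)} (hij : i ≠ j) (hk : k ∈ restList m i j) :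
    k ≠ i ∧ k ≠ j := by
  have := (perm_restList hij).nodup_iff.2 (List.nodup_finRange _)
  simp only [List.nodup_cons, List.mem_cons, not_or] at this
  exact ⟨fun h => this.1.2 (h ▸ hk), fun h => this.2.1 (h ▸ hk)⟩

/-- The leading pair consists of two copies of y, and y² = 0. -/
theorem evalWord_basicWord_of_ne (i : Fin (m + 4)) (q : ZMod 2) (v : F × F) (k : Fin (m + 4))
    (c : Bool) (h1 : (basicPair k).1 ≠ i) (h2 : (basicPair k).2 ≠ i) :
    evalWord (dorofeevTensor i q v) (basicWord k c) = 0 := by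
  obtain ⟨z, l, hzl⟩ : ∃ z l, restList m (basicPair k).1 (basicPair k).2 = z :: l := by
    refine List.exists_cons_of_ne_nil fun h => ?_
    have := length_restList (basicPair_ne k)
    rw [h] at this
    simp at this
  rw [evalWord_basicWord _ k z l hzl, dorofeevTensor_of_ne h1, dorofeevTensor_of_ne h2,
    tmul_dorofeevY_mul]
  cases c <;> simp [rmul_zero_left]

/-- The Grassmann factor depends neither on the order of the leading pair nor on the side of the
next multiplication, so words sharing the pair differ only in the vector. Of the m + 2 remaining
letters the first is accounted for by `leadOp`, and the last m + 1 act by `reflR`. -/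
theorem evalWord_basicWord_dorofeev (i j : Fin (m + 4)) (hij : i ≠ j) (q : ZMod 2) (v : F × F)
    (k : Fin (m + 4)) (b c : Bool) (h : basicPair k = if b then (i, j) else (j, i)) :
    evalWord (dorofeevTensor i q v) (basicWord k c) =
      leadProd F i j q ⊗ₜ[F] dorofeevM (q + 1 + 1 + (m + 1 : ℕ)) (reflR^[m + 1] (leadOp b c v)) := by
  have hlen := length_restList hij
  obtain ⟨z, l, hzl⟩ : ∃ z l, restList m i j = z :: l := by
    refine List.exists_cons_of_ne_nil fun h => ?_
    rw [h] at hlen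
    simp at hlen
  have hmem := fun k hk => ne_of_mem_restList (m := m) (k := k) hij hk
  rw [hzl] at hmem hlen
  have hz := (hmem z (by simp)).1
  have hl : ∀ k ∈ l, dorofeevTensor i q v k = Grassmann.gen F (k : ℕ) ⊗ₜ[F] dorofeevY F :=
    fun k hk => dorofeevTensor_of_ne (hmem k (by simp [hk])).1 q v
  have hrest : restList m (basicPair k).1 (basicPair k).2 = z :: l := by
    rw [h]
    cases b
    · simpa [restList_comm j i] using hzl
    · simpa using hzl
  have hl' : l.length = m + 1 := by simpa using hlen
  have hg : Grassmann.std F q (i : ℕ) * Grassmann.gen F (j : ℕ) ∈ grassmannPart F (q + 1) :=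
    SetLike.mul_mem_graded (Grassmann.std_mem q _) (Grassmann.gen_mem _)
  have hprod : leadProd F i j q = Grassmann.std F q (i : ℕ) * Grassmann.gen F (j : ℕ) *
      Grassmann.gen F (z : ℕ) * ((l.map Fin.val).map (Grassmann.gen F)).prod := by
    rw [leadProd, hzl]
    have e : ∀ k, k ≠ i → Grassmann.std F (dorofeevParity i q k) (k : ℕ) =
        Grassmann.gen F (k : ℕ) := by
      intro k hk
      simp [dorofeevParity, hk, Grassmann.std]
    have e' : Grassmann.std F (dorofeevParity i q i) (i : ℕ) = Grassmann.std F q (i : ℕ) := by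
      simp [dorofeevParity]
    simp only [List.map_cons, List.prod_cons, e j hij.symm, e z hz, e', List.map_map, mul_assoc]
    congr 4
    exact List.map_congr_left fun k hk => e k (hmem k (by simp [hk])).1
  rw [evalWord_basicWord _ k z l hrest, h]
  have e1 : (dorofeevTensor i q v i * dorofeevTensor i q v j) =
      (Grassmann.std F q (i : ℕ) * Grassmann.gen F (j : ℕ)) ⊗ₜ[F]
        dorofeevM (q + 1) (reflR v) := by
    rw [dorofeevTensor_self, dorofeevTensor_of_ne hij.symm, tmul_dorofeevM_mul]
  have e2 : (dorofeevTensor i q v j * dorofeevTensor i q v i) =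
      (Grassmann.std F q (i : ℕ) * Grassmann.gen F (j : ℕ)) ⊗ₜ[F]
        dorofeevM (q + 1) (reflL v) := by
    rw [dorofeevTensor_self, dorofeevTensor_of_ne hij.symm,
      mul_tmul_dorofeevM (Grassmann.std_mem q _)]
  rw [hprod, ← hl']
  cases b <;> cases c <;>
    simp only [leadOp, Bool.false_eq_true, if_true, if_false, e1, e2, dorofeevTensor_of_ne hz,
      tmul_dorofeevM_mul, mul_tmul_dorofeevM hg] <;>
    exact rmul_tmul_dorofeevM _ Fin.val l hl _ _ _

theorem tmul_dorofeevM_lin (g : Grassmann F) (q : ZMod 2) (n : ℕ) (a b : F) (v w : F × F) :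
    a • (g ⊗ₜ[F] dorofeevM q (reflR^[n] v)) + b • (g ⊗ₜ[F] dorofeevM q (reflR^[n] w)) =
      g ⊗ₜ[F] dorofeevM q (reflR^[n] (a • v + b • w)) := by
  have hr : reflR^[n] (a • v + b • w) = a • reflR^[n] v + b • reflR^[n] w := by
    induction n generalizing v w with
    | zero => rfl
    | succ n ih =>
      simp only [Function.iterate_succ, Function.comp_apply, ← ih]
      rfl
  rw [hr, dorofeevM_add, dorofeevM_smul, dorofeevM_smul, TensorProduct.tmul_add,
    TensorProduct.tmul_smul, TensorProduct.tmul_smul]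

theorem eq_zero_of_leadProd_tmul {i j : Fin (m + 4)} (hij : i ≠ j) {q q' : ZMod 2} {n : ℕ}
    {w : F × F} (hw : leadProd F i j q ⊗ₜ[F] dorofeevM q' (reflR^[n] w) = 0) : w = 0 :=
  reflR_iterate_eq_zero (dorofeevM_eq_zero (tmul_eq_zero_of_ne hw (leadProd_ne_zero hij q)))

/-- Transports the normal form from the envelope of `dorofeev` to G ⊗ `dorofeev`, where the basic
words have been computed. -/
theorem sum_basicWord_dorofeevTensor [CharZero F]
    {f : FreeNonUnitalNonAssocAlgebra F (Fin (m + 4))} (hf : IsMultilinearPoly f) {q : ZMod 2}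
    {c : Fin (m + 4) × Bool → F}
    (hc : ∀ A ∈ altMetabelian F, ∀ x : Fin (m + 4) → A.carrier,
      FreeNonUnitalNonAssocAlgebra.lift F x f = ∑ k, c k • evalWord x (basicWord k.1 k.2))
    {i : Fin (m + 4)} {v : F × F}
    (h : FreeNonUnitalNonAssocAlgebra.lift F (dorofeevPoint i q v)
      (superization (dorofeevParity i q) f) = 0) :
    ∑ k : Fin (m + 4) × Bool,
      c k • evalWord (dorofeevTensor i q v) (basicWord k.1 k.2) = 0 := by
  have hV : (dorofeev F).envelope ∈ altMetabelian F :=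
    (mem_superClass_iff _).2 dorofeev_isAltMetabelian
  let x : Fin (m + 4) → (dorofeev F).envelope.carrier := fun k =>
    envTmul (dorofeev F) (Grassmann.std_mem (F := F) (dorofeevParity i q k) (k : ℕ))
      (dorofeevPoint_mem i q v k)
  have h1 := congrArg (envIncl (dorofeev F)) (hc _ hV x)
  have h2 : envIncl (dorofeev F) (FreeNonUnitalNonAssocAlgebra.lift F x f) = 0 := by
    refine (lift_map (envIncl (dorofeev F)) (envIncl_mul _) x f).symm.trans ?_
    refine (lift_tmul hf (dorofeevParity i q) _ (fun k => Grassmann.std_mem _ _)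
      (dorofeevPoint i q v)).trans ?_
    rw [h, TensorProduct.tmul_zero]
  rw [h2, map_sum] at h1
  rw [h1]
  refine Finset.sum_congr rfl fun k _ => ?_
  rw [map_smul]
  exact congrArg _ (evalWord_comp (envIncl (dorofeev F)) (envIncl_mul _) x _)

theorem basicPair_zero : basicPair (0 : Fin (m + 4)) = (1, 0) := if_pos rfl

theorem basicPair_of_ne {k : Fin (m + 4)} (hk : k ≠ 0) : basicPair k = (0, k) := if_neg hk

/-- For such `i` only the leading pair (0,i) contains the module element. Its two words give the
vectors (-1,1) and (1,0), which are independent. -/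
theorem coeff_eq_zero_of_two_le {c : Fin (m + 4) × Bool → F} {q : ZMod 2} {i : Fin (m + 4)}
    (hi0 : i ≠ 0) (hi1 : i ≠ 1)
    (h : ∑ k : Fin (m + 4) × Bool,
      c k • evalWord (dorofeevTensor i q ((1, 0) : F × F)) (basicWord k.1 k.2) = 0) :
    c (i, true) = 0 ∧ c (i, false) = 0 := by
  rw [Fintype.sum_prod_type, Finset.sum_eq_single i] at h
  · simp only [Fintype.sum_bool] at h
    rw [evalWord_basicWord_dorofeev i 0 hi0 q (1, 0) i false true (basicPair_of_ne hi0),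
      evalWord_basicWord_dorofeev i 0 hi0 q (1, 0) i false false (basicPair_of_ne hi0),
      tmul_dorofeevM_lin] at h
    have h2 := eq_zero_of_leadProd_tmul hi0 h
    have h3 := congrArg Prod.fst h2
    have h4 := congrArg Prod.snd h2
    simp only [leadOp, reflR, reflL, Bool.false_eq_true, if_true, if_false, Prod.fst_add,
      Prod.snd_add, Prod.smul_fst, Prod.smul_snd, smul_eq_mul, Prod.fst_zero, Prod.snd_zero]
      at h3 h4
    constructor
    · linear_combination h4
    · linear_combination h3 + h4
  · intro k _ hk
    simp only [Fintype.sum_bool]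
    have h1 : (basicPair k).1 ≠ i ∧ (basicPair k).2 ≠ i := by
      by_cases hk0 : k = 0
      · subst hk0; rw [basicPair_zero]; exact ⟨Ne.symm hi1, Ne.symm hi0⟩
      · rw [basicPair_of_ne hk0]; exact ⟨Ne.symm hi0, hk⟩
    rw [evalWord_basicWord_of_ne i q _ k _ h1.1 h1.2,
      evalWord_basicWord_of_ne i q _ k _ h1.1 h1.2, smul_zero, smul_zero, add_zero]
  · simp

/-- With the module element at 0 or 1, the pairs (1,0) and (0,1) both contribute. The invertible
operator `reflR`^(m+1) and the common Grassmann factor cancel, which leaves one equation between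
vectors. -/
theorem leadOp_eq_zero {c : Fin (m + 4) × Bool → F} {q : ZMod 2} {i j : Fin (m + 4)} {b : Bool}
    (hij : i ≠ j) (h0 : basicPair 0 = if b then (i, j) else (j, i))
    (h1 : basicPair 1 = if !b then (i, j) else (j, i))
    (hc : ∀ i, i ≠ 0 → i ≠ 1 → c (i, true) = 0 ∧ c (i, false) = 0)
    (h : ∑ k : Fin (m + 4) × Bool,
      c k • evalWord (dorofeevTensor i q ((1, 0) : F × F)) (basicWord k.1 k.2) = 0) :
    (c (0, true) • leadOp b true ((1, 0) : F × F) + c (0, false) • leadOp b false ((1, 0) : F × F)) +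
      (c (1, true) • leadOp (!b) true ((1, 0) : F × F) + c (1, false) • leadOp (!b) false ((1, 0) : F × F)) = 0 := by
  have h10 : (0 : Fin (m + 4)) ≠ 1 := Fin.ne_of_val_ne (by simp)
  rw [Fintype.sum_prod_type, Fintype.sum_eq_add 0 1 h10] at h
  · simp only [Fintype.sum_bool] at h
    rw [evalWord_basicWord_dorofeev i j hij q (1, 0) 0 b true h0,
      evalWord_basicWord_dorofeev i j hij q (1, 0) 0 b false h0,
      evalWord_basicWord_dorofeev i j hij q (1, 0) 1 (!b) true h1,
      evalWord_basicWord_dorofeev i j hij q (1, 0) 1 (!b) false h1,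
      tmul_dorofeevM_lin, tmul_dorofeevM_lin] at h
    refine eq_zero_of_leadProd_tmul (q := q) (q' := q + 1 + 1 + (m + 1 : ℕ)) (n := m + 1) hij ?_
    rw [← h]
    have := (tmul_dorofeevM_lin (leadProd F i j q) (q + 1 + 1 + (m + 1 : ℕ)) (m + 1) 1 1
      (c (0, true) • leadOp b true ((1, 0) : F × F) + c (0, false) • leadOp b false ((1, 0) : F × F))
      (c (1, true) • leadOp (!b) true ((1, 0) : F × F) + c (1, false) • leadOp (!b) false ((1, 0) : F × F))).symm
    simpa only [one_smul] using this
  · intro k hk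
    simp [hc k hk.1 hk.2]

/-- In degree at least 4, the identities of metabelian alternative algebras are determined by
the values at one element of the module and copies of the odd generator. -/
theorem sat_of_dorofeev [CharZero F] {f : FreeNonUnitalNonAssocAlgebra F (Fin (m + 4))}
    (hf : IsMultilinearPoly f) (q : ZMod 2)
    (h : ∀ i (v : F × F), FreeNonUnitalNonAssocAlgebra.lift F (dorofeevPoint i q v)
      (superization (dorofeevParity i q) f) = 0) :
    ∀ A ∈ altMetabelian F, A.Sat f := by
  obtain ⟨c, hc⟩ := exists_normal_form hf
  have key := fun i v => sum_basicWord_dorofeevTensor hf hc (h i v)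
  have h10 : (1 : Fin (m + 4)) ≠ 0 := Fin.ne_of_val_ne (by simp)
  have hbig : ∀ i, i ≠ 0 → i ≠ 1 → c (i, true) = 0 ∧ c (i, false) = 0 := fun i hi0 hi1 =>
    coeff_eq_zero_of_two_le hi0 hi1 (key i (1, 0))
  have h0 := leadOp_eq_zero (b := false) h10.symm basicPair_zero (basicPair_of_ne h10) hbig
    (key 0 (1, 0))
  have h1 := leadOp_eq_zero (b := true) h10 basicPair_zero (basicPair_of_ne h10) hbig
    (key 1 (1, 0))
  have e1 := congrArg Prod.fst h0
  have e2 := congrArg Prod.snd h0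
  have e3 := congrArg Prod.fst h1
  have e4 := congrArg Prod.snd h1
  simp only [leadOp, reflR, reflL, Bool.false_eq_true, if_true, if_false, Bool.not_true,
    Bool.not_false, Prod.fst_add, Prod.snd_add, Prod.smul_fst, Prod.smul_snd, smul_eq_mul,
    Prod.fst_zero, Prod.snd_zero] at e1 e2 e3 e4
  -- With A, B = c(0,true), c(0,false) and C, D = c(1,true), c(1,false), the equations are B + C =
  -- A, A = D, A + D = C and B = C. Hence A = 2B and 4B = B.
  have three : (3 : F) ≠ 0 := three_ne_zero
  have hall : ∀ k, c k = 0 := by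
    have a1 : c (0, false) = 0 := by
      have : 3 * c (0, false) = 0 := by linear_combination 2 * e1 + e3 + e2 - e4
      exact (mul_eq_zero.1 this).resolve_left three
    have a2 : c (1, true) = 0 := by linear_combination e4 + a1
    have a3 : c (0, true) = 0 := by linear_combination -e1 + a1 + a2
    have a4 : c (1, false) = 0 := by linear_combination -e2 + a3
    rintro ⟨i, b⟩
    by_cases hi0 : i = 0
    · subst hi0; cases b
      · exact a1
      · exact a3
    · by_cases hi1 : i = 1
      · subst hi1; cases b
        · exact a4
        · exact a2
      · cases b
        · exact (hbig i hi0 hi1).2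
        · exact (hbig i hi0 hi1).1
  intro A hA x
  rw [hc A hA x]
  exact Finset.sum_eq_zero fun k _ => by rw [hall k, zero_smul]

end LargeDegree

/-! ### The superalgebra G ⊗ A of an ordinary algebra A. -/

section GrassmannTensor

variable {F : Type u} [Field F]

open Superalgebra

/-- The subspace `Gᵢ ⊗ A` of `G ⊗ A`. -/
def grassmannTensorPart (A : NAAlgebra F) (i : ZMod 2) :
    Submodule F (Grassmann F ⊗[F] A.carrier) :=
  Submodule.span F {z | ∃ g ∈ grassmannPart F i, ∃ a : A.carrier, z = g ⊗ₜ[F] a}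

theorem tmul_mem_grassmannTensorPart (A : NAAlgebra F) {i : ZMod 2} {g : Grassmann F}
    (hg : g ∈ grassmannPart F i) (a : A.carrier) : g ⊗ₜ[F] a ∈ grassmannTensorPart A i :=
  Submodule.subset_span ⟨g, hg, a, rfl⟩

/-- The two parts are eigenspaces of the grading involution for 1 and -1; this yields their
disjointness in `grassmannTensor`. -/
theorem rTensor_involute_of_mem (A : NAAlgebra F) (i : ZMod 2)
    (z : Grassmann F ⊗[F] A.carrier) (hz : z ∈ grassmannTensorPart A i) :
    LinearMap.rTensor A.carrier
      (CliffordAlgebra.involute (Q := (0 : QuadraticForm F (ℕ →₀ F)))).toLinearMap z =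
      (if i = 0 then 1 else -1 : ℤ) • z := by
  unfold grassmannTensorPart at hz
  induction hz using Submodule.span_induction with
  | mem z hz =>
    obtain ⟨g, hg, a, rfl⟩ := hz
    rw [LinearMap.rTensor_tmul]
    rcases zmod_two_cases i with rfl | rfl
    · simp [CliffordAlgebra.involute_eq_of_mem_even hg]
    · simp [CliffordAlgebra.involute_eq_of_mem_odd hg, TensorProduct.neg_tmul]
  | zero => simp
  | add x y _ _ hx hy => rw [map_add, hx, hy, smul_add]
  | smul c x _ hx => rw [map_smul, hx, smul_comm]

theorem eq_zero_of_span₃ {V : Type*} [AddCommGroup V] [Module F V] {H₁ H₂ H₃ : Set V}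
    {E : V → V → V → V} (h1 : ∀ b c, ∃ T : V →ₗ[F] V, ∀ a, E a b c = T a)
    (h2 : ∀ a c, ∃ T : V →ₗ[F] V, ∀ b, E a b c = T b)
    (h3 : ∀ a b, ∃ T : V →ₗ[F] V, ∀ c, E a b c = T c)
    (h : ∀ a ∈ H₁, ∀ b ∈ H₂, ∀ c ∈ H₃, E a b c = 0) {a b c : V} (ha : a ∈ Submodule.span F H₁)
    (hb : b ∈ Submodule.span F H₂) (hc : c ∈ Submodule.span F H₃) : E a b c = 0 := by
  have key : ∀ (H : Set V) (T : V →ₗ[F] V), (∀ x ∈ H, T x = 0) →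
      ∀ x ∈ Submodule.span F H, T x = 0 := by
    intro H T hT x hx
    have : Submodule.span F H ≤ LinearMap.ker T := Submodule.span_le.2 hT
    exact this hx
  obtain ⟨T, hT⟩ := h1 b c
  rw [hT]
  refine key H₁ T (fun a ha => ?_) a ha
  rw [← hT]
  obtain ⟨T, hT⟩ := h2 a c
  rw [hT]
  refine key H₂ T (fun b hb => ?_) b hb
  rw [← hT]
  obtain ⟨T, hT⟩ := h3 a b
  rw [hT]
  exact key H₃ T (fun c hc => by rw [← hT]; exact h a ha b hb c hc) c hc

variable [CharZero F]

/-- The superalgebra `G ⊗ A` with the parts `Gᵢ ⊗ A`. -/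
def grassmannTensor (A : NAAlgebra F) : Superalgebra F where
  carrier := Grassmann F ⊗[F] A.carrier
  part := grassmannTensorPart A
  isCompl := by
    constructor
    · rw [Submodule.disjoint_def]
      intro z h0 h1
      have e0 := rTensor_involute_of_mem A 0 z h0
      have e1 := rTensor_involute_of_mem A 1 z h1
      rw [e0] at e1
      have : (2 : F) • z = 0 := by
        rw [if_pos rfl, if_neg one_ne_zero, one_smul, neg_smul, one_smul] at e1
        rw [two_smul]
        nth_rewrite 1 [e1]
        exact neg_add_cancel z
      exact (smul_eq_zero.1 this).resolve_left two_ne_zero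
    · rw [codisjoint_iff, eq_top_iff]
      intro z _
      induction z with
      | zero => exact Submodule.zero_mem _
      | add x y hx hy => exact Submodule.add_mem _ (hx trivial) (hy trivial)
      | tmul g a =>
        have hg : g ∈ grassmannPart F 0 ⊔ grassmannPart F 1 := by
          rw [(CliffordAlgebra.evenOdd_isCompl (0 : QuadraticForm F (ℕ →₀ F))).sup_eq_top]
          trivial
        obtain ⟨g0, h0, g1, h1, rfl⟩ := Submodule.mem_sup.1 hg
        rw [TensorProduct.add_tmul]
        exact Submodule.add_mem_sup (tmul_mem_grassmannTensorPart A h0 a)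
          (tmul_mem_grassmannTensorPart A h1 a)
  mul_mem := by
    intro i j a b ha hb
    change a ∈ Submodule.span F _ at ha
    change b ∈ Submodule.span F _ at hb
    induction ha, hb using Submodule.span_induction₂ with
    | mem_mem x y hx hy =>
      obtain ⟨g, hg, a, rfl⟩ := hx
      obtain ⟨h, hh, b, rfl⟩ := hy
      rw [Algebra.TensorProduct.tmul_mul_tmul]
      exact tmul_mem_grassmannTensorPart A (SetLike.mul_mem_graded hg hh) _
    | zero_left y hy => rw [zero_mul]; exact Submodule.zero_mem _
    | zero_right x hx => rw [mul_zero]; exact Submodule.zero_mem _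
    | add_left x y z _ _ _ h₁ h₂ => rw [add_mul]; exact Submodule.add_mem _ h₁ h₂
    | add_right x y z _ _ _ h₁ h₂ => rw [mul_add]; exact Submodule.add_mem _ h₁ h₂
    | smul_left r x y _ _ h => rw [smul_mul_assoc]; exact Submodule.smul_mem _ r h
    | smul_right r x y _ _ h => rw [mul_smul_comm]; exact Submodule.smul_mem _ r h

/-- On pure tensors, exchanging two Grassmann factors produces the parity sign of the superidentity,
so that a common Grassmann factor multiplies the linearized identity of A. -/
theorem grassmannTensor_isAltMetabelian {A : NAAlgebra F} (hA : A ∈ altMetabelian F) :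
    (grassmannTensor A).IsAltMetabelian := by
  constructor
  · intro i j k a b c ha hb hc
    refine eq_zero_of_span₃ (F := F) (V := Grassmann F ⊗[F] A.carrier)
      (E := fun a b c => a * b * c - a * (b * c) + paritySign i j • (b * a * c - b * (a * c)))
      (fun b c => ⟨(LinearMap.mulRight F c).comp (LinearMap.mulRight F b) -
        LinearMap.mulRight F (b * c) + paritySign i j •
          ((LinearMap.mulRight F c).comp (LinearMap.mulLeft F b) -
            (LinearMap.mulLeft F b).comp (LinearMap.mulRight F c)), fun a => rfl⟩)
      (fun a c => ⟨(LinearMap.mulRight F c).comp (LinearMap.mulLeft F a) -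
        (LinearMap.mulLeft F a).comp (LinearMap.mulRight F c) + paritySign i j •
          ((LinearMap.mulRight F c).comp (LinearMap.mulRight F a) -
            LinearMap.mulRight F (a * c)), fun b => rfl⟩)
      (fun a b => ⟨LinearMap.mulLeft F (a * b) -
        (LinearMap.mulLeft F a).comp (LinearMap.mulLeft F b) + paritySign i j •
          (LinearMap.mulLeft F (b * a) -
            (LinearMap.mulLeft F b).comp (LinearMap.mulLeft F a)), fun c => rfl⟩)
      ?_ ha hb hc
    rintro _ ⟨g, hg, x, rfl⟩ _ ⟨h, hh, y, rfl⟩ _ ⟨k, hk, z, rfl⟩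
    simp only [Algebra.TensorProduct.tmul_mul_tmul, ← mul_assoc, Grassmann.graded_comm hg hh,
      smul_mul_assoc, ← TensorProduct.tmul_sub]
    rw [← TensorProduct.smul_tmul', ← smul_add, ← TensorProduct.tmul_add, left_alt_lin hA,
      TensorProduct.tmul_zero, smul_zero]
  · intro i j k a b c ha hb hc
    refine eq_zero_of_span₃ (F := F) (V := Grassmann F ⊗[F] A.carrier)
      (E := fun a b c => a * b * c - a * (b * c) + paritySign j k • (a * c * b - a * (c * b)))
      (fun b c => ⟨(LinearMap.mulRight F c).comp (LinearMap.mulRight F b) -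
        LinearMap.mulRight F (b * c) + paritySign j k •
          ((LinearMap.mulRight F b).comp (LinearMap.mulRight F c) -
            LinearMap.mulRight F (c * b)), fun a => rfl⟩)
      (fun a c => ⟨(LinearMap.mulRight F c).comp (LinearMap.mulLeft F a) -
        (LinearMap.mulLeft F a).comp (LinearMap.mulRight F c) + paritySign j k •
          (LinearMap.mulLeft F (a * c) -
            (LinearMap.mulLeft F a).comp (LinearMap.mulLeft F c)), fun b => rfl⟩)
      (fun a b => ⟨LinearMap.mulLeft F (a * b) -
        (LinearMap.mulLeft F a).comp (LinearMap.mulLeft F b) + paritySign j k •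
          ((LinearMap.mulRight F b).comp (LinearMap.mulLeft F a) -
            (LinearMap.mulLeft F a).comp (LinearMap.mulRight F b)), fun c => rfl⟩)
      ?_ ha hb hc
    rintro _ ⟨g, hg, x, rfl⟩ _ ⟨h, hh, y, rfl⟩ _ ⟨k, hk, z, rfl⟩
    simp only [Algebra.TensorProduct.tmul_mul_tmul, mul_assoc g, Grassmann.graded_comm hh hk,
      mul_smul_comm]
    rw [← TensorProduct.tmul_sub, ← TensorProduct.tmul_sub, ← TensorProduct.smul_tmul',
      ← smul_add, ← TensorProduct.tmul_add, right_alt_lin hA, TensorProduct.tmul_zero, smul_zero]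
  · intro a b c d
    change Grassmann F ⊗[F] A.carrier at a b c d
    change a * b * (c * d) = 0
    induction a with
    | zero => simp only [zero_mul]
    | add a a' h h' => simp only [add_mul, h, h', add_zero]
    | tmul g x =>
    induction b with
    | zero => simp only [zero_mul, mul_zero]
    | add a a' h h' => simp only [add_mul, mul_add, h, h', add_zero]
    | tmul g' x' =>
    induction c with
    | zero => simp only [zero_mul, mul_zero]
    | add a a' h h' => simp only [add_mul, mul_add, h, h', add_zero]
    | tmul h y =>
    induction d with
    | zero => simp only [mul_zero]
    | add a a' h h' => simp only [mul_add, h, h', add_zero]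
    | tmul h' y' =>
      simp only [Algebra.TensorProduct.tmul_mul_tmul, hA.2.2, TensorProduct.tmul_zero]

end GrassmannTensor

/-! ### Identities of degree at most 3, and the two generating free superalgebras. -/

section SmallDegree

variable {F : Type u} [Field F] {n : ℕ}

open Superalgebra

theorem superization_superization (p : Fin n → ZMod 2)
    (f : FreeNonUnitalNonAssocAlgebra F (Fin n)) : superization p (superization p f) = f := by
  induction f using MonoidAlgebra.induction_linear with
  | zero => simp [superization]
  | add f g hf hg => rw [superization_add, superization_add, hf, hg]
  | single w c =>
    rw [superization_single, superization_single, ← mul_assoc, ← Int.cast_mul,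
      koszulSign_mul_self, Int.cast_one, one_mul]

theorem IsMultilinearPoly.superization {f : FreeNonUnitalNonAssocAlgebra F (Fin n)}
    (hf : IsMultilinearPoly f) (p : Fin n → ZMod 2) : IsMultilinearPoly (superization p f) := by
  unfold _root_.superization
  rw [Finsupp.sum]
  refine Finset.sum_induction _ IsMultilinearPoly (fun _ _ => IsMultilinearPoly.add) ?_ ?_
  · intro w hw; simp at hw
  · exact fun w hw => isMultilinearPoly_single (hf w hw) _

/-- The value of a superpolynomial at elements `gᵢ ⊗ aᵢ` of `G ⊗ A`. -/
theorem lift_tmul_superization {A : NAAlgebra F} {f : FreeNonUnitalNonAssocAlgebra F (Fin n)}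
    (hf : IsMultilinearPoly f) (p : Fin n → ZMod 2) (g : Fin n → Grassmann F)
    (hg : ∀ i, g i ∈ grassmannPart F (p i)) (a : Fin n → A.carrier) :
    FreeNonUnitalNonAssocAlgebra.lift F (fun i => g i ⊗ₜ[F] a i) (superization p f) =
      ((List.finRange n).map g).prod ⊗ₜ[F] FreeNonUnitalNonAssocAlgebra.lift F a f := by
  rw [lift_tmul (hf.superization p) p g hg, superization_superization]

/-- The value of a multilinear polynomial with the first two arguments replaced. -/
theorem IsMultilinearPoly.bilinear {k : ℕ} {f : FreeNonUnitalNonAssocAlgebra F (Fin (k + 2))}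
    (hf : IsMultilinearPoly f) {A : Type*} [NonUnitalNonAssocRing A] [Module F A]
    [IsScalarTower F A A] [SMulCommClass F A A] (a : Fin (k + 2) → A) (s t : A) :
    FreeNonUnitalNonAssocAlgebra.lift F
        (Function.update (Function.update a 0 (s + t)) 1 (s + t)) f =
      FreeNonUnitalNonAssocAlgebra.lift F (Function.update (Function.update a 0 s) 1 s) f +
      FreeNonUnitalNonAssocAlgebra.lift F (Function.update (Function.update a 0 s) 1 t) f +
      FreeNonUnitalNonAssocAlgebra.lift F (Function.update (Function.update a 0 t) 1 s) f +
      FreeNonUnitalNonAssocAlgebra.lift F (Function.update (Function.update a 0 t) 1 t) f := by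
  have h01 : (0 : Fin (k + 2)) ≠ 1 := Fin.ne_of_val_ne (by simp)
  have h1 : ∀ u v w, FreeNonUnitalNonAssocAlgebra.lift F
      (Function.update (Function.update a 0 u) 1 (v + w)) f =
      FreeNonUnitalNonAssocAlgebra.lift F (Function.update (Function.update a 0 u) 1 v) f +
      FreeNonUnitalNonAssocAlgebra.lift F (Function.update (Function.update a 0 u) 1 w) f := by
    intro u v w
    obtain ⟨T, hT⟩ := hf.exists_linear (Function.update a 0 u) 1
    simp only [hT, map_add]
  have h2 : ∀ u v w, FreeNonUnitalNonAssocAlgebra.lift F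
      (Function.update (Function.update a 0 (v + w)) 1 u) f =
      FreeNonUnitalNonAssocAlgebra.lift F (Function.update (Function.update a 0 v) 1 u) f +
      FreeNonUnitalNonAssocAlgebra.lift F (Function.update (Function.update a 0 w) 1 u) f := by
    intro u v w
    obtain ⟨T, hT⟩ := hf.exists_linear (Function.update a 1 u) 0
    simp only [Function.update_comm h01, hT, map_add]
  rw [h1, h2, h2]
  abel

theorem finRange_map_prod {M : Type*} [Monoid M] {k : ℕ} (g : Fin (k + 2) → M)
    (hg : ∀ i : Fin k, g i.succ.succ = 1) : ((List.finRange (k + 2)).map g).prod = g 0 * g 1 := by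
  rw [List.finRange_succ, List.finRange_succ]
  simp only [List.map_cons, List.map_map, List.prod_cons]
  rw [List.prod_eq_one, mul_one]
  · rfl
  · intro x hx
    obtain ⟨i, _, rfl⟩ := List.mem_map.1 hx
    exact hg i

variable [CharZero F]

/-- There is one odd generator for each variable. Sending the i-th one to g_i ⊗ a_i, with distinct
Grassmann generators, returns a nonzero Grassmann product tensored with f(a). -/
theorem sat_of_freeSuper_zero_three (hn : n ≤ 3) {f : FreeNonUnitalNonAssocAlgebra F (Fin n)}
    (hf : IsMultilinearPoly f) (hC : (freeSuper (altMetabelian F) 0 3).SuperSatisfies f) :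
    ∀ A ∈ altMetabelian F, A.Sat f := by
  intro A hA a
  let b : Fin 0 ⊕ Fin 3 → Grassmann F ⊗[F] A.carrier := Sum.elim (fun _ => 0) fun k =>
    if h : (k : ℕ) < n then Grassmann.gen F (k : ℕ) ⊗ₜ[F] a ⟨k, h⟩ else 0
  have h := lift_superization_eq_zero hC (grassmannTensor A) (grassmannTensor_isAltMetabelian hA)
    b (by
      rintro (k | k)
      · exact Submodule.zero_mem _
      · change (if h : (k : ℕ) < n then Grassmann.gen F (k : ℕ) ⊗ₜ[F] a ⟨k, h⟩ else 0) ∈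
          grassmannTensorPart A 1
        split_ifs
        · exact tmul_mem_grassmannTensorPart A (Grassmann.gen_mem _) _
        · exact Submodule.zero_mem _) (fun i => Sum.inr (Fin.castLE hn i))
  have e := (lift_tmul_superization hf (fun _ => 1)
    (fun i => Grassmann.std F 1 (i : ℕ)) (fun i => Grassmann.std_mem 1 _) a)
  have e' : FreeNonUnitalNonAssocAlgebra.lift F
      (fun i : Fin n => Grassmann.std F 1 (i : ℕ) ⊗ₜ[F] a i) (superization (fun _ => 1) f) = 0 := by
    refine Eq.trans ?_ h
    congr 2
    funext i
    simp [Grassmann.std, b]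
  exact tmul_eq_zero_of_ne (e.symm.trans e') (Grassmann.prod_std_ne_zero (fun _ => 1) _
    Fin.val_injective _ (List.nodup_finRange n))

theorem sat_of_freeSuper_one_one_aux {k : ℕ} (hk : k ≤ 1)
    {f : FreeNonUnitalNonAssocAlgebra F (Fin (k + 2))}
    (hf : IsMultilinearPoly f) (hC : (freeSuper (altMetabelian F) 1 1).SuperSatisfies f) :
    ∀ A ∈ altMetabelian F, A.Sat f := by
  intro A hA a
  have h01 : (0 : Fin (k + 2)) ≠ 1 := Fin.ne_of_val_ne (by simp)
  -- As k ≤ 1, at most one variable exists besides 0 and 1.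
  have hlast : ∀ i : Fin (k + 2), i ≠ 0 → i ≠ 1 → i = Fin.last (k + 1) := by
    intro i h0 h1
    have h0' : (i : ℕ) ≠ 0 := fun h => h0 (Fin.ext (by simpa using h))
    have h1' : (i : ℕ) ≠ 1 := fun h => h1 (Fin.ext (by simpa using h))
    ext
    rw [Fin.val_last]
    omega
  have transfer : ∀ u ∈ grassmannTensorPart A 0, ∀ v ∈ grassmannTensorPart A 1,
      ∀ q : Fin (k + 2) → Fin 1 ⊕ Fin 1,
      FreeNonUnitalNonAssocAlgebra.lift F (fun i => Sum.elim (fun _ => u) (fun _ => v) (q i))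
        (superization (fun i => genParity (q i)) f) = 0 := by
    intro u hu v hv q
    exact lift_superization_eq_zero hC (grassmannTensor A) (grassmannTensor_isAltMetabelian hA)
      (Sum.elim (fun _ => u) (fun _ => v)) (by rintro (_ | _); exacts [hu, hv]) q
  set φ : A.carrier → A.carrier → A.carrier := fun s t => FreeNonUnitalNonAssocAlgebra.lift F
    (Function.update (Function.update a 0 s) 1 t) f with hφ
  -- The even generator serves variables 0 and 1, the odd one a possible third variable.
  have sym : ∀ s, φ s s = 0 := by
    intro s
    let q : Fin (k + 2) → Fin 1 ⊕ Fin 1 := fun i => if i = 0 ∨ i = 1 then Sum.inl 0 else Sum.inr 0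
    have h := transfer (1 ⊗ₜ s) (tmul_mem_grassmannTensorPart A Grassmann.one_mem s)
      (Grassmann.gen F (k + 1) ⊗ₜ a (Fin.last (k + 1)))
      (tmul_mem_grassmannTensorPart A (Grassmann.gen_mem _) _) q
    have e := lift_tmul_superization hf (fun i => genParity (q i))
      (fun i => Grassmann.std F (genParity (q i)) (i : ℕ)) (fun i => Grassmann.std_mem _ _)
      (Function.update (Function.update a 0 s) 1 s)
    refine tmul_eq_zero_of_ne ((e.symm.trans ?_).trans h) (Grassmann.prod_std_ne_zero _ _
      Fin.val_injective _ (List.nodup_finRange _))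
    congr 2
    funext i
    by_cases h0 : i = 0
    · subst h0; simp [q, genParity, Grassmann.std, h01]
    · by_cases h1 : i = 1
      · subst h1; simp [q, genParity, Grassmann.std]
      · simp only [q, h0, h1, or_self, if_false, genParity, Grassmann.std, if_true, Sum.elim_inr,
          ne_eq, not_false_eq_true, Function.update_of_ne]
        rw [hlast i h0 h1]
        rfl
  -- Parities reversed: both variables take the odd value g₀⊗s + g₁⊗t. The square terms vanish, and
  -- the cross terms give g₀g₁ ⊗ (φ s t - φ t s).
  have skew : ∀ s t, φ s t - φ t s = 0 := by
    intro s t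
    let q : Fin (k + 2) → Fin 1 ⊕ Fin 1 := fun i => if i = 0 ∨ i = 1 then Sum.inr 0 else Sum.inl 0
    let p : Fin (k + 2) → ZMod 2 := fun i => genParity (q i)
    let z : Fin (k + 2) → Grassmann F ⊗[F] A.carrier := fun i => 1 ⊗ₜ a i
    have h := transfer (1 ⊗ₜ a (Fin.last (k + 1)))
      (tmul_mem_grassmannTensorPart A Grassmann.one_mem _)
      (Grassmann.gen F 0 ⊗ₜ s + Grassmann.gen F 1 ⊗ₜ t)
      (Submodule.add_mem _ (tmul_mem_grassmannTensorPart A (Grassmann.gen_mem _) _)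
        (tmul_mem_grassmannTensorPart A (Grassmann.gen_mem _) _)) q
    have hv : ∀ v : Grassmann F ⊗[F] A.carrier,
        (fun i => Sum.elim (fun _ => (1 ⊗ₜ a (Fin.last (k + 1)) : Grassmann F ⊗[F] A.carrier))
          (fun _ => v) (q i)) = Function.update (Function.update z 0 v) 1 v := by
      intro v
      funext i
      by_cases h0 : i = 0
      · subst h0; simp [q, h01]
      · by_cases h1 : i = 1
        · subst h1; simp [q]
        · simp only [q, h0, h1, or_self, if_false, Sum.elim_inl, ne_eq, not_false_eq_true,
            Function.update_of_ne, z]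
          rw [hlast i h0 h1]
    rw [hv, (hf.superization p).bilinear] at h
    have val : ∀ (b c : ℕ) (x y : A.carrier), FreeNonUnitalNonAssocAlgebra.lift F
        (Function.update (Function.update z 0 (Grassmann.gen F b ⊗ₜ x)) 1
          (Grassmann.gen F c ⊗ₜ y)) (superization p f) =
        (Grassmann.gen F b * Grassmann.gen F c) ⊗ₜ φ x y := by
      intro b c x y
      let g : Fin (k + 2) → Grassmann F :=
        Function.update (Function.update (fun _ => 1) 0 (Grassmann.gen F b)) 1 (Grassmann.gen F c)
      have e := lift_tmul_superization hf p g (fun i => by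
        by_cases h0 : i = 0
        · subst h0
          simpa [p, q, genParity, g, h01] using Grassmann.gen_mem b
        · by_cases h1 : i = 1
          · subst h1
            simpa [p, q, genParity, g] using Grassmann.gen_mem c
          · simpa [p, q, genParity, g, h0, h1] using Grassmann.one_mem)
        (Function.update (Function.update a 0 x) 1 y)
      rw [finRange_map_prod g (fun i => by
        have h0 : i.succ.succ ≠ 0 := Fin.succ_ne_zero _
        have h1 : i.succ.succ ≠ 1 := Fin.ne_of_val_ne (by simp)
        simp [g, h0, h1])] at e
      have hg0 : g 0 = Grassmann.gen F b := by simp [g, h01]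
      have hg1 : g 1 = Grassmann.gen F c := by simp [g]
      rw [hg0, hg1] at e
      refine Eq.trans ?_ e
      congr 2
      funext i
      by_cases h0 : i = 0
      · subst h0; simp [g, h01]
      · by_cases h1 : i = 1
        · subst h1; simp [g]
        · simp [g, h0, h1, z]
    have sq : ∀ b : ℕ, Grassmann.gen F b * Grassmann.gen F b = 0 := fun b =>
      ExteriorAlgebra.ι_sq_zero _
    have anti : Grassmann.gen F 1 * Grassmann.gen F 0 =
        -(Grassmann.gen F 0 * Grassmann.gen F 1) := by
      rw [Grassmann.graded_comm (Grassmann.gen_mem 1) (Grassmann.gen_mem 0)]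
      simp [paritySign]
    rw [val, val, val, val, sq, sq, anti, TensorProduct.zero_tmul, TensorProduct.zero_tmul,
      zero_add, add_zero, TensorProduct.neg_tmul, ← sub_eq_add_neg, ← TensorProduct.tmul_sub] at h
    have hne : Grassmann.gen F 0 * Grassmann.gen F 1 ≠ 0 := by
      have := Grassmann.prod_gen_ne_zero (F := F) [0, 1] (by simp)
      simpa using this
    exact tmul_eq_zero_of_ne h hne
  have h1 := sym (a 0 + a 1)
  have h2 : φ (a 0 + a 1) (a 0 + a 1) = _ := hf.bilinear a (a 0) (a 1)
  rw [h1] at h2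
  change 0 = φ (a 0) (a 0) + φ (a 0) (a 1) + φ (a 1) (a 0) + φ (a 1) (a 1) at h2
  rw [sym, sym, zero_add, add_zero] at h2
  have h3 : (2 : F) • φ (a 0) (a 1) = 0 := by
    rw [two_smul]
    linear_combination (norm := abel) skew (a 0) (a 1) - h2
  have h4 := (smul_eq_zero.1 h3).resolve_left two_ne_zero
  simpa [hφ] using h4

theorem sat_of_freeSuper_one_one (hn : n ≤ 3) {f : FreeNonUnitalNonAssocAlgebra F (Fin n)}
    (hf : IsMultilinearPoly f) (hC : (freeSuper (altMetabelian F) 1 1).SuperSatisfies f) :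
    ∀ A ∈ altMetabelian F, A.Sat f := by
  intro A hA
  rcases n with _ | _ | k
  · intro a
    rw [lift_eq_sum, Finsupp.sum]
    refine Finset.sum_eq_zero fun w hw => ?_
    exact absurd (List.perm_nil.1 (hf w hw)) (wordLetters_ne_nil w)
  · intro a
    have h := lift_superization_eq_zero hC (grassmannTensor A)
      (grassmannTensor_isAltMetabelian hA) (Sum.elim (fun _ => 1 ⊗ₜ a 0) (fun _ => 0)) (by
        rintro (_ | _)
        · exact tmul_mem_grassmannTensorPart A Grassmann.one_mem _
        · exact Submodule.zero_mem _) (fun _ => Sum.inl 0)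
    have e := lift_tmul_superization hf (fun _ => 0) (fun _ => 1)
      (fun i => Grassmann.one_mem) a
    refine tmul_eq_zero_of_ne ((e.symm.trans ?_).trans h) (by simp)
    congr 2
    funext i
    rw [show i = 0 from Fin.ext (by omega)]
    rfl
  · exact sat_of_freeSuper_one_one_aux (by omega) hf hC A hA

/-- The free superalgebra on one even and one odd generator generates all superalgebras. -/
theorem supervarietyRS_one_one :
    supervarietyRS (altMetabelian F) 1 1 = superClass (altMetabelian F) := by
  refine supervarietyRS_eq fun n f hf hC => ?_
  rcases Nat.lt_or_ge n 4 with h | h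
  · exact sat_of_freeSuper_one_one (by omega) hf hC
  · obtain ⟨m, rfl⟩ := Nat.exists_eq_add_of_le' h
    refine sat_of_dorofeev hf 0 fun i v => ?_
    have h := lift_superization_eq_zero hC (dorofeev F) dorofeev_isAltMetabelian
      (Sum.elim (fun _ => dorofeevM 0 v) fun _ => dorofeevY F) (by
        rintro (_ | _)
        · exact dorofeevM_mem 0 v
        · exact dorofeevY_mem) (fun k => if k = i then Sum.inl 0 else Sum.inr 0)
    convert h using 3
    · funext k
      unfold dorofeevPoint
      split_ifs <;> rfl
    · funext k
      unfold dorofeevParity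
      split_ifs <;> rfl

/-- The free superalgebra on three odd generators generates all superalgebras. -/
theorem supervarietyRS_zero_three :
    supervarietyRS (altMetabelian F) 0 3 = superClass (altMetabelian F) := by
  refine supervarietyRS_eq fun n f hf hC => ?_
  rcases Nat.lt_or_ge n 4 with h | h
  · exact sat_of_freeSuper_zero_three (by omega) hf hC
  · obtain ⟨m, rfl⟩ := Nat.exists_eq_add_of_le' h
    refine sat_of_dorofeev hf 1 fun i v => ?_
    have h := lift_superization_eq_zero hC (dorofeev F) dorofeev_isAltMetabelian
      -- Two of the three odd generators suffice here; the third is needed only in degree 3.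
      (Sum.elim (fun _ => 0) fun j => if j = 0 then dorofeevM 1 v else dorofeevY F) (by
        rintro (j | j)
        · exact j.elim0
        · change (if j = 0 then dorofeevM 1 v else dorofeevY F) ∈ (dorofeev F).part 1
          split_ifs
          · exact dorofeevM_mem 1 v
          · exact dorofeevY_mem) (fun k => if k = i then Sum.inr 0 else Sum.inr 1)
    convert h using 3
    · funext k
      unfold dorofeevPoint
      split_ifs <;> simp
    · funext k
      unfold dorofeevParity
      split_ifs <;> rfl

end SmallDegree

/-! ### Nilpotency of right multiplications on products in finitely generated algebras. -/

section FinitelyGenerated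

variable {F : Type u} [Field F] {A : NAAlgebra F} {X : Type}

theorem rmul_smul (x : X → A.carrier) (l : List X) (c : F) (w : A.carrier) :
    rmul x (c • w) l = c • rmul x w l := by
  induction l generalizing w with
  | nil => rfl
  | cons i l ih => rw [rmul, smul_mul_assoc, ih, rmul]

theorem rmul_append_singleton {M : Type*} [Mul M] (x : X → M) (l : List X) (i : X) (w : M) :
    rmul x w (l ++ [i]) = rmul x w l * x i := by
  induction l generalizing w with
  | nil => rfl
  | cons j l ih => exact ih (w * x j)

theorem exists_rmul_eq_mul {M : Type*} [Mul M] (x : X → M) (l : List X) (a b : M) :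
    ∃ c d, rmul x (a * b) l = c * d := by
  induction l generalizing a b with
  | nil => exact ⟨a, b, rfl⟩
  | cons j l ih => exact ih (a * b) (x j)

/-- A repeated letter can be moved to the front twice up to sign, and R_x² = 0 on products since 2 ≠
0. -/
theorem rmul_eq_zero_of_not_nodup [CharZero F] (hA : A ∈ altMetabelian F) (x : X → A.carrier)
    {l : List X} (hl : ¬ l.Nodup) (a b : A.carrier) : rmul x (a * b) l = 0 := by
  obtain ⟨i, hi⟩ := List.exists_duplicate_iff_not_nodup.2 hl
  obtain ⟨l', hl'⟩ := (List.duplicate_iff_sublist.1 hi).exists_perm_append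
  have h : a * b * x i * x i = 0 := by
    have h1 := mul_right_right hA a b (x i) (x i)
    have h2 : (2 : F) • (a * b * x i * x i) = 0 := by
      rw [two_smul]
      exact eq_neg_iff_add_eq_zero.1 h1
    exact (smul_eq_zero.1 h2).resolve_left two_ne_zero
  have h' : rmul x (a * b) ([i, i] ++ l') = 0 := by
    change rmul x (a * b * x i * x i) l' = 0
    rw [h, rmul_zero_left]
  rcases rmul_perm hA x hl' a b with e | e
  · rw [e, h']
  · rw [e, h', neg_zero]

/-- In a metabelian alternative algebra that is generated by `r` elements, the product of more
than `r` right multiplications annihilates all products. -/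
theorem rmul_eq_zero_of_card_lt [CharZero F] (hA : A ∈ altMetabelian F) {Y : Type} [Fintype Y]
    (g : Y → A.carrier)
    (hg : ∀ u : A.carrier, u ∈ Submodule.span F (Set.range g ∪ {z | ∃ b c, z = b * c}))
    (x : X → A.carrier) (l : List X) (hl : Fintype.card Y < l.length) (a b : A.carrier) :
    rmul x (a * b) l = 0 := by
  -- The list `k` records arguments already replaced by generators. An argument that is itself a
  -- product contributes zero by metabelianity, and in the end the list of generators is too long to
  -- be free of repetitions.
  have key : ∀ (l : List X) (k : List Y), Fintype.card Y < k.length + l.length →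
      rmul x (rmul g (a * b) k) l = 0 := by
    intro l
    induction l with
    | nil =>
      intro k hk
      refine rmul_eq_zero_of_not_nodup hA g (fun h => ?_) a b
      have := h.length_le_card
      simp only [List.length_nil, add_zero] at hk
      omega
    | cons i l ih =>
      intro k hk
      rw [rmul]
      refine Submodule.span_induction (p := fun u _ => rmul x (rmul g (a * b) k * u) l = 0)
        ?_ ?_ ?_ ?_ (hg (x i))
      · rintro u (⟨j, rfl⟩ | ⟨c, d, rfl⟩)
        · rw [← rmul_append_singleton]
          refine ih _ ?_
          simp only [List.length_append, List.length_cons, List.length_nil] at hk ⊢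
          omega
        · obtain ⟨c', d', e⟩ := exists_rmul_eq_mul g k a b
          rw [e, hA.2.2, rmul_zero_left]
      · rw [mul_zero, rmul_zero_left]
      · intro u v _ _ hu hv
        rw [mul_add, rmul_add, hu, hv, add_zero]
      · intro c u _ hu
        rw [mul_smul_comm, rmul_smul, hu, smul_zero]
  exact key l [] (by simpa using hl)

theorem single_word_mul (v w : FreeMagma X) :
    (MonoidAlgebra.single (FreeMagma.mul v w) 1 : FreeNonUnitalNonAssocAlgebra F X) =
      MonoidAlgebra.single v 1 * MonoidAlgebra.single w 1 := by
  rw [MonoidAlgebra.single_mul_single, one_mul]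
  rfl

theorem proj_mem_span_freeGen (I : AlgIdeal (freeNA F X)) (u : I.quot.carrier) :
    u ∈ Submodule.span F ((Set.range fun q => I.proj (freeGen F q)) ∪
      {z | ∃ b c, z = b * c}) := by
  obtain ⟨z, rfl⟩ := I.proj_surjective u
  change FreeNonUnitalNonAssocAlgebra F X at z
  induction z using MonoidAlgebra.induction_linear with
  | zero =>
    have := map_zero I.proj
    exact this ▸ Submodule.zero_mem _
  | add f g hf hg =>
    have := map_add I.proj f g
    exact this ▸ Submodule.add_mem _ hf hg
  | single w c =>
    have e : (MonoidAlgebra.single w c : MonoidAlgebra F (FreeMagma X)) =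
        c • MonoidAlgebra.single w 1 := by simp
    have e' : I.proj (MonoidAlgebra.single w c : MonoidAlgebra F (FreeMagma X)) =
        c • I.proj (MonoidAlgebra.single w 1 : MonoidAlgebra F (FreeMagma X)) :=
      (congrArg I.proj e).trans (map_smul I.proj c _)
    rw [e']
    refine Submodule.smul_mem _ c (Submodule.subset_span ?_)
    induction w using FreeMagma.rec with
    | of q => exact Or.inl ⟨q, rfl⟩
    | mul v w _ _ =>
      refine Or.inr ⟨I.proj (MonoidAlgebra.single v 1 : MonoidAlgebra F (FreeMagma X)),
        I.proj (MonoidAlgebra.single w 1 : MonoidAlgebra F (FreeMagma X)), ?_⟩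
      exact (congrArg I.proj (single_word_mul v w)).trans (I.proj_mul _ _)

end FinitelyGenerated

/-! ### Infinite basic rank and the failure of the pairs (r, 0). -/

section InfiniteRank

variable {F : Type u} [Field F]

open Superalgebra

/-- Long products of right multiplications do not vanish in the Grassmann envelope of the
superalgebra `dorofeev F`. -/
theorem exists_evalWord_rmul_ne_zero {X : Type} (k : X → ℕ) (hk : Function.Injective k) (i : X)
    (l : List X) (hl : l.Nodup) (hi : i ∉ l) :
    ∃ x : X → (dorofeev F).envelope.carrier,
      evalWord x (rmul FreeMagma.of (FreeMagma.of i) l) ≠ 0 := by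
  classical
  let x : X → (dorofeev F).envelope.carrier := fun j =>
    if j = i then envTmul (dorofeev F) Grassmann.one_mem (dorofeevM_mem 0 (1, 0))
    else envTmul (dorofeev F) (Grassmann.gen_mem (k j)) dorofeevY_mem
  refine ⟨x, fun h => ?_⟩
  have h1 := congrArg (envIncl (dorofeev F)) h
  rw [map_zero, ← evalWord_comp (envIncl (dorofeev F)) (envIncl_mul _), evalWord_rmul,
    evalWord_of] at h1
  have hx : envIncl (dorofeev F) (x i) = 1 ⊗ₜ[F] dorofeevM 0 (1, 0) := by
    simp only [x, if_pos]
    exact envIncl_envTmul _ _ _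
  rw [hx, rmul_tmul_dorofeevM (fun j => envIncl (dorofeev F) (x j)) k l (fun j hj => by
    have : j ≠ i := by rintro rfl; exact hi hj
    simp only [x, if_neg this]
    exact envIncl_envTmul _ _ _), one_mul] at h1
  have h2 := reflR_iterate_eq_zero (dorofeevM_eq_zero (tmul_eq_zero_of_ne h1
    (Grassmann.prod_gen_ne_zero _ (hl.map hk))))
  exact one_ne_zero (congrArg Prod.fst h2)

theorem freeSuper_part_zero (V : Set (NAAlgebra F)) (r : ℕ) : (freeSuper V r 0).part 0 = ⊤ := by
  have hw : ∀ w : FreeMagma (Fin r ⊕ Fin 0), wordParity w = 0 := by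
    intro w
    induction w using FreeMagma.rec with
    | of q =>
      rcases q with _ | q
      · rfl
      · exact q.elim0
    | mul v w hv hw => exact (congrArg₂ (· + ·) hv hw).trans (add_zero 0)
  have h : wordPart F (Fin r) (Fin 0) 0 = ⊤ := by
    have h1 : wordPart F (Fin r) (Fin 0) 1 = ⊥ := by
      rw [wordPart, Submodule.span_eq_bot]
      rintro _ ⟨w, h, _⟩
      exact absurd ((hw w).symm.trans h) zero_ne_one
    have h2 := (isCompl_wordPart F (Fin r) (Fin 0)).sup_eq_top
    rwa [h1, sup_bot_eq] at h2
  have h' : (freeNASuper F (Fin r) (Fin 0)).part 0 = ⊤ := h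
  change ((freeNASuper F (Fin r) (Fin 0)).part 0).map _ = ⊤
  rw [h', Submodule.map_top, LinearMap.range_eq_top]
  exact AlgIdeal.proj_surjective _

theorem wordLetters_rmul {X : Type} (l : List X) (w : FreeMagma X) :
    wordLetters (rmul FreeMagma.of w l) = wordLetters w ++ l := by
  induction l generalizing w with
  | nil => simp [rmul]
  | cons i l ih =>
    rw [rmul, ih]
    change (wordLetters w ++ [i]) ++ l = _
    simp

variable [CharZero F]

theorem altMetabelian_hasInfiniteBasicRank : HasInfiniteBasicRank (altMetabelian F) := by
  intro r h
  -- After the leading product x₀x₁ there are r + 1 right multiplications, one more than the number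
  -- of generators.
  let l : List ℕ := List.range' 2 (r + 1)
  let w : FreeMagma ℕ := rmul FreeMagma.of (FreeMagma.of 0) (1 :: l)
  have h1 : (freeAlg (altMetabelian F) r).Satisfies (MonoidAlgebra.single w 1) := by
    intro a
    rw [lift_single, one_smul, evalWord_rmul]
    exact rmul_eq_zero_of_card_lt (freeAlg_mem F r) (freeAlgGen F)
      (proj_mem_span_freeGen _) a l (by simp [l]) (a 0) (a 1)
  have h2 : (dorofeev F).envelope ∈ altMetabelian F :=
    (mem_superClass_iff _).2 dorofeev_isAltMetabelian
  rw [← h] at h2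
  obtain ⟨x, hx⟩ := exists_evalWord_rmul_ne_zero (F := F) id Function.injective_id 0 (1 :: l)
    (by
      simp only [l, List.nodup_cons, List.mem_range']
      refine ⟨?_, List.nodup_range'⟩
      rintro ⟨x, _, hx⟩
      omega) (by
      simp only [l, List.mem_cons, List.mem_range', zero_ne_one, false_or]
      rintro ⟨x, _, hx⟩
      omega)
  refine hx ?_
  have h3 := h2 _ h1 x
  rwa [lift_single, one_smul] at h3

/-- Without odd elements the superidentities are the linearized ordinary ones, so bounds for
r-generated algebras apply to free superalgebras on r even generators. -/
theorem Superalgebra.IsAltMetabelian.mem_altMetabelian {A : Superalgebra F}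
    (hA : A.IsAltMetabelian) (h : A.part 0 = ⊤) : A.toNAAlgebra ∈ altMetabelian F := by
  have ht : ∀ a : A.carrier, a ∈ A.part 0 := fun a => h ▸ Submodule.mem_top
  refine ⟨fun x y => ?_, fun x y => ?_, hA.metab⟩
  · have e := hA.left_alt 0 0 0 x x y (ht x) (ht x) (ht y)
    rw [show paritySign 0 0 = 1 from rfl, one_smul, ← two_smul F] at e
    exact (smul_eq_zero.1 e).resolve_left two_ne_zero
  · have e := hA.right_alt 0 0 0 x y y (ht x) (ht y) (ht y)
    rw [show paritySign 0 0 = 1 from rfl, one_smul, ← two_smul F] at e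
    exact (smul_eq_zero.1 e).resolve_left two_ne_zero

/-- The free superalgebras without odd generators do not generate all superalgebras. -/
theorem supervarietyRS_zero_right_ne (r : ℕ) :
    supervarietyRS (altMetabelian F) r 0 ≠ superClass (altMetabelian F) := by
  intro h
  let l : List (Fin (r + 3)) := (List.finRange (r + 1)).map fun i => i.succ.succ
  have hl : List.finRange (r + 3) = 0 :: 1 :: l := by
    rw [List.finRange_succ, List.finRange_succ]
    simp [l, Function.comp_def]
  let w : FreeMagma (Fin (r + 3)) := rmul FreeMagma.of (FreeMagma.of 0) (1 :: l)
  have hw : wordLetters w = List.finRange (r + 3) := by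
    rw [hl]
    exact wordLetters_rmul _ _
  have hf : IsMultilinearPoly (MonoidAlgebra.single w 1 : FreeNonUnitalNonAssocAlgebra F _) :=
    isMultilinearPoly_single (by rw [hw]) 1
  have h1 : (freeSuper (altMetabelian F) r 0).SuperSatisfies (MonoidAlgebra.single w 1) := by
    intro p a _
    rw [superization_single, lift_single, evalWord_rmul]
    refine (congrArg _ ?_).trans (smul_zero _)
    exact rmul_eq_zero_of_card_lt
      ((freeSuper_isAltMetabelian r 0).mem_altMetabelian (freeSuper_part_zero _ r))
      (freeSuperGen F) (proj_mem_span_freeGen _) a l (by simp [l]) (a 0) (a 1)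
  have h2 : dorofeev F ∈ superClass (altMetabelian F) :=
    (mem_superClass_iff _).2 dorofeev_isAltMetabelian
  rw [← h] at h2
  have h3 := (superSatisfies_iff_envelope_sat _ hf).1 (h2 _ _ hf h1)
  have hnd := List.nodup_finRange (r + 3)
  rw [hl, List.nodup_cons] at hnd
  obtain ⟨x, hx⟩ := exists_evalWord_rmul_ne_zero (F := F) (fun i : Fin (r + 3) => (i : ℕ))
    Fin.val_injective 0 (1 :: l) hnd.2 hnd.1
  refine hx ?_
  have h4 := h3 x
  rwa [lift_single, one_smul] at h4

end InfiniteRank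

/-! ### The even superalgebra of polynomials without constant term modulo x⁴. -/

section Cube

/-- The space `F x ⊕ F x² ⊕ F x³`. -/
@[ext]
structure CubeSpace (F : Type u) where
  c₁ : F
  c₂ : F
  c₃ : F

namespace CubeSpace

variable {F : Type u}

/-- The coordinates of an element. -/
def coords : CubeSpace F ≃ F × F × F where
  toFun a := (a.c₁, a.c₂, a.c₃)
  invFun v := ⟨v.1, v.2.1, v.2.2⟩
  left_inv _ := rfl
  right_inv _ := rfl

variable [Field F]

instance : AddCommGroup (CubeSpace F) := coords.addCommGroup

instance : Module F (CubeSpace F) := coords.module F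

/-- The multiplication of polynomials without constant term modulo `x⁴`. -/
instance : Mul (CubeSpace F) where
  mul a b := ⟨0, a.c₁ * b.c₁, a.c₁ * b.c₂ + a.c₂ * b.c₁⟩

theorem add_def (a b : CubeSpace F) : a + b = ⟨a.c₁ + b.c₁, a.c₂ + b.c₂, a.c₃ + b.c₃⟩ := rfl

theorem smul_def (c : F) (a : CubeSpace F) : c • a = ⟨c * a.c₁, c * a.c₂, c * a.c₃⟩ := rfl

theorem zero_def : (0 : CubeSpace F) = ⟨0, 0, 0⟩ := rfl

theorem mul_def (a b : CubeSpace F) :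
    a * b = ⟨0, a.c₁ * b.c₁, a.c₁ * b.c₂ + a.c₂ * b.c₁⟩ := rfl

instance : NonUnitalNonAssocRing (CubeSpace F) where
  left_distrib a b c := by
    simp only [mul_def, add_def]
    ext <;> ring
  right_distrib a b c := by
    simp only [mul_def, add_def]
    ext <;> ring
  zero_mul a := by
    simp only [mul_def, zero_def]
    ext <;> ring
  mul_zero a := by
    simp only [mul_def, zero_def]
    ext <;> ring

instance : IsScalarTower F (CubeSpace F) (CubeSpace F) where
  smul_assoc c a b := by
    simp only [smul_eq_mul, mul_def, smul_def]
    ext <;> ring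

instance : SMulCommClass F (CubeSpace F) (CubeSpace F) where
  smul_comm c a b := by
    simp only [smul_eq_mul, mul_def, smul_def]
    ext <;> ring

theorem mul_mul_eq (a b c : CubeSpace F) : a * b * c = ⟨0, 0, a.c₁ * b.c₁ * c.c₁⟩ := by
  simp only [mul_def]
  ext <;> ring

theorem mul_mul_eq' (a b c : CubeSpace F) : a * (b * c) = ⟨0, 0, a.c₁ * b.c₁ * c.c₁⟩ := by
  simp only [mul_def]
  ext <;> ring

end CubeSpace

variable {F : Type u} [Field F]

/-- The purely even superalgebra `F x ⊕ F x² ⊕ F x³`. -/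
def cubeSuper (F : Type u) [Field F] : Superalgebra F where
  carrier := CubeSpace F
  part i := if i = 0 then ⊤ else ⊥
  isCompl := by
    rw [if_pos rfl, if_neg one_ne_zero]
    exact isCompl_top_bot
  mul_mem := by
    intro i j a b ha hb
    rcases zmod_two_cases i with rfl | rfl
    · rcases zmod_two_cases j with rfl | rfl
      · exact Submodule.mem_top
      · have : b = 0 := hb
        rw [this, mul_zero]
        exact Submodule.zero_mem _
    · have : a = 0 := ha
      rw [this, zero_mul]
      exact Submodule.zero_mem _

/-- The multiplication is associative, so all associators vanish, and a product of two products has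
degree at least 4. -/
theorem cubeSuper_isAltMetabelian : (cubeSuper F).IsAltMetabelian := by
  have h : ∀ a b c : (cubeSuper F).carrier, a * b * c - a * (b * c) = 0 := fun a b c =>
    sub_eq_zero.2 ((CubeSpace.mul_mul_eq a b c).trans (CubeSpace.mul_mul_eq' a b c).symm)
  refine ⟨fun i j k a b c _ _ _ => ?_, fun i j k a b c _ _ _ => ?_, fun a b c d => ?_⟩
  · rw [h, h, smul_zero, add_zero]
  · rw [h, h, smul_zero, add_zero]
  · refine (CubeSpace.mul_mul_eq a b (c * d)).trans ?_
    change (⟨0, 0, _ * _ * 0⟩ : CubeSpace F) = _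
    rw [mul_zero]
    rfl

end Cube

/-! ### The symmetrized cube and the failure of the pairs (0, s) with s ≤ 2. -/

section SymmetricProduct

variable {F : Type u} [Field F]

/-- The sum of the products `(x y) z` over all permutations of three variables. -/
def cubePoly (F : Type u) [Field F] : FreeNonUnitalNonAssocAlgebra F (Fin 3) :=
  MonoidAlgebra.single (wordL 0 1 2) 1 + MonoidAlgebra.single (wordL 1 0 2) 1 +
    MonoidAlgebra.single (wordL 0 2 1) 1 + MonoidAlgebra.single (wordL 2 0 1) 1 +
    MonoidAlgebra.single (wordL 1 2 0) 1 + MonoidAlgebra.single (wordL 2 1 0) 1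

theorem isMultilinearPoly_cubePoly : IsMultilinearPoly (cubePoly F) :=
  (((((isMultilinearPoly_single (by decide) _).add (isMultilinearPoly_single (by decide) _)).add
    (isMultilinearPoly_single (by decide) _)).add (isMultilinearPoly_single (by decide) _)).add
    (isMultilinearPoly_single (by decide) _)).add (isMultilinearPoly_single (by decide) _)

section

variable {A : Type*} [NonUnitalNonAssocRing A] [Module F A] [IsScalarTower F A A]
  [SMulCommClass F A A]

theorem lift_cubePoly (x : Fin 3 → A) : FreeNonUnitalNonAssocAlgebra.lift F x (cubePoly F) =
    x 0 * x 1 * x 2 + x 1 * x 0 * x 2 + x 0 * x 2 * x 1 + x 2 * x 0 * x 1 + x 1 * x 2 * x 0 +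
      x 2 * x 1 * x 0 := by
  simp only [cubePoly, map_add, lift_single, one_smul]
  rfl

theorem lift_superization_cubePoly (x : Fin 3 → A) :
    FreeNonUnitalNonAssocAlgebra.lift F x (superization (fun _ => 1) (cubePoly F)) =
      x 0 * x 1 * x 2 - x 1 * x 0 * x 2 - x 0 * x 2 * x 1 + x 2 * x 0 * x 1 + x 1 * x 2 * x 0 -
        x 2 * x 1 * x 0 := by
  have e : ∀ i j k : Fin 3, wordLetters (wordL i j k) = [i, j, k] := fun i j k => rfl
  simp only [cubePoly, superization_add, superization_single, map_add, lift_single, e, mul_one]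
  rw [show koszulSign (fun _ => 1) [(0 : Fin 3), 1, 2] = 1 by decide,
    show koszulSign (fun _ => 1) [(1 : Fin 3), 0, 2] = -1 by decide,
    show koszulSign (fun _ => 1) [(0 : Fin 3), 2, 1] = -1 by decide,
    show koszulSign (fun _ => 1) [(2 : Fin 3), 0, 1] = 1 by decide,
    show koszulSign (fun _ => 1) [(1 : Fin 3), 2, 0] = 1 by decide,
    show koszulSign (fun _ => 1) [(2 : Fin 3), 1, 0] = -1 by decide]
  simp only [Int.cast_one, Int.cast_neg, one_smul, neg_smul, sub_eq_add_neg]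
  rfl

end

/-- The homogeneous elements of the free superalgebra are combinations of generators and
products of homogeneous elements. -/
theorem mem_span_of_mem_freeSuper_part {r s : ℕ} (p : ZMod 2)
    {a : (freeSuper (altMetabelian F) r s).carrier}
    (ha : a ∈ (freeSuper (altMetabelian F) r s).part p) :
    a ∈ Submodule.span F {z | (∃ j, genParity j = p ∧ z = freeSuperGen F j) ∨
      ∃ q q', q + q' = p ∧ ∃ b ∈ (freeSuper (altMetabelian F) r s).part q,
        ∃ c ∈ (freeSuper (altMetabelian F) r s).part q', z = b * c} := by
  let π : FreeNonUnitalNonAssocAlgebra F (Fin r ⊕ Fin s) →ₗ[F]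
      (freeSuper (altMetabelian F) r s).carrier :=
    AlgIdeal.proj (AlgIdeal.inter (superIdeals (altMetabelian F) r s))
  have hmem : ∀ w : FreeMagma (Fin r ⊕ Fin s), π (MonoidAlgebra.single w 1) ∈
      (freeSuper (altMetabelian F) r s).part (wordParity w) := fun w =>
    ⟨_, (show _ ∈ wordPart F (Fin r) (Fin s) (wordParity w) from
      Submodule.subset_span ⟨w, rfl, rfl⟩), rfl⟩
  obtain ⟨z, hz, rfl⟩ := ha
  suffices h : wordPart F (Fin r) (Fin s) p ≤ (Submodule.span F _).comap π from h hz
  refine Submodule.span_le.2 ?_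
  rintro _ ⟨w, hw, rfl⟩
  refine Submodule.subset_span ?_
  cases w with
  | of j => exact Or.inl ⟨j, by rw [← hw]; cases j <;> rfl, rfl⟩
  | mul v w =>
    refine Or.inr ⟨_, _, hw, _, hmem v, _, hmem w, ?_⟩
    exact (congrArg π (single_word_mul v w)).trans (AlgIdeal.proj_mul _ _ _)

variable [CharZero F]

/-- Two of the six terms are products of two products. The other four cancel, because L_sR_t +
R_sR_t = -R_sL_t and R_sR_t and R_sL_t are skew in s and t. -/
theorem lift_cubePoly_eq_zero_of_mul {A : NAAlgebra F} (hA : A ∈ altMetabelian F)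
    (x : Fin 3 → A.carrier) (i : Fin 3) (a b : A.carrier) (hi : x i = a * b) :
    FreeNonUnitalNonAssocAlgebra.lift F x (cubePoly F) = 0 := by
  have key : ∀ s t : A.carrier, a * b * s * t + s * (a * b) * t + a * b * t * s +
      t * (a * b) * s = 0 := by
    intro s t
    rw [mul_left_right hA a b s t, mul_left_right hA a b t s, mul_right_left hA a b s t]
    abel
  have m := hA.2.2
  rw [lift_cubePoly]
  fin_cases i
  · have hi' : x 0 = a * b := hi
    simp only [hi', m]
    linear_combination (norm := abel) key (x 1) (x 2)
  · have hi' : x 1 = a * b := hi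
    simp only [hi', m]
    linear_combination (norm := abel) key (x 0) (x 2)
  · have hi' : x 2 = a * b := hi
    simp only [hi', m]
    linear_combination (norm := abel) key (x 0) (x 1)

open Superalgebra

theorem lift_superization_cubePoly_of_mul {C : Superalgebra F} (hC : C.IsAltMetabelian)
    {p : Fin 3 → ZMod 2} {a : Fin 3 → C.carrier} (ha : ∀ i, a i ∈ C.part (p i)) (i : Fin 3)
    {q q' : ZMod 2} {b c : C.carrier} (hb : b ∈ C.part q) (hc : c ∈ C.part q')
    (hq : q + q' = p i) (hi : a i = b * c) :
    FreeNonUnitalNonAssocAlgebra.lift F a (superization p (cubePoly F)) = 0 := by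
  -- Indices 3 and 4 are disjoint from the indices 0, 1, 2 of the variables, which keeps the total
  -- Grassmann product nonzero.
  let u := envTmul C (Grassmann.std_mem q 3) hb
  let v := envTmul C (Grassmann.std_mem q' 4) hc
  let x : Fin 3 → C.envelope.carrier := fun j =>
    if j = i then u * v else envTmul C (Grassmann.std_mem (p j) (j : ℕ)) (ha j)
  let g : Fin 3 → Grassmann F := fun j =>
    if j = i then Grassmann.std F q 3 * Grassmann.std F q' 4 else Grassmann.std F (p j) (j : ℕ)
  have h := lift_cubePoly_eq_zero_of_mul ((mem_superClass_iff C).2 hC) x i u v (if_pos rfl)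
  have h1 := congrArg (envIncl C) h
  rw [map_zero, ← lift_map (envIncl C) (envIncl_mul C)] at h1
  have hx : (fun j => envIncl C (x j)) = fun j => g j ⊗ₜ[F] a j := by
    funext j
    by_cases hj : j = i
    · subst hj
      simp only [x, g, if_pos]
      rw [envIncl_mul, envIncl_envTmul, envIncl_envTmul, Algebra.TensorProduct.tmul_mul_tmul, hi]
    · simp only [x, g, if_neg hj]
      exact envIncl_envTmul _ _ _
  have hg : ∀ j, g j ∈ grassmannPart F (p j) := by
    intro j
    by_cases hj : j = i
    · subst hj
      simp only [g, if_pos, ← hq]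
      exact SetLike.mul_mem_graded (Grassmann.std_mem q 3) (Grassmann.std_mem q' 4)
    · simp only [g, if_neg hj]
      exact Grassmann.std_mem _ _
  rw [hx, lift_tmul isMultilinearPoly_cubePoly p g hg] at h1
  refine tmul_eq_zero_of_ne h1 ?_
  have hne := Grassmann.prod_std_ne_zero (F := F) ![p 0, p 1, p 2, q, q']
    (fun j : Fin 5 => (j : ℕ)) Fin.val_injective
  fin_cases i
  · have := hne [3, 4, 1, 2] (by decide)
    simpa [g, List.finRange_succ, mul_assoc] using this
  · have := hne [0, 3, 4, 2] (by decide)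
    simpa [g, List.finRange_succ, mul_assoc] using this
  · have := hne [0, 1, 3, 4] (by decide)
    simpa [g, List.finRange_succ, mul_assoc] using this

/-- By multilinearity each argument is a generator or a product. A product gives zero; three
generators are all odd, and two of them coincide, which kills the skew-symmetric superpolynomial. -/
theorem freeSuper_zero_superSatisfies_cubePoly {s : ℕ} (hs : s ≤ 2) :
    (freeSuper (altMetabelian F) 0 s).SuperSatisfies (cubePoly F) := by
  intro p a ha
  refine lift_eq_zero_of_span (isMultilinearPoly_cubePoly.superization p) _ (fun z hz => ?_) a
    fun i => mem_span_of_mem_freeSuper_part (p i) (ha i)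
  have hz' : ∀ i, z i ∈ (freeSuper (altMetabelian F) 0 s).part (p i) := by
    intro i
    rcases hz i with ⟨j, hj, e⟩ | ⟨q, q', hq, b, hb, c, hc, e⟩
    · rw [e, ← hj]; exact freeSuperGen_mem j
    · rw [e, ← hq]; exact Superalgebra.mul_mem _ _ _ _ _ hb hc
  by_cases h : ∃ i, ∃ q q', q + q' = p i ∧ ∃ b ∈ (freeSuper (altMetabelian F) 0 s).part q,
      ∃ c ∈ (freeSuper (altMetabelian F) 0 s).part q', z i = b * c
  · obtain ⟨i, q, q', hq, b, hb, c, hc, e⟩ := h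
    exact lift_superization_cubePoly_of_mul (freeSuper_isAltMetabelian 0 s) hz' i hb hc hq e
  · have hgen : ∀ i, ∃ j : Fin s, p i = 1 ∧ z i = freeSuperGen F (Sum.inr j) := by
      intro i
      rcases hz i with ⟨j, hj, e⟩ | h'
      · rcases j with j | j
        · exact j.elim0
        · exact ⟨j, hj.symm, e⟩
      · exact absurd ⟨i, h'⟩ h
    choose k hk hzk using hgen
    obtain ⟨i, j, hij, hkij⟩ := Fintype.exists_ne_map_eq_of_card_lt k (by simp; omega)
    rw [show p = fun _ => 1 from funext hk, lift_superization_cubePoly]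
    have e : z i = z j := by rw [hzk, hzk, hkij]
    have cases3 : z 0 = z 1 ∨ z 0 = z 2 ∨ z 1 = z 2 := by
      fin_cases i <;> fin_cases j <;> first
        | exact absurd rfl hij
        | exact Or.inl e
        | exact Or.inl e.symm
        | exact Or.inr (Or.inl e)
        | exact Or.inr (Or.inl e.symm)
        | exact Or.inr (Or.inr e)
        | exact Or.inr (Or.inr e.symm)
    rcases cases3 with e | e | e <;> rw [e] <;> abel

/-- The free superalgebras on at most two odd generators do not generate all superalgebras. -/
theorem supervarietyRS_zero_left_ne {s : ℕ} (hs : s ≤ 2) :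
    supervarietyRS (altMetabelian F) 0 s ≠ superClass (altMetabelian F) := by
  intro h
  have h1 : cubeSuper F ∈ superClass (altMetabelian F) :=
    (mem_superClass_iff _).2 cubeSuper_isAltMetabelian
  rw [← h] at h1
  have h2 := (superSatisfies_iff_envelope_sat _ isMultilinearPoly_cubePoly).1
    (h1 _ _ isMultilinearPoly_cubePoly (freeSuper_zero_superSatisfies_cubePoly hs))
  let x : (cubeSuper F).carrier := (⟨1, 0, 0⟩ : CubeSpace F)
  have hx : x ∈ (cubeSuper F).part 0 :=
    (Submodule.mem_top : (⟨1, 0, 0⟩ : CubeSpace F) ∈ (⊤ : Submodule F (CubeSpace F)))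
  have h3 := h2 fun _ => envTmul (cubeSuper F) Grassmann.one_mem hx
  have h4 := congrArg (envIncl (cubeSuper F)) h3
  rw [map_zero, ← lift_map (envIncl (cubeSuper F)) (envIncl_mul _), lift_cubePoly] at h4
  simp only [envIncl_envTmul, Algebra.TensorProduct.tmul_mul_tmul, mul_one,
    ← TensorProduct.tmul_add] at h4
  have h5 := congrArg CubeSpace.c₃ (tmul_eq_zero_of_ne h4 one_ne_zero)
  have h6 : x * x * x = (⟨0, 0, 1⟩ : CubeSpace F) := by
    refine (CubeSpace.mul_mul_eq (⟨1, 0, 0⟩ : CubeSpace F) ⟨1, 0, 0⟩ ⟨1, 0, 0⟩).trans ?_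
    simp
  rw [h6] at h5
  -- At x = y = z the symmetrization equals 6x³.
  change (1 + 1 + 1 + 1 + 1 + 1 : F) = 0 at h5
  norm_num at h5

end SymmetricProduct

/-! ### Minimal pairs. -/

section Spectrum

theorem basicSpectrum_altMetabelian (F : Type u) [Field F] [CharZero F] :
    basicSpectrum (altMetabelian F) = {(1, 1), (0, 3)} := by
  -- Every generating pair dominates (1,1) or (0,3). Both of these generate and they are
  -- incomparable, so they are exactly the minimal pairs.
  have key : ∀ r s, supervarietyRS (altMetabelian F) r s = superClass (altMetabelian F) →
      (1 ≤ r ∧ 1 ≤ s) ∨ 3 ≤ s := by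
    intro r s h
    by_contra! hc
    rcases Nat.eq_zero_or_pos s with rfl | hs
    · exact supervarietyRS_zero_right_ne r h
    · rcases Nat.eq_zero_or_pos r with rfl | hr
      · exact supervarietyRS_zero_left_ne (Nat.le_of_lt_succ hc.2) h
      · exact absurd (hc.1 hr) (by omega)
  ext ⟨r, s⟩
  simp only [basicSpectrum, Set.mem_ofPred_eq, Set.mem_insert_iff, Set.mem_singleton_iff,
    Prod.mk.injEq]
  constructor
  · rintro ⟨h, hmin⟩
    rcases key r s h with ⟨hr, hs⟩ | hs
    · have := hmin (y := (1, 1)) supervarietyRS_one_one ⟨hr, hs⟩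
      exact Or.inl ⟨le_antisymm this.1 hr, le_antisymm this.2 hs⟩
    · have := hmin (y := (0, 3)) supervarietyRS_zero_three ⟨Nat.zero_le r, hs⟩
      exact Or.inr ⟨le_antisymm this.1 (Nat.zero_le r), le_antisymm this.2 hs⟩
  · rintro (⟨rfl, rfl⟩ | ⟨rfl, rfl⟩)
    · refine ⟨supervarietyRS_one_one, ?_⟩
      rintro ⟨r, s⟩ h ⟨hr, hs⟩
      rcases key r s h with h' | h'
      · exact h'
      · exact absurd (le_trans h' hs) (by norm_num)
    · refine ⟨supervarietyRS_zero_three, ?_⟩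
      rintro ⟨r, s⟩ h ⟨hr, hs⟩
      rcases key r s h with h' | h'
      · exact absurd (le_trans h'.1 hr) (by norm_num)
      · exact ⟨Nat.zero_le r, h'⟩

end Spectrum

end

theorem mainTheorem1 (F : Type*) [Field F] [CharZero F] :
    basicSpectrum (altMetabelian F) = {(1, 1), (0, 3)} ∧
      HasInfiniteBasicRank (altMetabelian F) := by
  exact ⟨basicSpectrum_altMetabelian F, altMetabelian_hasInfiniteBasicRank⟩
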